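/- Notation. Let $\mathbb T=\mathbb R/\mathbb Z$, $M_1=M_2=\mathbb T\times\mathbb R$, and let $M_1\times M_2$ have coordinates $(\theta_1,r_1,\theta_2,r_2)$, the flat (Euclidean) product metric $d$ and the symplectic form $d\theta_1\wedge dr_1+d\theta_2\wedge dr_2$. For $\omega=(\omega_1,\omega_2)\in\mathbb R^2$ let $T_0(\theta_1,r_1,\theta_2,r_2)=(\theta_1+\omega_1+r_1,\,r_1,\,\theta_2+\omega_2+r_2,\,r_2)$, and let $\mathcal T_{(r_1,r_2)}=\mathbb T^2\times\{(r_1,r_2)\}$. For $\alpha>1$ and $L>0$, $G^{\alpha,L}(M)$, with $M=M_1$ ($N=2$) or $M=M_1\times M_2$ ($N=4$), is the space of the $C^\infty$ functions $f$ on $M$ with $$\|f\|_{\alpha,L}=\sum_{\ell\in\mathbb N^N}\frac{L^{|\ell|\alpha}}{\ell!^{\alpha}}\ \sup_M|\partial^\ell f|<\infty .$$ A function is flat on a set if it vanishes there together with all its partial derivatives. When a function $H$ on $M_1\times M_2$ generates a complete Hamiltonian vector field, $\Phi^H$ denotes the time-$1$ map of its flow; a function on $M_1$ is also viewed as a function on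 $M_1\times M_2$ that does not depend on $(\theta_2,r_2)$. For $C,\gamma>0$ put $E_{C,\gamma}(\nu)=\exp(\exp(C\nu^{-\gamma}))$ for $\nu>0$ and $E^*_{C,\gamma}(\nu)=E_{C,\gamma}(\nu/|\ln\nu|)$ for $0<\nu<1$. A set $Z\subset M_1\times M_2$ is diffusive-$*$ for a map $T$ of $M_1\times M_2$ to itself, with constant $C$ and exponent $\gamma$, if there is a sequence $\nu_n\in(0,\tfrac12)$ with $\nu_n\to0$ such that for every $n$ and every $z\in Z$ there are a point $\hat z\in M_1\times M_2$ and an integer $t\ge1$ with $$d(\hat z,z)\le\nu_n,\qquad t\le E^*_{C,\gamma}(\nu_n),\qquad d(T^t\hat z,z)\ge E^*_{C,\gamma}(2\nu_n).$$ Theorem. Let $\alpha>1$ and $L>0$ be real and let $\gamma=\frac1{\alpha-1}$. There is a constant $C>0$, depending only on $\alpha$ and $L$, such that for every $\omega\in\mathbb R^2$ and every $\varepsilon>0$ there exist $u\in G^{\alpha,L}(M_1)$ and $v\in G^{\alpha,L}(M_1\times M_2)$, both $1$-periodic in $r_1$, and a closed set $X_\varepsilon\subset[0,1]$ with $\operatorname{Leb}(X_\varepsilon)\ge1-\varepsilon$,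 such that: (1) $u$ and $v$ are flat for $r_1\in X_\varepsilon+\mathbb Z$; (2) $\|u\|_{\alpha,L}+\|v\|_{\alpha,L}<\varepsilon$; (3) $u$ and $v$ generate complete Hamiltonian vector fields on $M_1\times M_2$ and, for each $(r_1,r_2)\in(X_\varepsilon+\mathbb Z)\times\mathbb R$, the torus $\mathcal T_{(r_1,r_2)}$ is invariant and diffusive-$*$ for $T=\Phi^v\circ\Phi^u\circ T_0$, with constant $C$ and exponent $\gamma$; moreover the union $\mathbb T\times(X_\varepsilon+\mathbb Z)\times M_2$ of all these tori is itself diffusive-$*$ for $T$, with constant $C$ and exponent $\gamma$. -/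

import Mathlib

open scoped ENNReal Topology Nat

noncomputable section

namespace ManyTori

/-! ### Multi-index derivatives and the uniform Gevrey norm on `ℝ^N` -/

/-- The partial derivative with respect to the `i`-th coordinate. -/
def pderiv {N : ℕ} (i : Fin N) (f : (Fin N → ℝ) → ℝ) : (Fin N → ℝ) → ℝ :=
  fun x => fderiv ℝ f x (Pi.single i 1)

/-- `∂^ℓ f = ∂_0^{ℓ 0} ∂_1^{ℓ 1} ⋯ ∂_{N-1}^{ℓ (N-1)} f`. -/
def multiDeriv {N : ℕ} (ℓ : Fin N → ℕ) (f : (Fin N → ℝ) → ℝ) : (Fin N → ℝ) → ℝ :=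
  (List.finRange N).foldr (fun i g => (pderiv i)^[ℓ i] g) f

/-- `‖f‖_{α,L} = ∑_ℓ L^{|ℓ| α} / (ℓ!)^α * sup |∂^ℓ f|`, with value in `[0, ∞]`. -/
def gevreyNorm {N : ℕ} (α L : ℝ) (f : (Fin N → ℝ) → ℝ) : ℝ≥0∞ :=
  ∑' ℓ : Fin N → ℕ,
    ENNReal.ofReal (L ^ (((∑ i, ℓ i : ℕ) : ℝ) * α) / ((∏ i, (ℓ i)! : ℕ) : ℝ) ^ α) *
      ⨆ x : Fin N → ℝ, ‖multiDeriv ℓ f x‖ₑ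

/-- `f` is a uniformly Gevrey-`(α, L)` function on `ℝ^N`. -/
def IsGevrey {N : ℕ} (α L : ℝ) (f : (Fin N → ℝ) → ℝ) : Prop :=
  ContDiff ℝ ((⊤ : ℕ∞) : WithTop ℕ∞) f ∧ gevreyNorm α L f < ⊤

/-- `f` vanishes on `S` together with all its partial derivatives. -/
def IsFlatOn {N : ℕ} (f : (Fin N → ℝ) → ℝ) (S : Set (Fin N → ℝ)) : Prop :=
  ∀ x ∈ S, ∀ ℓ : Fin N → ℕ, multiDeriv ℓ f x = 0

/-! ### The phase space `M₁ × M₂`, with `M₁ = M₂ = 𝕋 × ℝ`, and its flat (Euclidean) metric -/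

/-- The annulus `𝕋 × ℝ`, `𝕋 = ℝ / ℤ`. -/
abbrev Annulus : Type := WithLp 2 (UnitAddCircle × ℝ)

/-- The space `M₁ × M₂`. -/
abbrev Phase : Type := WithLp 2 (Annulus × Annulus)

/-- The point `(θ, r)` of the annulus. -/
def annulusPt (θ : UnitAddCircle) (r : ℝ) : Annulus := WithLp.toLp 2 (θ, r)

/-- The point `(z₁, z₂)` of `M₁ × M₂`. -/
def phasePt (z₁ z₂ : Annulus) : Phase := WithLp.toLp 2 (z₁, z₂)

/-- The universal covering `ℝ² → M₁`, in the coordinates `(θ₁, r₁)`. -/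
def annulusCover (x : Fin 2 → ℝ) : Annulus := annulusPt (x 0 : UnitAddCircle) (x 1)

/-- The universal covering `ℝ⁴ → M₁ × M₂`, in the coordinates `(θ₁, r₁, θ₂, r₂)`. -/
def phaseCover (x : Fin 4 → ℝ) : Phase :=
  phasePt (annulusPt (x 0 : UnitAddCircle) (x 1)) (annulusPt (x 2 : UnitAddCircle) (x 3))

/-- A function on `M₁`, viewed as a function on `M₁ × M₂`. -/
def extend (u : Annulus → ℝ) : Phase → ℝ := fun z => u z.fst

/-! ### Hamiltonian flows for `dθ₁ ∧ dr₁ + dθ₂ ∧ dr₂` -/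

/-- The vector field `θ_j' = ∂H/∂r_j`, `r_j' = -∂H/∂θ_j`, in the coordinates `(θ₁, r₁, θ₂, r₂)`. -/
def hamVectorField (H : (Fin 4 → ℝ) → ℝ) (x : Fin 4 → ℝ) : Fin 4 → ℝ :=
  ![pderiv 1 H x, -pderiv 0 H x, pderiv 3 H x, -pderiv 2 H x]

/-- `c : ℝ → ℝ⁴` is (the lift of) an integral curve, defined for all times, of the Hamiltonian
vector field generated by `H`. -/
def IsHamCurve (H : Phase → ℝ) (c : ℝ → Fin 4 → ℝ) : Prop :=
  ∀ t : ℝ, HasDerivAt c (hamVectorField (H ∘ phaseCover) (c t)) t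

/-- `H` generates a complete Hamiltonian vector field, and `Φ` is the time-`1` map of its flow. -/
def IsTimeOneMap (H : Phase → ℝ) (Φ : Phase → Phase) : Prop :=
  (∀ x : Fin 4 → ℝ, ∃ c : ℝ → Fin 4 → ℝ, IsHamCurve H c ∧ c 0 = x) ∧
  ∀ c : ℝ → Fin 4 → ℝ, IsHamCurve H c → Φ (phaseCover (c 0)) = phaseCover (c 1)

/-- The integrable twist map `F₀` (and `G₀`): `(θ, r) ↦ (θ + ω + r, r)`. -/
def twist (ω : ℝ) (z : Annulus) : Annulus :=
  annulusPt (z.fst + ((ω + z.snd : ℝ) : UnitAddCircle)) z.snd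

/-- `T₀ = F₀ × G₀`. -/
def T₀ (ω₁ ω₂ : ℝ) (z : Phase) : Phase := phasePt (twist ω₁ z.fst) (twist ω₂ z.snd)

/-- The torus `𝕋² × {(r₁, r₂)}`. -/
def torus (r₁ r₂ : ℝ) : Set Phase := {z | z.fst.snd = r₁ ∧ z.snd.snd = r₂}

/-- `X + ℤ`. -/
def addInt (X : Set ℝ) : Set ℝ := {r | ∃ x ∈ X, ∃ k : ℤ, r = x + k}

/-! ### Diffusive dynamics -/

/-- `E_{C,γ}(ν) = exp (exp (C ν^{-γ}))`. -/
def E (C γ ν : ℝ) : ℝ := Real.exp (Real.exp (C * ν ^ (-γ)))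

/-- `E*_{C,γ}(ν) = E_{C,γ}(ν / |ln ν|)`, for `0 < ν < 1`. -/
def Estar (C γ ν : ℝ) : ℝ := E C γ (ν / |Real.log ν|)

/-- The point `z` is `ν`-diffusive-`*` for `T` (with constant `C` and exponent `γ`). -/
def IsNuDiffusiveStarAt {M : Type*} [MetricSpace M] (C γ : ℝ) (T : M → M) (ν : ℝ) (z : M) :
    Prop :=
  ∃ (z' : M) (t : ℕ), 0 < t ∧ dist z' z ≤ ν ∧ (t : ℝ) ≤ Estar C γ ν ∧
    Estar C γ (2 * ν) ≤ dist (T^[t] z') z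

/-- The set `X` is diffusive-`*` for `T` (with constant `C` and exponent `γ`): for some sequence
`ν_n → 0` of positive numbers, all points of `X` are `ν_n`-diffusive-`*` for every `n`.
The bound `ν_n < 1/2` keeps `ν_n` and `2 ν_n` in the domain `(0, 1)` of `E*`. -/
def IsDiffusiveStar {M : Type*} [MetricSpace M] (C γ : ℝ) (T : M → M) (X : Set M) : Prop :=
  ∃ ν : ℕ → ℝ, (∀ n, 0 < ν n ∧ ν n < 1 / 2) ∧ Filter.Tendsto ν Filter.atTop (𝓝 0) ∧
    ∀ n, ∀ z ∈ X, IsNuDiffusiveStarAt C γ T (ν n) z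

end ManyTori

end

/-!
Write `Q = Q n` for a rapidly increasing sequence of integers. Near an action `r₁ = p / Q - ω₁`,
the map `T₀` acts on `Q θ₁` and `Q (r₁ + ω₁) - p` as an integrable twist map. A potential
`κ / (2π Q²) cos (2π Q θ₁)`, localized by a bump of width `1 / (Q log Q)` in `r₁`, turns this twist
map into the standard map of strength `κ`. By reversibility and an intermediate value argument, the
standard map has for every `m` an orbit that goes in exactly `2m` steps, with velocities at most
about `√κ`, from `1/2` to `3/2`. Since `κ` is small, such an orbit never leaves the region where
the bump is `1`, and it repeats forever. It spends a single step out of `2m` within about `√κ` of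
`1/2`, so that a bump in `θ₁` of width `√κ / (8 Q)` times `- sin (2π Q θ₂) / (4π Q m)` increases
`r₂` by `1 / (2m)` once in `2m` steps, provided that `Q θ₂` is an integer, and otherwise has no
effect: `r₂` grows linearly in time along these orbits, at speed `1 / (2m)²`.

A bump of width `w` has a Gevrey norm of order `exp (c w ^ (-γ))`. Hence the first bump allows
`κ = exp (- c (Q log Q) ^ γ)`, and the second one forces `m` to be of order
`exp (exp (c (Q log Q) ^ γ))`, which is the origin of the double exponential in `E*`.

For each order `Q`, keep only the resonances `p / Q` whose zones do not meet the zones of smaller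
order. Every action away from all the zones is then within about `1 / Q` of a kept resonance of
each order, so all the tori are approached by drifting orbits; the union of the zones of order `Q`
has measure of order `1 / log Q` per period, whose sum is as small as we like.
-/

noncomputable section

namespace ManyTori

/-! ### One-variable Gevrey bounds -/

/-- `f` is a Gevrey function of exponent `α`: it is smooth, and `|f⁽ᵏ⁾| ≤ A Rᵏ (k!)^α` for every
`k`. A function satisfying this bound with `R L^α ≤ 1 / 2` has norm at most `2 A` in `G^{α,L}`. -/
structure GevreyBound (α R A : ℝ) (f : ℝ → ℝ) : Prop where
  contDiff : ContDiff ℝ ((⊤ : ℕ∞) : WithTop ℕ∞) f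
  abs_iteratedDeriv_le : ∀ k x, |iteratedDeriv k f x| ≤ A * R ^ k * (k ! : ℝ) ^ α

theorem factorial_rpow_pos (α : ℝ) (k : ℕ) : 0 < (k ! : ℝ) ^ α :=
  Real.rpow_pos_of_pos (by exact_mod_cast k.factorial_pos) _

theorem factorial_rpow_mul_factorial_rpow_le {α : ℝ} (hα : 0 ≤ α) {i k : ℕ} (hik : i ≤ k) :
    (i ! : ℝ) ^ α * ((k - i)! : ℝ) ^ α ≤ (k ! : ℝ) ^ α := by
  rw [← Real.mul_rpow (by positivity) (by positivity)]
  refine Real.rpow_le_rpow (by positivity) ?_ hα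
  exact_mod_cast Nat.le_of_dvd k.factorial_pos (Nat.factorial_mul_factorial_dvd_factorial hik)

theorem iteratedDeriv_const_zero (k : ℕ) (x : ℝ) :
    iteratedDeriv k (fun _ : ℝ => (0 : ℝ)) x = 0 := by
  simp only [iteratedDeriv_const, ite_self]

theorem iteratedDeriv_eq_zero_of_eventuallyEq {f : ℝ → ℝ} {x : ℝ} (h : f =ᶠ[𝓝 x] fun _ => 0)
    (k : ℕ) : iteratedDeriv k f x = 0 := by
  rw [h.iteratedDeriv_eq k, iteratedDeriv_const_zero]

namespace GevreyBound

variable {α R A A' : ℝ} {f g : ℝ → ℝ}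

theorem nonneg (hf : GevreyBound α R A f) : 0 ≤ A := by
  simpa using (abs_nonneg _).trans (hf.abs_iteratedDeriv_le 0 0)

theorem contDiffAt (hf : GevreyBound α R A f) (n : ℕ) (x : ℝ) : ContDiffAt ℝ n f x :=
  hf.contDiff.contDiffAt.of_le (by exact_mod_cast le_top)

theorem mono (hf : GevreyBound α R A f) (hR : 0 ≤ R) (h : A ≤ A') : GevreyBound α R A' f where
  contDiff := hf.contDiff
  abs_iteratedDeriv_le k x := (hf.abs_iteratedDeriv_le k x).trans <| by
    have := (factorial_rpow_pos α k).le
    gcongr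

theorem const (hR : 0 ≤ R) (c : ℝ) : GevreyBound α R |c| (fun _ => c) where
  contDiff := contDiff_const
  abs_iteratedDeriv_le k x := by
    have := (factorial_rpow_pos α k).le
    rw [iteratedDeriv_const]
    rcases eq_or_ne k 0 with rfl | hk
    · simp
    · rw [if_neg hk, abs_zero]
      positivity

theorem const_mul (hf : GevreyBound α R A f) (c : ℝ) :
    GevreyBound α R (|c| * A) (fun x => c * f x) where
  contDiff := contDiff_const.mul hf.contDiff
  abs_iteratedDeriv_le k x := by
    rw [iteratedDeriv_const_mul_field, abs_mul, mul_assoc |c|, mul_assoc |c|]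
    exact mul_le_mul_of_nonneg_left (hf.abs_iteratedDeriv_le k x) (abs_nonneg c)

theorem comp_add_const (hf : GevreyBound α R A f) (c : ℝ) :
    GevreyBound α R A (fun x => f (x + c)) where
  contDiff := hf.contDiff.comp (contDiff_id.add contDiff_const)
  abs_iteratedDeriv_le k x := by
    rw [iteratedDeriv_comp_add_const]
    exact hf.abs_iteratedDeriv_le k _

theorem comp_const_sub (hf : GevreyBound α R A f) (c : ℝ) :
    GevreyBound α R A (fun x => f (c - x)) where
  contDiff := hf.contDiff.comp (contDiff_const.sub contDiff_id)
  abs_iteratedDeriv_le k x := by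
    rw [iteratedDeriv_comp_const_sub]
    simpa [abs_mul] using hf.abs_iteratedDeriv_le k _

theorem abs_leibniz_term_le (hα : 0 ≤ α) (hR : 0 ≤ R) (hf : GevreyBound α R A f)
    (hg : GevreyBound α R A' g) {i k : ℕ} (hik : i ≤ k) (x : ℝ) :
    |(k.choose i : ℝ) * iteratedDeriv i f x * iteratedDeriv (k - i) g x| ≤
      k.choose i * (A * A' * R ^ k * (k ! : ℝ) ^ α) := by
  have hA := hf.nonneg
  have hA' := hg.nonneg
  have := (factorial_rpow_pos α i).le
  have := (factorial_rpow_pos α (k - i)).le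
  rw [abs_mul, abs_mul, Nat.abs_cast, mul_assoc]
  refine mul_le_mul_of_nonneg_left ?_ (by positivity)
  calc |iteratedDeriv i f x| * |iteratedDeriv (k - i) g x|
      ≤ (A * R ^ i * (i ! : ℝ) ^ α) * (A' * R ^ (k - i) * ((k - i)! : ℝ) ^ α) := by
        gcongr
        exacts [hf.abs_iteratedDeriv_le i x, hg.abs_iteratedDeriv_le (k - i) x]
    _ = A * A' * (R ^ i * R ^ (k - i)) * ((i ! : ℝ) ^ α * ((k - i)! : ℝ) ^ α) := by ring
    _ ≤ A * A' * R ^ k * (k ! : ℝ) ^ α := by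
        rw [← pow_add, Nat.add_sub_cancel' hik]
        gcongr
        exact factorial_rpow_mul_factorial_rpow_le hα hik

theorem mul (hα : 0 ≤ α) (hR : 0 ≤ R) (hf : GevreyBound α R A f) (hg : GevreyBound α R A' g) :
    GevreyBound α (2 * R) (A * A') (fun x => f x * g x) where
  contDiff := hf.contDiff.mul hg.contDiff
  abs_iteratedDeriv_le k x := by
    have leibniz : iteratedDeriv k (fun x => f x * g x) x = ∑ i ∈ Finset.range (k + 1),
        (k.choose i : ℝ) * iteratedDeriv i f x * iteratedDeriv (k - i) g x :=
      iteratedDeriv_mul (hf.contDiffAt k x) (hg.contDiffAt k x)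
    have sum_choose : ∑ i ∈ Finset.range (k + 1), (k.choose i : ℝ) = 2 ^ k := by
      exact_mod_cast Nat.sum_range_choose k
    calc |iteratedDeriv k (fun x => f x * g x) x|
        ≤ ∑ i ∈ Finset.range (k + 1),
          |(k.choose i : ℝ) * iteratedDeriv i f x * iteratedDeriv (k - i) g x| := by
          rw [leibniz]
          exact Finset.abs_sum_le_sum_abs _ _
      _ ≤ ∑ i ∈ Finset.range (k + 1), k.choose i * (A * A' * R ^ k * (k ! : ℝ) ^ α) :=
          Finset.sum_le_sum fun i hi =>
            abs_leibniz_term_le hα hR hf hg (Nat.lt_succ_iff.1 (Finset.mem_range.1 hi)) x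
      _ = A * A' * (2 * R) ^ k * (k ! : ℝ) ^ α := by
          rw [← Finset.sum_mul, sum_choose, mul_pow]
          ring

theorem of_locally (hf : GevreyBound α R A f) (hR : 0 ≤ R)
    (hg : ∀ x, g =ᶠ[𝓝 x] (fun _ => 0) ∨ ∃ c, g =ᶠ[𝓝 x] (fun y => f (y - c))) :
    GevreyBound α R A g where
  contDiff := contDiff_iff_contDiffAt.2 fun x => by
    rcases hg x with h | ⟨c, h⟩
    · exact contDiffAt_const.congr_of_eventuallyEq h
    · exact (hf.contDiff.comp (contDiff_id.sub contDiff_const)).contDiffAt.congr_of_eventuallyEq h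
  abs_iteratedDeriv_le k x := by
    have hA := hf.nonneg
    have := (factorial_rpow_pos α k).le
    rcases hg x with h | ⟨c, h⟩
    · rw [iteratedDeriv_eq_zero_of_eventuallyEq h, abs_zero]
      positivity
    · rw [h.iteratedDeriv_eq k, iteratedDeriv_comp_sub_const]
      exact hf.abs_iteratedDeriv_le k _

end GevreyBound

theorem iteratedDeriv_sin_mul_add (a : ℝ) (k : ℕ) (b : ℝ) :
    iteratedDeriv k (fun x => Real.sin (a * x + b)) =
      fun x => a ^ k * Real.sin (a * x + (b + k * (Real.pi / 2))) := by
  induction k generalizing b with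
  | zero => simp
  | succ k ih =>
    have deriv_eq : deriv (fun x => Real.sin (a * x + b)) =
        fun x => a * Real.sin (a * x + (b + Real.pi / 2)) := by
      funext x
      have : HasDerivAt (fun x => Real.sin (a * x + b)) (Real.cos (a * x + b) * (a * 1)) x :=
        (((hasDerivAt_id x).const_mul a).add_const b).sin
      rw [this.deriv, ← add_assoc, Real.sin_add_pi_div_two]
      ring
    funext x
    rw [iteratedDeriv_succ', deriv_eq, iteratedDeriv_const_mul_field, ih]
    push_cast
    ring_nf

theorem pow_le_exp_mul_factorial_rpow {α y : ℝ} (hα : 0 < α) (hy : 0 ≤ y) (k : ℕ) :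
    y ^ k ≤ Real.exp (α * y ^ (1 / α)) * (k ! : ℝ) ^ α := by
  have pow_le : (y ^ (1 / α)) ^ k ≤ Real.exp (y ^ (1 / α)) * (k ! : ℝ) :=
    (div_le_iff₀ (by exact_mod_cast k.factorial_pos)).1
      (Real.pow_div_factorial_le_exp (y ^ (1 / α)) (by positivity) k)
  have rpow_eq : ((y ^ (1 / α)) ^ k) ^ α = y ^ k := by
    rw [← Real.rpow_natCast, ← Real.rpow_mul hy, ← Real.rpow_mul hy, mul_right_comm,
      one_div_mul_cancel hα.ne', one_mul, Real.rpow_natCast]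
  calc y ^ k = ((y ^ (1 / α)) ^ k) ^ α := rpow_eq.symm
    _ ≤ (Real.exp (y ^ (1 / α)) * (k ! : ℝ)) ^ α := Real.rpow_le_rpow (by positivity) pow_le hα.le
    _ = Real.exp (α * y ^ (1 / α)) * (k ! : ℝ) ^ α := by
        rw [Real.mul_rpow (by positivity) (by positivity), ← Real.exp_mul, mul_comm α]

theorem GevreyBound.sin_mul_add {α R a : ℝ} (hα : 0 < α) (hR : 0 < R) (ha : 0 ≤ a) (b : ℝ) :
    GevreyBound α R (Real.exp (α * (a / R) ^ (1 / α))) (fun x => Real.sin (a * x + b)) where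
  contDiff := by fun_prop
  abs_iteratedDeriv_le k x := by
    rw [iteratedDeriv_sin_mul_add, abs_mul, abs_of_nonneg (by positivity)]
    calc a ^ k * |Real.sin (a * x + (b + k * (Real.pi / 2)))|
        ≤ a ^ k * 1 := by gcongr; exact Real.abs_sin_le_one _
      _ = (a / R) ^ k * R ^ k := by rw [mul_one, ← mul_pow, div_mul_cancel₀ _ hR.ne']
      _ ≤ (Real.exp (α * (a / R) ^ (1 / α)) * (k ! : ℝ) ^ α) * R ^ k := by
          gcongr
          exact pow_le_exp_mul_factorial_rpow hα (by positivity) k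
      _ = Real.exp (α * (a / R) ^ (1 / α)) * R ^ k * (k ! : ℝ) ^ α := by ring

/-! ### The flat function `exp (-λ x^{-γ})` -/

/-- The smooth function equal to `exp (-λ x^{-γ})` for `x > 0` and to `0` for `x ≤ 0`, which is
Gevrey of exponent `1 + 1 / γ` and from which all the bumps are built. -/
def flatExp (lam γ : ℝ) (x : ℝ) : ℝ := if 0 < x then Real.exp (-lam * x ^ (-γ)) else 0

theorem flatExp_nonneg (lam γ x : ℝ) : 0 ≤ flatExp lam γ x := by
  rw [flatExp]
  split_ifs <;> positivity

theorem flatExp_of_nonpos {lam γ x : ℝ} (hx : x ≤ 0) : flatExp lam γ x = 0 :=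
  if_neg (not_lt.2 hx)

theorem exp_le_flatExp {lam γ x y : ℝ} (hlam : 0 ≤ lam) (hγ : 0 ≤ γ) (hy : 0 < y) (hyx : y ≤ x) :
    Real.exp (-lam * y ^ (-γ)) ≤ flatExp lam γ x := by
  rw [flatExp, if_pos (hy.trans_le hyx), Real.exp_le_exp, neg_mul, neg_mul, neg_le_neg_iff]
  exact mul_le_mul_of_nonneg_left (Real.rpow_le_rpow_of_nonpos hy hyx (by linarith)) hlam

theorem hasDerivAt_iteratedDeriv_re {H : ℂ → ℂ} {f : ℝ → ℝ} {k : ℕ}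
    (hH : ∀ x : ℝ, 0 < x → AnalyticAt ℂ H x)
    (hf : ∀ x : ℝ, 0 < x → iteratedDeriv k f x = (iteratedDeriv k H x).re) {x : ℝ} (hx : 0 < x) :
    HasDerivAt (iteratedDeriv k f) (iteratedDeriv (k + 1) H x).re x := by
  have hasDerivAt_H : HasDerivAt (iteratedDeriv k H) (iteratedDeriv (k + 1) H x) (x : ℂ) := by
    rw [iteratedDeriv_succ, iteratedDeriv_eq_iterate]
    exact ((hH x hx).iterated_deriv k).differentiableAt.hasDerivAt
  refine hasDerivAt_H.real_of_complex.congr_of_eventuallyEq ?_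
  filter_upwards [lt_mem_nhds hx] with y hy using hf y hy

theorem iteratedDeriv_re {H : ℂ → ℂ} {f : ℝ → ℝ} (hH : ∀ x : ℝ, 0 < x → AnalyticAt ℂ H x)
    (hf : ∀ x : ℝ, 0 < x → f x = (H x).re) (k : ℕ) {x : ℝ} (hx : 0 < x) :
    iteratedDeriv k f x = (iteratedDeriv k H x).re := by
  induction k generalizing x with
  | zero => simpa using hf x hx
  | succ k ih =>
    rw [iteratedDeriv_succ, (hasDerivAt_iteratedDeriv_re hH (fun _ hy => ih hy) hx).deriv]

theorem exists_half_le_re_cpow (γ : ℝ) :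
    ∃ κ : ℝ, 0 < κ ∧ κ < 1 ∧ ∀ ζ : ℂ, ‖ζ - 1‖ ≤ κ → 1 / 2 ≤ (ζ ^ (-(γ : ℂ))).re := by
  have continuousAt_re : ContinuousAt (fun ζ : ℂ => (ζ ^ (-(γ : ℂ))).re) 1 :=
    Complex.continuous_re.continuousAt.comp
      (continuousAt_cpow_const (b := -(γ : ℂ)) Complex.one_mem_slitPlane)
  have eventually_lt : ∀ᶠ ζ : ℂ in 𝓝 1, 1 / 2 < (ζ ^ (-(γ : ℂ))).re :=
    continuousAt_re.eventually_const_lt (by norm_num)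
  obtain ⟨δ, hδ, h⟩ := Metric.eventually_nhds_iff.1 eventually_lt
  refine ⟨min (δ / 2) (1 / 2), by positivity, (min_le_right _ _).trans_lt (by norm_num),
    fun ζ hζ => (h ?_).le⟩
  rw [dist_eq_norm]
  linarith [min_le_left (δ / 2) (1 / 2 : ℝ)]

theorem ofReal_mul_cpow {x : ℝ} (hx : 0 < x) {ζ : ℂ} (hζ : ζ ≠ 0) (γ : ℝ) :
    ((x : ℂ) * ζ) ^ (-(γ : ℂ)) = ((x ^ (-γ) : ℝ) : ℂ) * ζ ^ (-(γ : ℂ)) := by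
  have hx0 : (x : ℂ) ≠ 0 := by exact_mod_cast hx.ne'
  rw [Complex.cpow_def_of_ne_zero (mul_ne_zero hx0 hζ), Complex.log_ofReal_mul hx hζ, add_mul,
    Complex.exp_add, ← Complex.cpow_def_of_ne_zero hζ, Complex.ofReal_cpow hx.le,
    Complex.cpow_def_of_ne_zero hx0, Complex.ofReal_log hx.le, Complex.ofReal_neg]

/-- The holomorphic extension of `exp (-λ x^{-γ})` to the slit plane. -/
def cexpCpow (lam γ : ℝ) (z : ℂ) : ℂ := Complex.exp (-(lam : ℂ) * z ^ (-(γ : ℂ)))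

theorem analyticAt_cexpCpow (lam γ : ℝ) {z : ℂ} (hz : z ∈ Complex.slitPlane) :
    AnalyticAt ℂ (cexpCpow lam γ) z :=
  (analyticAt_const.mul (analyticAt_id.cpow analyticAt_const hz)).cexp

theorem re_cexpCpow_ofReal (lam γ : ℝ) {x : ℝ} (hx : 0 < x) :
    (cexpCpow lam γ x).re = Real.exp (-lam * x ^ (-γ)) := by
  have : cexpCpow lam γ x = ((Real.exp (-lam * x ^ (-γ)) : ℝ) : ℂ) := by
    rw [cexpCpow, Complex.ofReal_exp, Complex.ofReal_mul, Complex.ofReal_cpow hx.le,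
      Complex.ofReal_neg, Complex.ofReal_neg]
  rw [this, Complex.ofReal_re]

theorem norm_cexpCpow_le {lam γ κ x : ℝ} (hlam : 0 ≤ lam) (hx : 0 < x)
    (hκ : ∀ ζ : ℂ, ‖ζ - 1‖ ≤ κ → 1 / 2 ≤ (ζ ^ (-(γ : ℂ))).re) {z : ℂ} (hz0 : z ≠ 0)
    (hz : ‖z - x‖ ≤ κ * x) : ‖cexpCpow lam γ z‖ ≤ Real.exp (-(lam / 2) * x ^ (-γ)) := by
  have hx0 : (x : ℂ) ≠ 0 := by exact_mod_cast hx.ne'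
  have eq_mul : z = (x : ℂ) * (z / x) := by field_simp
  have norm_sub_one_le : ‖z / x - 1‖ ≤ κ := by
    rw [div_sub_one hx0, norm_div, Complex.norm_real, Real.norm_of_nonneg hx.le]
    exact (div_le_iff₀ hx).2 hz
  rw [cexpCpow, Complex.norm_exp, Real.exp_le_exp, eq_mul,
    ofReal_mul_cpow hx (div_ne_zero hz0 hx0), ← mul_assoc, ← Complex.ofReal_neg,
    ← Complex.ofReal_mul, Complex.re_ofReal_mul]
  calc -lam * x ^ (-γ) * ((z / x) ^ (-(γ : ℂ))).re ≤ -lam * x ^ (-γ) * (1 / 2) :=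
        mul_le_mul_of_nonpos_left (hκ _ norm_sub_one_le)
          (mul_nonpos_of_nonpos_of_nonneg (neg_nonpos.2 hlam) (by positivity))
    _ = -(lam / 2) * x ^ (-γ) := by ring

theorem mem_slitPlane_of_norm_sub_le {x κ : ℝ} (hx : 0 < x) (hκ : κ < 1) {z : ℂ}
    (hz : ‖z - x‖ ≤ κ * x) : z ∈ Complex.slitPlane := by
  have abs_re_sub_le : |z.re - x| ≤ κ * x := by
    simpa using (Complex.abs_re_le_norm (z - x)).trans hz
  exact Or.inl (by nlinarith [(abs_le.1 abs_re_sub_le).1])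

theorem exists_abs_iteratedDeriv_exp_rpow_le (γ : ℝ) :
    ∃ κ : ℝ, 0 < κ ∧ ∀ lam : ℝ, 0 ≤ lam → ∀ k : ℕ, ∀ x : ℝ, 0 < x →
      DifferentiableAt ℝ (iteratedDeriv k (fun x : ℝ => Real.exp (-lam * x ^ (-γ)))) x ∧
      |iteratedDeriv k (fun x : ℝ => Real.exp (-lam * x ^ (-γ))) x| ≤
        (k ! : ℝ) * Real.exp (-(lam / 2) * x ^ (-γ)) / (κ * x) ^ k := by
  obtain ⟨κ, hκ, hκ1, half_le_re⟩ := exists_half_le_re_cpow γ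
  refine ⟨κ, hκ, fun lam hlam k x hx => ?_⟩
  have analyticAt_pos : ∀ y : ℝ, 0 < y → AnalyticAt ℂ (cexpCpow lam γ) y := fun y hy =>
    analyticAt_cexpCpow lam γ (Complex.ofReal_mem_slitPlane.2 hy)
  have eq_re : ∀ j : ℕ, ∀ y : ℝ, 0 < y →
      iteratedDeriv j (fun x : ℝ => Real.exp (-lam * x ^ (-γ))) y =
        (iteratedDeriv j (cexpCpow lam γ) y).re := fun j y hy =>
    iteratedDeriv_re analyticAt_pos (fun x hx => (re_cexpCpow_ofReal lam γ hx).symm) j hy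
  refine ⟨(hasDerivAt_iteratedDeriv_re analyticAt_pos (eq_re k) hx).differentiableAt, ?_⟩
  have mem_slitPlane : ∀ z ∈ Metric.closedBall (x : ℂ) (κ * x), z ∈ Complex.slitPlane :=
    fun z hz => mem_slitPlane_of_norm_sub_le hx hκ1 (mem_closedBall_iff_norm.1 hz)
  rw [eq_re k x hx]
  refine (Complex.abs_re_le_norm _).trans ?_
  refine Complex.norm_iteratedDeriv_le_of_forall_mem_sphere_norm_le k (by positivity) ?_ ?_
  · refine DifferentiableOn.diffContOnCl fun z hz => ?_
    exact (analyticAt_cexpCpow lam γ (mem_slitPlane z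
      (Metric.closure_ball_subset_closedBall hz))).differentiableAt.differentiableWithinAt
  · intro z hz
    exact norm_cexpCpow_le hlam hx half_le_re
      (Complex.slitPlane_ne_zero (mem_slitPlane z (Metric.sphere_subset_closedBall hz)))
      (mem_sphere_iff_norm.1 hz).le

theorem hasDerivAt_zero_of_abs_le_sq {f : ℝ → ℝ} {M : ℝ} (hf : ∀ x, |f x| ≤ M * x ^ 2) :
    HasDerivAt f 0 0 := by
  have f_zero : f 0 = 0 := by simpa using hf 0
  rw [hasDerivAt_iff_isLittleO_nhds_zero]
  simp only [zero_add, f_zero, sub_zero, smul_zero]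
  refine Asymptotics.IsBigO.trans_isLittleO (g := fun h : ℝ => h ^ 2) ?_
    (Asymptotics.isLittleO_pow_id one_lt_two)
  refine Asymptotics.IsBigO.of_bound M (Filter.Eventually.of_forall fun h => ?_)
  simpa using hf h

theorem hasDerivAt_extend_zero {f : ℝ → ℝ} (hf : ∀ x, 0 < x → DifferentiableAt ℝ f x) {M : ℝ}
    (hM : ∀ x, 0 < x → |f x| ≤ M * x ^ 2) (x : ℝ) :
    HasDerivAt (fun x => if 0 < x then f x else 0) (if 0 < x then deriv f x else 0) x := by
  have hM0 : 0 ≤ M := by simpa using (abs_nonneg _).trans (hM 1 one_pos)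
  rcases lt_trichotomy x 0 with hx | rfl | hx
  · rw [if_neg hx.not_gt]
    refine (hasDerivAt_const x (0 : ℝ)).congr_of_eventuallyEq ?_
    filter_upwards [gt_mem_nhds hx] with y hy using if_neg hy.not_gt
  · rw [if_neg (lt_irrefl _)]
    refine hasDerivAt_zero_of_abs_le_sq (M := M) fun y => ?_
    split_ifs with hy
    · exact hM y hy
    · rw [abs_zero]
      positivity
  · rw [if_pos hx]
    refine (hf x hx).hasDerivAt.congr_of_eventuallyEq ?_
    filter_upwards [lt_mem_nhds hx] with y hy using if_pos hy

section ExtendZero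

variable {f : ℝ → ℝ} (hf : ∀ k x, 0 < x → DifferentiableAt ℝ (iteratedDeriv k f) x)
  (hM : ∀ k, ∃ M, ∀ x, 0 < x → |iteratedDeriv k f x| ≤ M * x ^ 2)

include hf hM

theorem iteratedDeriv_extend_zero (k : ℕ) :
    iteratedDeriv k (fun x => if 0 < x then f x else 0) =
      fun x => if 0 < x then iteratedDeriv k f x else 0 := by
  induction k with
  | zero => simp only [iteratedDeriv_zero]
  | succ k ih =>
    obtain ⟨M, hM⟩ := hM k
    funext x
    rw [iteratedDeriv_succ, ih, (hasDerivAt_extend_zero (hf k) hM x).deriv, iteratedDeriv_succ]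

theorem contDiff_extend_zero :
    ContDiff ℝ ((⊤ : ℕ∞) : WithTop ℕ∞) (fun x => if 0 < x then f x else 0) := by
  refine contDiff_of_differentiable_iteratedDeriv fun k _ => ?_
  obtain ⟨M, hM'⟩ := hM k
  rw [iteratedDeriv_extend_zero hf hM k]
  exact fun x => (hasDerivAt_extend_zero (hf k) hM' x).differentiableAt

end ExtendZero

theorem exp_rpow_div_pow_le {γ s x : ℝ} (hγ : 0 < γ) (hs : 0 < s) (hx : 0 < x) (k : ℕ) :
    Real.exp (-(s ^ γ / γ) * x ^ (-γ)) / x ^ k ≤ (k ! : ℝ) ^ (1 / γ) / s ^ k := by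
  have exponent_eq : 1 / γ * (s / x) ^ (1 / (1 / γ)) = s ^ γ / γ * x ^ (-γ) := by
    rw [one_div_one_div, Real.div_rpow hs.le hx.le, Real.rpow_neg hx.le]
    ring
  have pow_le := pow_le_exp_mul_factorial_rpow (α := 1 / γ) (y := s / x) (by positivity)
    (by positivity) k
  rw [exponent_eq, div_pow, div_le_iff₀ (by positivity)] at pow_le
  rwa [neg_mul, Real.exp_neg, div_le_div_iff₀ (by positivity) (by positivity),
    inv_mul_le_iff₀ (by positivity), ← mul_assoc]

theorem exists_gevreyBound_flatExp {γ R : ℝ} (hγ : 0 < γ) (hR : 0 < R) :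
    ∃ lam : ℝ, 0 < lam ∧ GevreyBound (1 + 1 / γ) R 1 (flatExp lam γ) := by
  obtain ⟨κ, hκ, cauchy⟩ := exists_abs_iteratedDeriv_exp_rpow_le γ
  set s : ℝ := 1 / (κ * R) with hs
  have hs0 : 0 < s := by positivity
  set lam : ℝ := 2 * (s ^ γ / γ) with hlam
  have hlam0 : 0 < lam := by positivity
  set f : ℝ → ℝ := fun x => Real.exp (-lam * x ^ (-γ))
  have differentiableAt_f : ∀ k x, 0 < x → DifferentiableAt ℝ (iteratedDeriv k f) x :=
    fun k x hx => (cauchy lam hlam0.le k x hx).1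
  have abs_le : ∀ k j x, 0 < x → |iteratedDeriv k f x| ≤
      (k ! : ℝ) * (((k + j)! : ℝ) ^ (1 / γ) / s ^ (k + j)) / κ ^ k * x ^ j := by
    intro k j x hx
    calc |iteratedDeriv k f x|
        ≤ (k ! : ℝ) * Real.exp (-(lam / 2) * x ^ (-γ)) / (κ * x) ^ k :=
          (cauchy lam hlam0.le k x hx).2
      _ = (k ! : ℝ) * (Real.exp (-(s ^ γ / γ) * x ^ (-γ)) / x ^ (k + j)) / κ ^ k * x ^ j := by
          rw [hlam, mul_div_cancel_left₀ _ two_ne_zero, mul_pow, pow_add]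
          field_simp
      _ ≤ _ := by
          gcongr (k ! : ℝ) * ?_ / κ ^ k * x ^ j
          exact exp_rpow_div_pow_le hγ hs0 hx (k + j)
  have abs_le_sq : ∀ k, ∃ M, ∀ x, 0 < x → |iteratedDeriv k f x| ≤ M * x ^ 2 :=
    fun k => ⟨_, abs_le k 2⟩
  refine ⟨lam, hlam0, contDiff_extend_zero differentiableAt_f abs_le_sq, fun k x => ?_⟩
  have := factorial_rpow_pos (1 + 1 / γ) k
  rw [show flatExp lam γ = fun x => if 0 < x then f x else 0 from rfl,
    iteratedDeriv_extend_zero differentiableAt_f abs_le_sq]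
  dsimp only
  split_ifs with hx
  · refine (abs_le k 0 x hx).trans_eq ?_
    rw [Real.rpow_add (by exact_mod_cast k.factorial_pos), Real.rpow_one, hs, div_pow, mul_pow,
      one_pow, add_zero, pow_zero]
    field_simp
  · rw [abs_zero]
    positivity

/-! ### Bumps of small width -/

/-- The primitive of `η` vanishing at `0`, normalized to take the value `1` at `a`. -/
def normalizedPrimitive (η : ℝ → ℝ) (a x : ℝ) : ℝ :=
  (∫ t in (0 : ℝ)..a, η t)⁻¹ * ∫ t in (0 : ℝ)..x, η t

section NormalizedPrimitive

variable {η : ℝ → ℝ} {a : ℝ}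

theorem hasDerivAt_normalizedPrimitive (hη : Continuous η) (a x : ℝ) :
    HasDerivAt (normalizedPrimitive η a) ((∫ t in (0 : ℝ)..a, η t)⁻¹ * η x) x :=
  (intervalIntegral.integral_hasDerivAt_right (hη.intervalIntegrable 0 x)
    (hη.stronglyMeasurableAtFilter _ _) hη.continuousAt).const_mul _

theorem normalizedPrimitive_of_nonpos (hleft : ∀ x ≤ 0, η x = 0) {x : ℝ} (hx : x ≤ 0) :
    normalizedPrimitive η a x = 0 := by
  have integral_eq_zero : ∫ t in (0 : ℝ)..x, η t = 0 :=
    intervalIntegral.integral_zero_ae <| Filter.Eventually.of_forall fun t ht =>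
      hleft t (by rw [Set.uIoc_of_ge hx] at ht; exact ht.2)
  rw [normalizedPrimitive, integral_eq_zero, mul_zero]

theorem normalizedPrimitive_of_le (hη : Continuous η) (hright : ∀ x, a ≤ x → η x = 0)
    (hint : 0 < ∫ x in (0 : ℝ)..a, η x) {x : ℝ} (hx : a ≤ x) : normalizedPrimitive η a x = 1 := by
  have integral_eq_zero : ∫ t in a..x, η t = 0 :=
    intervalIntegral.integral_zero_ae <| Filter.Eventually.of_forall fun t ht =>
      hright t (by rw [Set.uIoc_of_le hx] at ht; exact ht.1.le)
  rw [normalizedPrimitive, ← intervalIntegral.integral_add_adjacent_intervals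
    (hη.intervalIntegrable 0 a) (hη.intervalIntegrable a x), integral_eq_zero, add_zero,
    inv_mul_cancel₀ hint.ne']

theorem normalizedPrimitive_mem_Icc (hη : Continuous η) (hnonneg : ∀ x, 0 ≤ η x)
    (hleft : ∀ x ≤ 0, η x = 0) (hright : ∀ x, a ≤ x → η x = 0)
    (hint : 0 < ∫ x in (0 : ℝ)..a, η x) (x : ℝ) : normalizedPrimitive η a x ∈ Set.Icc 0 1 := by
  have monotone : Monotone (normalizedPrimitive η a) :=
    monotone_of_deriv_nonneg
      (fun x => (hasDerivAt_normalizedPrimitive hη a x).differentiableAt) fun x => by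
        rw [(hasDerivAt_normalizedPrimitive hη a x).deriv]
        exact mul_nonneg (inv_nonneg.2 hint.le) (hnonneg x)
  constructor
  · rw [← normalizedPrimitive_of_nonpos (a := a) hleft (min_le_right x 0)]
    exact monotone (min_le_left x 0)
  · rw [← normalizedPrimitive_of_le hη hright hint (le_max_right x a)]
    exact monotone (le_max_left x a)

theorem GevreyBound.normalizedPrimitive {α R I : ℝ} (hα : 0 ≤ α) (hR : 0 < R)
    (hη : GevreyBound α R 1 η) (hnonneg : ∀ x, 0 ≤ η x) (hleft : ∀ x ≤ 0, η x = 0)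
    (hright : ∀ x, a ≤ x → η x = 0) (hI : 0 < I) (hle : I ≤ ∫ x in (0 : ℝ)..a, η x) :
    GevreyBound α R (1 + 1 / (I * R)) (normalizedPrimitive η a) := by
  have hint := hI.trans_le hle
  have continuous_η := hη.contDiff.continuous
  have deriv_eq : deriv (ManyTori.normalizedPrimitive η a) =
      fun x => (∫ t in (0 : ℝ)..a, η t)⁻¹ * η x :=
    funext fun x => (hasDerivAt_normalizedPrimitive continuous_η a x).deriv
  refine ⟨contDiff_infty_iff_deriv.2
    ⟨fun x => (hasDerivAt_normalizedPrimitive continuous_η a x).differentiableAt,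
      deriv_eq ▸ contDiff_const.mul hη.contDiff⟩, fun k x => ?_⟩
  have const_pos : 0 < 1 / (I * R) := by positivity
  rcases k with _ | k
  · obtain ⟨h0, h1⟩ := normalizedPrimitive_mem_Icc continuous_η hnonneg hleft hright hint x
    simp only [iteratedDeriv_zero, pow_zero, mul_one, Nat.factorial_zero, Nat.cast_one,
      Real.one_rpow]
    rw [abs_of_nonneg h0]
    linarith
  · have := (factorial_rpow_pos α k).le
    have factorial_le : (k ! : ℝ) ^ α ≤ ((k + 1)! : ℝ) ^ α := by
      refine Real.rpow_le_rpow (by positivity) ?_ hα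
      exact_mod_cast Nat.factorial_le (Nat.le_succ k)
    rw [iteratedDeriv_succ', deriv_eq, iteratedDeriv_const_mul_field, abs_mul,
      abs_of_pos (inv_pos.2 hint)]
    calc (∫ t in (0 : ℝ)..a, η t)⁻¹ * |iteratedDeriv k η x|
        ≤ I⁻¹ * (1 * R ^ k * ((k + 1)! : ℝ) ^ α) := by
          refine mul_le_mul (inv_anti₀ hI hle) ((hη.abs_iteratedDeriv_le k x).trans ?_)
            (abs_nonneg _) (by positivity)
          gcongr
      _ = 1 / (I * R) * R ^ (k + 1) * ((k + 1)! : ℝ) ^ α := by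
          rw [pow_succ]
          field_simp
      _ ≤ (1 + 1 / (I * R)) * R ^ (k + 1) * ((k + 1)! : ℝ) ^ α := by
          gcongr
          exact le_add_of_nonneg_left zero_le_one

end NormalizedPrimitive

/-- The product of two flat functions facing each other, a smooth profile supported
on `[0, a]`. -/
def flatProfile (lam γ a x : ℝ) : ℝ := flatExp lam γ x * flatExp lam γ (a - x)

section FlatProfile

variable {lam γ a : ℝ}

theorem flatProfile_nonneg (x : ℝ) : 0 ≤ flatProfile lam γ a x :=
  mul_nonneg (flatExp_nonneg _ _ _) (flatExp_nonneg _ _ _)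

theorem flatProfile_of_nonpos {x : ℝ} (hx : x ≤ 0) : flatProfile lam γ a x = 0 := by
  rw [flatProfile, flatExp_of_nonpos hx, zero_mul]

theorem flatProfile_of_le {x : ℝ} (hx : a ≤ x) : flatProfile lam γ a x = 0 := by
  rw [flatProfile, flatExp_of_nonpos (sub_nonpos.2 hx), mul_zero]

theorem le_integral_flatProfile (hlam : 0 ≤ lam) (hγ : 0 ≤ γ) (ha : 0 < a)
    (hcont : Continuous (flatProfile lam γ a)) :
    a / 2 * Real.exp (-lam * (a / 4) ^ (-γ)) ^ 2 ≤ ∫ x in (0 : ℝ)..a, flatProfile lam γ a x := by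
  have middle_half_le : ∫ x in (a / 4)..(3 * a / 4), flatProfile lam γ a x ≤
      ∫ x in (0 : ℝ)..a, flatProfile lam γ a x :=
    intervalIntegral.integral_mono_interval (by linarith) (by linarith) (by linarith)
      (Filter.Eventually.of_forall flatProfile_nonneg) (hcont.intervalIntegrable _ _)
  have const_le : ∫ x in (a / 4)..(3 * a / 4), Real.exp (-lam * (a / 4) ^ (-γ)) ^ 2 ≤
      ∫ x in (a / 4)..(3 * a / 4), flatProfile lam γ a x := by
    refine intervalIntegral.integral_mono_on (by linarith) (by simp) (hcont.intervalIntegrable _ _)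
      fun x hx => ?_
    have ha4 : 0 < a / 4 := by positivity
    rw [sq]
    exact mul_le_mul (exp_le_flatExp hlam hγ ha4 hx.1)
      (exp_le_flatExp hlam hγ ha4 (by linarith [hx.2])) (Real.exp_pos _).le (flatExp_nonneg _ _ _)
  rw [intervalIntegral.integral_const, smul_eq_mul,
    show 3 * a / 4 - a / 4 = a / 2 by ring] at const_le
  exact const_le.trans middle_half_le

end FlatProfile

theorem one_div_le_exp_rpow {γ a : ℝ} (hγ : 0 < γ) (ha : 0 < a) :
    1 / a ≤ Real.exp (1 / γ * a ^ (-γ)) := by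
  simpa [Real.rpow_neg ha.le, Real.inv_rpow ha.le] using
    pow_le_exp_mul_factorial_rpow (α := 1 / γ) (y := 1 / a) (by positivity) (by positivity) 1

theorem one_add_inv_profile_mass_le_exp {lam γ a R : ℝ} (hlam : 0 ≤ lam) (hγ : 0 < γ) (ha : 0 < a)
    (ha1 : a ≤ 1) (hR : 0 < R) :
    1 + 1 / (a / 2 * Real.exp (-lam * (a / 4) ^ (-γ)) ^ 2 * R) ≤
      Real.exp ((2 / R + 1 / γ + 2 * lam * 4 ^ γ) * a ^ (-γ)) := by
  set Y : ℝ := a ^ (-γ) with hY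
  have one_le_Y : 1 ≤ Y := Real.one_le_rpow_of_pos_of_le_one_of_nonpos ha ha1 (by linarith)
  have exp_sq_eq : Real.exp (-lam * (a / 4) ^ (-γ)) ^ 2 = (Real.exp (2 * lam * 4 ^ γ * Y))⁻¹ := by
    rw [← Real.exp_nat_mul, ← Real.exp_neg, hY, Real.div_rpow ha.le (by norm_num),
      Real.rpow_neg (by norm_num : (0 : ℝ) ≤ 4), div_inv_eq_mul]
    congr 1
    push_cast
    ring
  have add_one_le : 1 + 2 / R ≤ Real.exp (2 / R * Y) := by
    have le_mul : 2 / R ≤ 2 / R * Y := le_mul_of_one_le_right (by positivity) one_le_Y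
    linarith [Real.add_one_le_exp (2 / R * Y)]
  have one_le : 1 ≤ 1 / a * Real.exp (2 * lam * 4 ^ γ * Y) :=
    one_le_mul_of_one_le_of_one_le ((one_le_div ha).2 ha1) (Real.one_le_exp (by positivity))
  calc 1 + 1 / (a / 2 * Real.exp (-lam * (a / 4) ^ (-γ)) ^ 2 * R)
      = 1 + 2 / R * (1 / a * Real.exp (2 * lam * 4 ^ γ * Y)) := by
        rw [exp_sq_eq]
        field_simp
    _ ≤ (1 + 2 / R) * (1 / a * Real.exp (2 * lam * 4 ^ γ * Y)) := by
        rw [add_mul, one_mul]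
        gcongr
    _ ≤ Real.exp (2 / R * Y) * (Real.exp (1 / γ * Y) * Real.exp (2 * lam * 4 ^ γ * Y)) := by
        gcongr
        exact one_div_le_exp_rpow hγ ha
    _ = Real.exp ((2 / R + 1 / γ + 2 * lam * 4 ^ γ) * Y) := by
        rw [← Real.exp_add, ← Real.exp_add]
        congr 1
        ring

theorem exists_gevreyBound_step {γ R : ℝ} (hγ : 0 < γ) (hR : 0 < R) :
    ∃ c : ℝ, 0 < c ∧ ∀ a : ℝ, 0 < a → a ≤ 1 → ∃ S : ℝ → ℝ,
      GevreyBound (1 + 1 / γ) R (Real.exp (c * a ^ (-γ))) S ∧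
      (∀ x ≤ 0, S x = 0) ∧ ∀ x, a ≤ x → S x = 1 := by
  obtain ⟨lam, hlam, flatExp_bound⟩ := exists_gevreyBound_flatExp hγ (half_pos hR)
  refine ⟨2 / R + 1 / γ + 2 * lam * 4 ^ γ, by positivity, fun a ha ha1 => ?_⟩
  have profile_bound : GevreyBound (1 + 1 / γ) R 1 (flatProfile lam γ a) := by
    have := flatExp_bound.mul (by positivity) (by positivity) (flatExp_bound.comp_const_sub a)
    rwa [one_mul, mul_div_cancel₀ _ two_ne_zero] at this
  have le_integral := le_integral_flatProfile hlam.le hγ.le ha profile_bound.contDiff.continuous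
  have mass_pos : 0 < a / 2 * Real.exp (-lam * (a / 4) ^ (-γ)) ^ 2 := by positivity
  refine ⟨normalizedPrimitive (flatProfile lam γ a) a, ?_,
    fun x hx => normalizedPrimitive_of_nonpos (fun _ => flatProfile_of_nonpos) hx,
    fun x hx => normalizedPrimitive_of_le profile_bound.contDiff.continuous
      (fun _ => flatProfile_of_le) (mass_pos.trans_le le_integral) hx⟩
  exact (profile_bound.normalizedPrimitive (by positivity) hR flatProfile_nonneg
    (fun _ => flatProfile_of_nonpos) (fun _ => flatProfile_of_le) mass_pos le_integral).mono hR.le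
    (one_add_inv_profile_mass_le_exp hlam.le hγ ha ha1 hR)

theorem exists_gevreyBound_bump {γ R : ℝ} (hγ : 0 < γ) (hR : 0 < R) :
    ∃ c : ℝ, 0 < c ∧ ∀ w : ℝ, 0 < w → w ≤ 1 → ∃ b : ℝ → ℝ,
      GevreyBound (1 + 1 / γ) R (Real.exp (c * w ^ (-γ))) b ∧
      (∀ x, |x| ≤ w / 2 → b x = 1) ∧ ∀ x, w ≤ |x| → b x = 0 := by
  obtain ⟨c, hc, exists_step⟩ := exists_gevreyBound_step hγ (half_pos hR)
  refine ⟨2 * (c * 2 ^ γ), by positivity, fun w hw hw1 => ?_⟩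
  obtain ⟨S, S_bound, S_left, S_right⟩ := exists_step (w / 2) (by positivity) (by linarith)
  refine ⟨fun x => S (x + w) * S (w - x), ?_, fun x hx => ?_, fun x hx => ?_⟩
  · have exponent_eq : c * (w / 2) ^ (-γ) + c * (w / 2) ^ (-γ) = 2 * (c * 2 ^ γ) * w ^ (-γ) := by
      rw [Real.div_rpow hw.le (by norm_num), Real.rpow_neg (by norm_num : (0 : ℝ) ≤ 2),
        div_inv_eq_mul]
      ring
    have product_bound := (S_bound.comp_add_const w).mul (by positivity) (by positivity)
      (S_bound.comp_const_sub w)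
    rwa [mul_div_cancel₀ _ two_ne_zero, ← Real.exp_add, exponent_eq] at product_bound
  · obtain ⟨hl, hr⟩ := abs_le.1 hx
    dsimp only
    rw [S_right (x + w) (by linarith), S_right (w - x) (by linarith), one_mul]
  · dsimp only
    rcases le_abs.1 hx with h | h
    · rw [S_left (w - x) (by linarith), mul_zero]
    · rw [S_left (x + w) (by linarith), zero_mul]

/-! ### Sums of tensor products -/

/-- The derivative of order `k` of the function `x ↦ ∑ₙ ∏ᵢ hₙᵢ(xᵢ)`, taken term by term; the sum
itself is `tensorSum h 0`. -/
def tensorSum {N : ℕ} (h : ℕ → Fin N → ℝ → ℝ) (k : Fin N → ℕ) (x : Fin N → ℝ) : ℝ :=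
  ∑' n, ∏ i, iteratedDeriv (k i) (h n i) (x i)

/-- The bound on the derivative of order `k` of a tensor product of Gevrey functions. -/
def tensorWeight {N : ℕ} (α R : ℝ) (k : Fin N → ℕ) : ℝ := ∏ i, (R ^ k i * ((k i)! : ℝ) ^ α)

theorem norm_sum_smul_proj_le {N : ℕ} (a : Fin N → ℝ) :
    ‖∑ j, a j • (ContinuousLinearMap.proj j : (Fin N → ℝ) →L[ℝ] ℝ)‖ ≤ ∑ j, |a j| := by
  refine (norm_sum_le _ _).trans (Finset.sum_le_sum fun j _ => ?_)
  have norm_proj : ‖(ContinuousLinearMap.proj j : (Fin N → ℝ) →L[ℝ] ℝ)‖ ≤ 1 :=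
    ContinuousLinearMap.opNorm_le_bound _ zero_le_one fun y => by
      simpa using norm_le_pi_norm y j
  rw [norm_smul, Real.norm_eq_abs]
  exact mul_le_of_le_one_right (abs_nonneg _) norm_proj

section

variable {N : ℕ} {α R : ℝ} {A : ℕ → Fin N → ℝ} {h : ℕ → Fin N → ℝ → ℝ}

theorem abs_prod_iteratedDeriv_le (hh : ∀ n i, GevreyBound α R (A n i) (h n i))
    (k : Fin N → ℕ) (n : ℕ) (x : Fin N → ℝ) :
    |∏ i, iteratedDeriv (k i) (h n i) (x i)| ≤ (∏ i, A n i) * tensorWeight α R k := by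
  rw [Finset.abs_prod, tensorWeight, ← Finset.prod_mul_distrib]
  refine Finset.prod_le_prod (fun i _ => abs_nonneg _) fun i _ => ?_
  rw [← mul_assoc]
  exact (hh n i).abs_iteratedDeriv_le (k i) (x i)

theorem summable_prod_iteratedDeriv (hh : ∀ n i, GevreyBound α R (A n i) (h n i))
    (hs : Summable fun n => ∏ i, A n i) (k : Fin N → ℕ) (x : Fin N → ℝ) :
    Summable fun n => ∏ i, iteratedDeriv (k i) (h n i) (x i) :=
  Summable.of_norm_bounded (hs.mul_right _) fun n => abs_prod_iteratedDeriv_le hh k n x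

theorem abs_tensorSum_le (hh : ∀ n i, GevreyBound α R (A n i) (h n i))
    (hs : Summable fun n => ∏ i, A n i) (k : Fin N → ℕ) (x : Fin N → ℝ) :
    |tensorSum h k x| ≤ (∑' n, ∏ i, A n i) * tensorWeight α R k := by
  rw [← tsum_mul_right, tensorSum, ← Real.norm_eq_abs]
  exact tsum_of_norm_bounded (hs.mul_right _).hasSum fun n => abs_prod_iteratedDeriv_le hh k n x

theorem hasFDerivAt_prod_iteratedDeriv {f : Fin N → ℝ → ℝ}
    (hf : ∀ i, ContDiff ℝ ((⊤ : ℕ∞) : WithTop ℕ∞) (f i)) (k : Fin N → ℕ) (x : Fin N → ℝ) :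
    HasFDerivAt (fun x : Fin N → ℝ => ∏ i, iteratedDeriv (k i) (f i) (x i))
      (∑ j, (∏ i, iteratedDeriv ((k + Pi.single j 1 : Fin N → ℕ) i) (f i) (x i)) •
        (ContinuousLinearMap.proj j : (Fin N → ℝ) →L[ℝ] ℝ)) x := by
  have hasFDerivAt_factor : ∀ i ∈ (Finset.univ : Finset (Fin N)),
      HasFDerivAt (fun x : Fin N → ℝ => iteratedDeriv (k i) (f i) (x i))
        (iteratedDeriv (k i + 1) (f i) (x i) •
          (ContinuousLinearMap.proj i : (Fin N → ℝ) →L[ℝ] ℝ)) x := by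
    intro i _
    have hd : HasDerivAt (iteratedDeriv (k i) (f i))
        (iteratedDeriv (k i + 1) (f i) (x i)) (x i) := by
      rw [iteratedDeriv_succ]
      exact ((hf i).differentiable_iteratedDeriv (k i)
        (by exact_mod_cast WithTop.coe_lt_top _) (x i)).hasDerivAt
    exact hd.comp_hasFDerivAt x (ContinuousLinearMap.proj (R := ℝ) i).hasFDerivAt
  refine (HasFDerivAt.finsetProd hasFDerivAt_factor).congr_fderiv
    (Finset.sum_congr rfl fun j _ => ?_)
  rw [smul_smul, ← Finset.mul_prod_erase _ _ (Finset.mem_univ j), mul_comm]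
  congr 2
  · simp
  · refine Finset.prod_congr rfl fun i hi => ?_
    simp [Pi.single_eq_of_ne (Finset.ne_of_mem_erase hi)]

theorem hasFDerivAt_tensorSum (hh : ∀ n i, GevreyBound α R (A n i) (h n i))
    (hs : Summable fun n => ∏ i, A n i) (k : Fin N → ℕ) (x : Fin N → ℝ) :
    HasFDerivAt (tensorSum h k) (∑ j, tensorSum h (k + Pi.single j 1) x •
      (ContinuousLinearMap.proj j : (Fin N → ℝ) →L[ℝ] ℝ)) x := by
  have norm_fderiv_le : ∀ (n : ℕ) (x : Fin N → ℝ),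
      ‖∑ j, (∏ i, iteratedDeriv ((k + Pi.single j 1 : Fin N → ℕ) i) (h n i) (x i)) •
        (ContinuousLinearMap.proj j : (Fin N → ℝ) →L[ℝ] ℝ)‖ ≤
      (∏ i, A n i) * ∑ j, tensorWeight α R (k + Pi.single j 1) := fun n x => by
    rw [Finset.mul_sum]
    exact (norm_sum_smul_proj_le _).trans
      (Finset.sum_le_sum fun j _ => abs_prod_iteratedDeriv_le hh _ n x)
  refine (hasFDerivAt_tsum (hs.mul_right _)
    (fun n => hasFDerivAt_prod_iteratedDeriv (fun i => (hh n i).contDiff) k) norm_fderiv_le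
    (summable_prod_iteratedDeriv hh hs k 0) x).congr_fderiv ?_
  rw [Summable.tsum_finsetSum fun j _ => (summable_prod_iteratedDeriv hh hs _ x).smul_const _]
  exact Finset.sum_congr rfl fun j _ =>
    (summable_prod_iteratedDeriv hh hs _ x).tsum_smul_const _

theorem pderiv_tensorSum (hh : ∀ n i, GevreyBound α R (A n i) (h n i))
    (hs : Summable fun n => ∏ i, A n i) (k : Fin N → ℕ) (j : Fin N) :
    pderiv j (tensorSum h k) = tensorSum h (k + Pi.single j 1) := by
  funext x
  rw [pderiv, (hasFDerivAt_tensorSum hh hs k x).fderiv]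
  simp [Pi.single_apply]

theorem contDiff_tensorSum (hh : ∀ n i, GevreyBound α R (A n i) (h n i))
    (hs : Summable fun n => ∏ i, A n i) (k : Fin N → ℕ) :
    ContDiff ℝ ((⊤ : ℕ∞) : WithTop ℕ∞) (tensorSum h k) := by
  refine contDiff_infty.2 fun m => ?_
  induction m generalizing k with
  | zero =>
    exact contDiff_zero.2 (continuous_iff_continuousAt.2 fun x =>
      (hasFDerivAt_tensorSum hh hs k x).continuousAt)
  | succ m ih =>
    exact contDiff_succ_iff_hasFDerivAt.2 ⟨_,
      ContDiff.sum fun j _ => (ih (k + Pi.single j 1)).smul contDiff_const,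
      fun x => hasFDerivAt_tensorSum hh hs k x⟩

theorem iterate_pderiv_tensorSum (hh : ∀ n i, GevreyBound α R (A n i) (h n i))
    (hs : Summable fun n => ∏ i, A n i) (k : Fin N → ℕ) (j : Fin N) (m : ℕ) :
    (pderiv j)^[m] (tensorSum h k) = tensorSum h (k + Pi.single j m) := by
  induction m with
  | zero => simp
  | succ m ih =>
    rw [Function.iterate_succ_apply', ih, pderiv_tensorSum hh hs, add_assoc, ← Pi.single_add]

theorem multiDeriv_tensorSum (hh : ∀ n i, GevreyBound α R (A n i) (h n i))
    (hs : Summable fun n => ∏ i, A n i) (ℓ : Fin N → ℕ) :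
    multiDeriv ℓ (tensorSum h 0) = tensorSum h ℓ := by
  have foldr_pderiv : ∀ l : List (Fin N),
      l.foldr (fun i g => (pderiv i)^[ℓ i] g) (tensorSum h 0) =
        tensorSum h (l.map fun i => Pi.single i (ℓ i)).sum := by
    intro l
    induction l with
    | nil => simp
    | cons a l ih =>
      rw [List.foldr_cons, ih, iterate_pderiv_tensorSum hh hs, List.map_cons, List.sum_cons,
        add_comm]
  rw [multiDeriv, foldr_pderiv, ← Fin.sum_univ_def]
  exact congrArg (tensorSum h) (Finset.univ_sum_single ℓ)

theorem exists_lipschitzWith_tensorSum (hh : ∀ n i, GevreyBound α R (A n i) (h n i))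
    (hs : Summable fun n => ∏ i, A n i) (k : Fin N → ℕ) :
    ∃ K : NNReal, LipschitzWith K (tensorSum h k) := by
  refine ⟨(∑ j, (∑' n, ∏ i, A n i) * tensorWeight α R (k + Pi.single j 1)).toNNReal,
    lipschitzWith_of_nnnorm_fderiv_le (𝕜 := ℝ)
      (fun x => (hasFDerivAt_tensorSum hh hs k x).differentiableAt) fun x => ?_⟩
  rw [← NNReal.coe_le_coe, coe_nnnorm, (hasFDerivAt_tensorSum hh hs k x).fderiv]
  exact ((norm_sum_smul_proj_le _).trans
    (Finset.sum_le_sum fun j _ => abs_tensorSum_le hh hs _ x)).trans (Real.le_coe_toNNReal _)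

end

theorem tsum_pi_prod_inv_two (N : ℕ) :
    ∑' ℓ : Fin N → ℕ, ∏ i, (2⁻¹ : ℝ≥0∞) ^ ℓ i = 2 ^ N := by
  induction N with
  | zero => simp
  | succ N ih =>
    rw [← (Fin.consEquiv fun _ : Fin (N + 1) => ℕ).tsum_eq, ENNReal.tsum_prod']
    simp only [Fin.consEquiv_apply, Fin.prod_univ_succ, Fin.cons_zero, Fin.cons_succ]
    simp_rw [ENNReal.tsum_mul_left, ih, ENNReal.tsum_mul_right, ENNReal.tsum_geometric,
      ENNReal.one_sub_inv_two, inv_inv, pow_succ, mul_comm]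

theorem gevreyWeight_mul_tensorWeight {N : ℕ} {α L : ℝ} (hL : 0 < L) (ℓ : Fin N → ℕ) :
    L ^ (((∑ i, ℓ i : ℕ) : ℝ) * α) / ((∏ i, (ℓ i)! : ℕ) : ℝ) ^ α *
      tensorWeight α (1 / (2 * L ^ α)) ℓ = ∏ i, (2⁻¹ : ℝ) ^ ℓ i := by
  have rpow_sum : L ^ (((∑ i, ℓ i : ℕ) : ℝ) * α) = ∏ i, (L ^ α) ^ ℓ i := by
    rw [mul_comm, Real.rpow_mul hL.le, Real.rpow_natCast, Finset.prod_pow_eq_pow_sum]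
  have prod_factorial_rpow : ((∏ i, (ℓ i)! : ℕ) : ℝ) ^ α = ∏ i, ((ℓ i)! : ℝ) ^ α := by
    push_cast
    rw [Real.finsetProd_rpow]
    exact fun i _ => by positivity
  rw [rpow_sum, prod_factorial_rpow, tensorWeight, ← Finset.prod_div_distrib,
    ← Finset.prod_mul_distrib]
  refine Finset.prod_congr rfl fun i _ => ?_
  have := (factorial_rpow_pos α (ℓ i)).ne'
  have := Real.rpow_pos_of_pos hL α
  rw [one_div, mul_inv, mul_pow, inv_pow (L ^ α)]
  field_simp

theorem gevreyNorm_tensorSum_le {N : ℕ} {α L : ℝ} (hL : 0 < L) {A : ℕ → Fin N → ℝ}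
    {h : ℕ → Fin N → ℝ → ℝ} (hh : ∀ n i, GevreyBound α (1 / (2 * L ^ α)) (A n i) (h n i))
    (hs : Summable fun n => ∏ i, A n i) :
    gevreyNorm α L (tensorSum h 0) ≤ 2 ^ N * ENNReal.ofReal (∑' n, ∏ i, A n i) := by
  rw [gevreyNorm, ← tsum_pi_prod_inv_two, ← ENNReal.tsum_mul_right]
  refine ENNReal.tsum_le_tsum fun ℓ => ?_
  have iSup_enorm_le : ⨆ x : Fin N → ℝ, ‖tensorSum h ℓ x‖ₑ ≤
      ENNReal.ofReal ((∑' n, ∏ i, A n i) * tensorWeight α (1 / (2 * L ^ α)) ℓ) := by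
    refine iSup_le fun x => ?_
    rw [← ofReal_norm]
    exact ENNReal.ofReal_le_ofReal (abs_tensorSum_le hh hs ℓ x)
  have ofReal_prod : ENNReal.ofReal (∏ i, (2⁻¹ : ℝ) ^ ℓ i) = ∏ i, (2⁻¹ : ℝ≥0∞) ^ ℓ i := by
    rw [ENNReal.ofReal_prod_of_nonneg (fun i _ => by positivity)]
    simp [ENNReal.ofReal_pow, ENNReal.ofReal_inv_of_pos, ENNReal.inv_pow]
  rw [multiDeriv_tensorSum hh hs]
  refine (mul_le_mul_right iSup_enorm_le _).trans (le_of_eq ?_)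
  rw [← ENNReal.ofReal_mul (by positivity), mul_left_comm, gevreyWeight_mul_tensorWeight hL,
    mul_comm, ENNReal.ofReal_mul (by positivity), ofReal_prod]

/-! ### Hamiltonian flows -/

section

variable {F : Type*} [NormedAddCommGroup F] [NormedSpace ℝ F] {v : F → F} {K : NNReal}

theorem exists_integral_curve_Ioo [CompleteSpace F] {M : ℝ} (hv : LipschitzWith K v)
    (hM : ∀ x, ‖v x‖ ≤ M) (x : F) {T : ℝ} (hT : 0 < T) :
    ∃ c : ℝ → F, c 0 = x ∧ ∀ t ∈ Set.Ioo (-T) T, HasDerivAt c (v (c t)) t := by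
  have hM_nonneg : 0 ≤ M := (norm_nonneg _).trans (hM x)
  have zero_mem : (0 : ℝ) ∈ Set.Icc (-T) T := ⟨by linarith, hT.le⟩
  have isPicardLindelof : IsPicardLindelof (fun _ => v) (⟨0, zero_mem⟩ : Set.Icc (-T) T) x
      (M.toNNReal * T.toNNReal) 0 M.toNNReal K :=
    { lipschitzOnWith := fun t _ => hv.lipschitzOnWith
      continuousOn := fun y _ => continuousOn_const
      norm_le := fun t _ y _ => by rw [Real.coe_toNNReal _ hM_nonneg]; exact hM y
      mul_max_le := by simp [Real.coe_toNNReal _ hM_nonneg, Real.coe_toNNReal _ hT.le] }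
  obtain ⟨c, hc0, hc⟩ := isPicardLindelof.exists_eq_forall_mem_Icc_hasDerivWithinAt₀
  exact ⟨c, hc0, fun t ht =>
    (hc t (Set.Ioo_subset_Icc_self ht)).hasDerivAt (Icc_mem_nhds ht.1 ht.2)⟩

theorem integral_curve_eqOn_Ioo (hv : LipschitzWith K v) {c c' : ℝ → F} {T T' : ℝ} (hT : 0 < T)
    (hTT' : T ≤ T') (hc : ∀ t ∈ Set.Ioo (-T) T, HasDerivAt c (v (c t)) t)
    (hc' : ∀ t ∈ Set.Ioo (-T') T', HasDerivAt c' (v (c' t)) t) (h0 : c 0 = c' 0) :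
    Set.EqOn c c' (Set.Ioo (-T) T) :=
  ODE_solution_unique_of_mem_Ioo (v := fun _ => v) (s := fun _ => Set.univ) (K := K)
    (fun _ _ => hv.lipschitzOnWith) (t₀ := 0) ⟨by linarith, hT⟩ (fun s hs => ⟨hc s hs, trivial⟩)
    (fun s hs => ⟨hc' s ⟨by linarith [hs.1], by linarith [hs.2]⟩, trivial⟩) h0

theorem exists_global_integral_curve [CompleteSpace F] {M : ℝ} (hv : LipschitzWith K v)
    (hM : ∀ x, ‖v x‖ ≤ M) (x : F) :
    ∃ c : ℝ → F, (∀ t, HasDerivAt c (v (c t)) t) ∧ c 0 = x := by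
  choose! c hc0 hc using fun T hT => exists_integral_curve_Ioo hv hM x (T := T) hT
  have eq_of_le : ∀ T T' : ℝ, 0 < T → T ≤ T' → ∀ t ∈ Set.Ioo (-T) T, c T t = c T' t :=
    fun T T' hT hTT' => integral_curve_eqOn_Ioo hv hT hTT' (hc T hT) (hc T' (hT.trans_le hTT'))
      (by rw [hc0 T hT, hc0 T' (hT.trans_le hTT')])
  refine ⟨fun t => c (|t| + 1) t, fun t => ?_, hc0 _ (by positivity)⟩
  have mem_Ioo : ∀ s : ℝ, s ∈ Set.Ioo (-(|s| + 1)) (|s| + 1) := fun s =>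
    ⟨by linarith [neg_abs_le s], by linarith [le_abs_self s]⟩
  refine (hc (|t| + 1) (by positivity) t (mem_Ioo t)).congr_of_eventuallyEq ?_
  filter_upwards [Ioo_mem_nhds (mem_Ioo t).1 (mem_Ioo t).2] with s hs
  rcases le_total (|s| + 1) (|t| + 1) with h | h
  · exact eq_of_le _ _ (by positivity) h s (mem_Ioo s)
  · exact (eq_of_le _ _ (by positivity) h s hs).symm

end

theorem phaseCover_eq_iff {x y : Fin 4 → ℝ} : phaseCover x = phaseCover y ↔
    ((x 0 : UnitAddCircle) = (y 0 : UnitAddCircle) ∧ x 1 = y 1) ∧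
      ((x 2 : UnitAddCircle) = (y 2 : UnitAddCircle) ∧ x 3 = y 3) := by
  simp only [phaseCover, phasePt, annulusPt]
  rw [(WithLp.toLp_injective 2).eq_iff, Prod.mk.injEq, (WithLp.toLp_injective 2).eq_iff,
    (WithLp.toLp_injective 2).eq_iff, Prod.mk.injEq, Prod.mk.injEq]

theorem phaseCover_surjective : Function.Surjective phaseCover := by
  intro z
  obtain ⟨θ₁, hθ₁⟩ : ∃ θ : ℝ, (θ : UnitAddCircle) = z.fst.fst :=
    QuotientAddGroup.mk_surjective z.fst.fst
  obtain ⟨θ₂, hθ₂⟩ : ∃ θ : ℝ, (θ : UnitAddCircle) = z.snd.fst :=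
    QuotientAddGroup.mk_surjective z.snd.fst
  refine ⟨![θ₁, z.fst.snd, θ₂, z.snd.snd], ?_⟩
  simp only [phaseCover, phasePt, annulusPt, Matrix.cons_val_zero, Matrix.cons_val_one,
    Matrix.cons_val, hθ₁, hθ₂]
  rfl

theorem phaseCover_add_of_eq {x y : Fin 4 → ℝ} (h : phaseCover x = phaseCover y)
    (a : Fin 4 → ℝ) : phaseCover (a + x) = phaseCover (a + y) := by
  rw [phaseCover_eq_iff] at h ⊢
  obtain ⟨⟨h0, h1⟩, h2, h3⟩ := h
  refine ⟨⟨?_, ?_⟩, ?_, ?_⟩ <;> simp only [Pi.add_apply, AddCircle.coe_add, h0, h1, h2, h3]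

theorem hamVectorField_add_of_periodic {H : (Fin 4 → ℝ) → ℝ} {a : Fin 4 → ℝ}
    (ha : ∀ x, H (x + a) = H x) (x : Fin 4 → ℝ) :
    hamVectorField H (x + a) = hamVectorField H x := by
  have pderiv_add : ∀ i, pderiv i H (x + a) = pderiv i H x := fun i => by
    rw [pderiv, pderiv, ← fderiv_comp_add_right a]
    simp only [ha]
  simp only [hamVectorField, pderiv_add]

theorem exists_isTimeOneMap {H : Phase → ℝ} {K : NNReal} {M : ℝ}
    (hv : LipschitzWith K (hamVectorField (H ∘ phaseCover)))
    (hM : ∀ x, ‖hamVectorField (H ∘ phaseCover) x‖ ≤ M) :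
    ∃ Φ : Phase → Phase, IsTimeOneMap H Φ := by
  choose c hc hc0 using exists_global_integral_curve hv hM
  choose lift phaseCover_lift using phaseCover_surjective
  refine ⟨fun z => phaseCover (c (lift z) 1), fun x => ⟨c x, hc x, hc0 x⟩, fun e he => ?_⟩
  set x := lift (phaseCover (e 0))
  have cover_x : phaseCover x = phaseCover (e 0) := phaseCover_lift _
  have periodic : ∀ y, (H ∘ phaseCover) (y + (e 0 - x)) = (H ∘ phaseCover) y := fun y => by
    have := phaseCover_add_of_eq cover_x (y - x)
    simp only [Function.comp_apply]
    rw [show y + (e 0 - x) = y - x + e 0 by abel, ← this, sub_add_cancel]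
  have translate_eq : (fun t => c x t + (e 0 - x)) = e := by
    refine ODE_solution_unique_univ (v := fun _ => hamVectorField (H ∘ phaseCover))
      (s := fun _ => Set.univ) (K := K) (t₀ := 0) (fun _ => hv.lipschitzOnWith)
      (fun t => ⟨?_, trivial⟩) (fun t => ⟨he t, trivial⟩) (by rw [hc0]; abel)
    rw [hamVectorField_add_of_periodic periodic]
    exact (hc x t).add_const _
  calc phaseCover (c x 1) = phaseCover (c x 1 - x + x) := by rw [sub_add_cancel]
    _ = phaseCover (c x 1 - x + e 0) := phaseCover_add_of_eq cover_x _
    _ = phaseCover (e 1) := by rw [← congrFun translate_eq 1, sub_add_eq_add_sub, add_sub_assoc]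

theorem IsTimeOneMap.apply_of_hasDerivAt {H : Phase → ℝ} {Φ : Phase → Phase} {K : NNReal}
    (hΦ : IsTimeOneMap H Φ) (hv : LipschitzWith K (hamVectorField (H ∘ phaseCover)))
    {c : ℝ → Fin 4 → ℝ}
    (hc : ∀ t ∈ Set.Icc (0 : ℝ) 1, HasDerivAt c (hamVectorField (H ∘ phaseCover) (c t)) t) :
    Φ (phaseCover (c 0)) = phaseCover (c 1) := by
  obtain ⟨e, he, he0⟩ := hΦ.1 (c 0)
  have eqOn : Set.EqOn e c (Set.Icc 0 1) :=
    ODE_solution_unique (v := fun _ => hamVectorField (H ∘ phaseCover)) (fun _ => hv)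
      (fun t _ => (he t).continuousAt.continuousWithinAt)
      (fun t _ => (he t).hasDerivWithinAt)
      (fun t ht => (hc t ht).continuousAt.continuousWithinAt)
      (fun t ht => (hc t ⟨ht.1, ht.2.le⟩).hasDerivWithinAt) he0
  rw [← he0, hΦ.2 e he, eqOn ⟨zero_le_one, le_rfl⟩]

section

variable {α R : ℝ} {A : ℕ → Fin 4 → ℝ} {h : ℕ → Fin 4 → ℝ → ℝ}

theorem hamVectorField_tensorSum (hh : ∀ n i, GevreyBound α R (A n i) (h n i))
    (hs : Summable fun n => ∏ i, A n i) (x : Fin 4 → ℝ) :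
    hamVectorField (tensorSum h 0) x =
      ![tensorSum h (Pi.single 1 1) x, -tensorSum h (Pi.single 0 1) x,
        tensorSum h (Pi.single 3 1) x, -tensorSum h (Pi.single 2 1) x] := by
  simp only [hamVectorField, pderiv_tensorSum hh hs, zero_add]

theorem exists_lipschitzWith_hamVectorField (hh : ∀ n i, GevreyBound α R (A n i) (h n i))
    (hs : Summable fun n => ∏ i, A n i) :
    ∃ K : NNReal, LipschitzWith K (hamVectorField (tensorSum h 0)) := by
  choose K hK using exists_lipschitzWith_tensorSum hh hs
  refine ⟨∑ j, K (Pi.single j 1), LipschitzWith.of_dist_le_mul fun x y =>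
    (dist_pi_le_iff (by positivity)).2 fun i => ?_⟩
  have lipschitzWith_component : ∀ j,
      LipschitzWith (∑ j, K (Pi.single j 1)) (tensorSum h (Pi.single j 1)) :=
    fun j => (hK _).weaken (Finset.single_le_sum
      (f := fun j : Fin 4 => K (Pi.single j 1)) (fun _ _ => zero_le) (Finset.mem_univ j))
  rw [hamVectorField_tensorSum hh hs, hamVectorField_tensorSum hh hs]
  fin_cases i
  · exact (lipschitzWith_component 1).dist_le_mul x y
  · simpa using (lipschitzWith_component 0).dist_le_mul x y
  · exact (lipschitzWith_component 3).dist_le_mul x y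
  · simpa using (lipschitzWith_component 2).dist_le_mul x y

theorem exists_norm_hamVectorField_le (hh : ∀ n i, GevreyBound α R (A n i) (h n i))
    (hs : Summable fun n => ∏ i, A n i) :
    ∃ M : ℝ, ∀ x, ‖hamVectorField (tensorSum h 0) x‖ ≤ M := by
  set M : Fin 4 → ℝ := fun j => (∑' n, ∏ i, A n i) * tensorWeight α R (Pi.single j 1)
  have abs_le : ∀ j x, |tensorSum h (Pi.single j 1) x| ≤ M j := fun j =>
    abs_tensorSum_le hh hs (Pi.single j 1)
  have M_nonneg : ∀ j, 0 ≤ M j := fun j => (abs_nonneg _).trans (abs_le j 0)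
  have abs_le_sum : ∀ j x, |tensorSum h (Pi.single j 1) x| ≤ ∑ j, M j := fun j x =>
    (abs_le j x).trans (Finset.single_le_sum (fun j _ => M_nonneg j) (Finset.mem_univ j))
  refine ⟨∑ j, M j, fun x =>
    (pi_norm_le_iff_of_nonneg (Finset.sum_nonneg fun j _ => M_nonneg j)).2 fun i => ?_⟩
  rw [hamVectorField_tensorSum hh hs]
  fin_cases i
  · exact abs_le_sum 1 x
  · simpa using abs_le_sum 0 x
  · exact abs_le_sum 3 x
  · simpa using abs_le_sum 2 x

end

/-! ### Slow orbits of the standard map -/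

/-- The force `κ sin (2π x)`, cut off to `0` for `x ≥ 1/2`. -/
def cutForce (κ x : ℝ) : ℝ := κ * max 0 (Real.sin (2 * Real.pi * min x (1 / 2)))

/-- Position and velocity, after `j` steps, of the orbit of the cut-off standard map issued from
the position `0` with velocity `ρ`. -/
def cutOrbit (κ ρ : ℝ) : ℕ → ℝ × ℝ
  | 0 => (0, ρ)
  | j + 1 =>
    ((cutOrbit κ ρ j).1 + (cutOrbit κ ρ j).2,
      (cutOrbit κ ρ j).2 + cutForce κ ((cutOrbit κ ρ j).1 + (cutOrbit κ ρ j).2))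

/-- `e` and `v` are the positions and velocities of an orbit segment of the standard map
`(e, v) ↦ (e + v, v + κ sin (2π (e + v)))` that goes from `0` to `1/2` in `m` steps, speeding up
all the time. -/
structure IsHalfOrbit (κ : ℝ) (m : ℕ) (e v : ℕ → ℝ) : Prop where
  position_zero : e 0 = 0
  position_end : e m = 1 / 2
  position_succ : ∀ j, e (j + 1) = e j + v j
  velocity_succ : ∀ j < m, v (j + 1) = v j + κ * Real.sin (2 * Real.pi * e (j + 1))
  velocity_nonneg : ∀ j, 0 ≤ v j
  velocity_monotone : Monotone v
  velocity_zero_le : v 0 ≤ 1 / (2 * m)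

/-- `y` and `V` are the positions and velocities of an orbit segment of the standard map with
parameter `κ` that goes from `1/2` to `3/2` in `2 * m` steps, stays away from both of them in
between, and ends with the velocity it started with. -/
structure IsTransitOrbit (κ : ℝ) (m : ℕ) (y V : ℕ → ℝ) : Prop where
  position_zero : y 0 = 1 / 2
  position_end : y (2 * m) = 3 / 2
  velocity_end : V (2 * m) = V 0
  position_succ : ∀ k, y (k + 1) = y k + V k
  velocity_succ : ∀ k < 2 * m, V (k + 1) = V k + κ * Real.sin (2 * Real.pi * y (k + 1))
  position_mem : ∀ k, 0 < k → k < 2 * m → y k ∈ Set.Icc (1 / 2 + √κ / 4) (3 / 2 - √κ / 4)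
  velocity_nonneg : ∀ k ≤ 2 * m, 0 ≤ V k
  velocity_sq_le : ∀ k ≤ 2 * m, V k ^ 2 ≤ κ + (1 / (2 * m)) ^ 2

theorem cutForce_nonneg {κ : ℝ} (hκ : 0 ≤ κ) (x : ℝ) : 0 ≤ cutForce κ x :=
  mul_nonneg hκ (le_max_left _ _)

theorem cutForce_of_mem_Icc {κ x : ℝ} (hx : x ∈ Set.Icc 0 (1 / 2)) :
    cutForce κ x = κ * Real.sin (2 * Real.pi * x) := by
  have := Real.pi_pos
  have sin_nonneg : 0 ≤ Real.sin (2 * Real.pi * x) :=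
    Real.sin_nonneg_of_nonneg_of_le_pi (mul_nonneg (by positivity) hx.1) (by nlinarith [hx.2])
  rw [cutForce, min_eq_left hx.2, max_eq_right sin_nonneg]

theorem continuous_cutOrbit (κ : ℝ) (j : ℕ) : Continuous fun ρ => cutOrbit κ ρ j := by
  induction j with
  | zero => exact continuous_const.prodMk continuous_id
  | succ j ih =>
    have continuous_position : Continuous fun ρ => (cutOrbit κ ρ j).1 + (cutOrbit κ ρ j).2 := by
      fun_prop
    have continuous_cutForce : Continuous (cutForce κ) := by unfold cutForce; fun_prop
    exact continuous_position.prodMk (ih.snd.add (continuous_cutForce.comp continuous_position))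

theorem cutOrbit_zero_velocity (κ : ℝ) (j : ℕ) : cutOrbit κ 0 j = (0, 0) := by
  induction j with
  | zero => rfl
  | succ j ih => simp [cutOrbit, ih, cutForce]

theorem le_cutOrbit {κ : ℝ} (hκ : 0 ≤ κ) (ρ : ℝ) (j : ℕ) :
    j * ρ ≤ (cutOrbit κ ρ j).1 ∧ ρ ≤ (cutOrbit κ ρ j).2 := by
  induction j with
  | zero => simp [cutOrbit]
  | succ j ih =>
    have := cutForce_nonneg hκ ((cutOrbit κ ρ j).1 + (cutOrbit κ ρ j).2)
    simp only [cutOrbit]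
    push_cast
    constructor <;> linarith [ih.1, ih.2]

theorem exists_cutOrbit_eq_half {κ : ℝ} (hκ : 0 ≤ κ) {m : ℕ} (hm : 1 ≤ m) :
    ∃ ρ, 0 ≤ ρ ∧ (cutOrbit κ ρ m).1 = 1 / 2 := by
  have half_mem : (1 / 2 : ℝ) ∈ Set.Icc (cutOrbit κ 0 m).1 (cutOrbit κ (1 / 2) m).1 := by
    have : (1 : ℝ) ≤ m := by exact_mod_cast hm
    rw [cutOrbit_zero_velocity]
    exact ⟨by norm_num, by linarith [(le_cutOrbit hκ (1 / 2) m).1]⟩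
  obtain ⟨ρ, ⟨hρ, -⟩, hρm⟩ := intermediate_value_Icc (show (0 : ℝ) ≤ 1 / 2 by norm_num)
    (continuous_cutOrbit κ m).fst.continuousOn half_mem
  exact ⟨ρ, hρ, hρm⟩

theorem exists_isHalfOrbit {κ : ℝ} (hκ : 0 ≤ κ) {m : ℕ} (hm : 1 ≤ m) :
    ∃ e v : ℕ → ℝ, IsHalfOrbit κ m e v := by
  obtain ⟨ρ, hρ, hρm⟩ := exists_cutOrbit_eq_half hκ hm
  have velocity_nonneg : ∀ j, 0 ≤ (cutOrbit κ ρ j).2 := fun j => hρ.trans (le_cutOrbit hκ ρ j).2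
  have position_monotone : Monotone fun j => (cutOrbit κ ρ j).1 :=
    monotone_nat_of_le_succ fun j => le_add_of_nonneg_right (velocity_nonneg j)
  refine ⟨fun j => (cutOrbit κ ρ j).1, fun j => (cutOrbit κ ρ j).2,
    { position_zero := rfl
      position_end := hρm
      position_succ := fun j => rfl
      velocity_succ := fun j hj => ?_
      velocity_nonneg := velocity_nonneg
      velocity_monotone := monotone_nat_of_le_succ fun j =>
        le_add_of_nonneg_right (cutForce_nonneg hκ _)
      velocity_zero_le := ?_ }⟩
  · rw [← cutForce_of_mem_Icc
      ⟨position_monotone (Nat.zero_le (j + 1)), (position_monotone hj).trans hρm.le⟩]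
    rfl
  · have : (1 : ℝ) ≤ m := by exact_mod_cast hm
    have := (le_cutOrbit hκ ρ m).1
    rw [le_div_iff₀ (by positivity)]
    change ρ * _ ≤ _
    linarith

theorem half_le_sin_two_pi_mul {x : ℝ} (h1 : 1 / 8 ≤ x) (h2 : x ≤ 3 / 8) :
    1 / 2 ≤ Real.sin (2 * Real.pi * x) := by
  have hpi := Real.pi_pos
  rw [← Real.cos_pi_div_two_sub, ← Real.cos_abs, ← Real.cos_pi_div_three]
  exact Real.cos_le_cos_of_nonneg_of_le_pi (abs_nonneg _) (by linarith)
    (abs_le.2 ⟨by nlinarith, by nlinarith⟩)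

namespace IsHalfOrbit

variable {κ : ℝ} {m : ℕ} {e v : ℕ → ℝ} (ho : IsHalfOrbit κ m e v)
include ho

theorem position_monotone : Monotone e := monotone_nat_of_le_succ fun j => by
  linarith [ho.position_succ j, ho.velocity_nonneg j]

theorem position_nonneg (j : ℕ) : 0 ≤ e j :=
  ho.position_zero.symm.le.trans (ho.position_monotone (Nat.zero_le j))

theorem velocity_sq_succ_sub {j : ℕ} (hj : j < m) : v (j + 1) ^ 2 - v j ^ 2 =
    κ * (v (j + 1) + v j) * Real.sin (2 * Real.pi * e (j + 1)) := by
  linear_combination (v (j + 1) + v j) * ho.velocity_succ j hj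

theorem velocity_sq_le (hκ : 0 ≤ κ) {j : ℕ} (hj : j < m) :
    v j ^ 2 ≤ v 0 ^ 2 + κ * (e (j + 1) + e j) := by
  induction j with
  | zero =>
    have := mul_nonneg hκ (ho.position_nonneg 1)
    rw [zero_add, ho.position_zero]
    linarith
  | succ j ih =>
    have velocity_sq_sub_le : v (j + 1) ^ 2 - v j ^ 2 ≤ κ * (v (j + 1) + v j) := by
      rw [ho.velocity_sq_succ_sub (by omega)]
      exact mul_le_of_le_one_right
        (mul_nonneg hκ (add_nonneg (ho.velocity_nonneg _) (ho.velocity_nonneg _)))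
        (Real.sin_le_one _)
    calc v (j + 1) ^ 2 ≤ v j ^ 2 + κ * (v (j + 1) + v j) := by linarith
      _ ≤ v 0 ^ 2 + κ * (e (j + 1) + e j) + κ * (v (j + 1) + v j) := by
        gcongr
        exact ih (by omega)
      _ = v 0 ^ 2 + κ * (e (j + 1 + 1) + e (j + 1)) := by
        rw [ho.position_succ (j + 1), ho.position_succ j]; ring

/-- On `[1/8, 3/8]` the force is at least `κ / 2`, so that crossing this interval increases the
kinetic energy by a definite multiple of `κ`. -/
theorem le_velocity_sq (hκ : 0 ≤ κ) {p : ℕ} (hp : p < m) {j : ℕ} (hj : j ≤ p) :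
    κ / 2 * (min (e (j + 1)) (3 / 8) - 1 / 8 - v p) ≤ v j ^ 2 := by
  induction j with
  | zero =>
    have position_one : e 1 = v 0 := by
      rw [← zero_add 1, ho.position_succ, ho.position_zero, zero_add]
    have : min (e 1) (3 / 8) - 1 / 8 - v p ≤ 0 := by
      linarith [min_le_left (e 1) (3 / 8), ho.velocity_monotone hj]
    nlinarith [sq_nonneg (v 0)]
  | succ j ih =>
    have ih := ih (by omega)
    have position_next := ho.position_succ (j + 1)
    have velocity_le := ho.velocity_monotone hj
    have velocity_nonneg := ho.velocity_nonneg
    have min_le_position := min_le_left (e (j + 1 + 1)) (3 / 8)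
    have min_le_const := min_le_right (e (j + 1 + 1)) (3 / 8)
    rcases lt_or_ge (e (j + 1)) (1 / 8) with hlt | hge
    · have : min (e (j + 1 + 1)) (3 / 8) - 1 / 8 - v p ≤ 0 := by linarith
      nlinarith [sq_nonneg (v (j + 1))]
    rcases le_or_gt (e (j + 1)) (3 / 8) with hle | hgt
    · rw [min_eq_left hle] at ih
      have energy_gain : κ * (v (j + 1) + v j) * (1 / 2) ≤ v (j + 1) ^ 2 - v j ^ 2 := by
        rw [ho.velocity_sq_succ_sub (by omega)]
        exact mul_le_mul_of_nonneg_left (half_le_sin_two_pi_mul hge hle)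
          (mul_nonneg hκ (add_nonneg (velocity_nonneg _) (velocity_nonneg _)))
      have : κ / 2 * (min (e (j + 1 + 1)) (3 / 8) - 1 / 8 - v p) ≤
          κ / 2 * (e (j + 1) - 1 / 8 - v p + v (j + 1)) :=
        mul_le_mul_of_nonneg_left (by linarith) (by positivity)
      linarith [mul_nonneg hκ (velocity_nonneg j)]
    · rw [min_eq_right hgt.le] at ih
      calc _ ≤ κ / 2 * (3 / 8 - 1 / 8 - v p) :=
            mul_le_mul_of_nonneg_left (by linarith) (by positivity)
        _ ≤ v j ^ 2 := ih
        _ ≤ v (j + 1) ^ 2 :=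
            pow_le_pow_left₀ (velocity_nonneg j) (ho.velocity_monotone j.le_succ) 2

theorem velocity_end_eq {p : ℕ} (hp : m = p + 1) : v m = v p := by
  rw [hp, ho.velocity_succ p (by omega), ← hp, ho.position_end,
    show 2 * Real.pi * (1 / 2) = Real.pi by ring, Real.sin_pi, mul_zero, add_zero]

theorem sqrt_div_four_le_velocity_end (hκ : 0 ≤ κ) (hκ4 : κ ≤ 1 / 4) (hm : 1 ≤ m) :
    √κ / 4 ≤ v m := by
  obtain ⟨p, hp⟩ : ∃ p, m = p + 1 := ⟨m - 1, by omega⟩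
  rw [ho.velocity_end_eq hp]
  have sqrt_le : √κ ≤ 1 / 2 := (Real.sqrt_le_left (by norm_num)).2 (by linarith)
  rcases le_or_gt (v p) (1 / 8) with hle | hgt
  · refine le_of_sq_le_sq ?_ (ho.velocity_nonneg p)
    have energy := ho.le_velocity_sq hκ (p := p) (by omega) le_rfl
    rw [← hp, ho.position_end, min_eq_right (by norm_num)] at energy
    have : κ / 2 * (1 / 8) ≤ κ / 2 * (3 / 8 - 1 / 8 - v p) :=
      mul_le_mul_of_nonneg_left (by linarith) (by positivity)
    rw [div_pow, Real.sq_sqrt hκ]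
    linarith
  · linarith

theorem velocity_end_sq_le (hκ : 0 ≤ κ) (hm : 1 ≤ m) : v m ^ 2 ≤ κ + (1 / (2 * m)) ^ 2 := by
  obtain ⟨p, hp⟩ : ∃ p, m = p + 1 := ⟨m - 1, by omega⟩
  rw [ho.velocity_end_eq hp]
  have energy := ho.velocity_sq_le hκ (j := p) (by omega)
  have velocity_zero_sq_le := pow_le_pow_left₀ (ho.velocity_nonneg 0) ho.velocity_zero_le 2
  have position_le : e p ≤ 1 / 2 := (ho.position_monotone (by omega)).trans ho.position_end.le
  rw [← hp, ho.position_end] at energy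
  nlinarith

end IsHalfOrbit

/-- The odd function on `ℤ` that extends the function `e` on `ℕ`, when `e 0 = 0`. -/
def oddExtension (e : ℕ → ℝ) (j : ℤ) : ℝ := j.sign * e j.natAbs

theorem oddExtension_neg (e : ℕ → ℝ) (j : ℤ) : oddExtension e (-j) = -oddExtension e j := by
  simp [oddExtension]

theorem oddExtension_natCast {e : ℕ → ℝ} (he : e 0 = 0) (n : ℕ) : oddExtension e n = e n := by
  rcases n.eq_zero_or_pos with rfl | hn
  · simp [oddExtension, he]
  · simp [oddExtension, Int.sign_natCast_of_ne_zero hn.ne']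

namespace IsHalfOrbit

variable {κ : ℝ} {m : ℕ} {e v : ℕ → ℝ} (ho : IsHalfOrbit κ m e v)
include ho

theorem oddExtension_succ_sub (j : ℕ) :
    oddExtension e (j + 1) - oddExtension e j = v j := by
  have := oddExtension_natCast ho.position_zero (j + 1)
  push_cast at this
  rw [this, oddExtension_natCast ho.position_zero, ho.position_succ, add_sub_cancel_left]

theorem oddExtension_neg_sub (j : ℕ) :
    oddExtension e (-j) - oddExtension e (-(j + 1)) = v j := by
  rw [oddExtension_neg, oddExtension_neg, ← ho.oddExtension_succ_sub]
  ring

/-- The standard map is reversible under `x ↦ -x`, as its force is odd. -/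
theorem oddExtension_second_difference {j : ℤ} (hj : |j| ≤ m) :
    oddExtension e (j + 1) - oddExtension e j = oddExtension e j - oddExtension e (j - 1) +
      κ * Real.sin (2 * Real.pi * oddExtension e j) := by
  have of_natCast : ∀ n : ℕ, n ≤ m →
      oddExtension e (n + 1) - oddExtension e n = oddExtension e n - oddExtension e (n - 1) +
        κ * Real.sin (2 * Real.pi * oddExtension e n)
    | 0, _ => by
      have := ho.oddExtension_neg_sub 0
      have := ho.oddExtension_succ_sub 0
      have zero : oddExtension e 0 = 0 := by simp [oddExtension]
      simp_all
    | n + 1, hn => by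
      have velocity_succ := ho.velocity_succ n (by omega)
      rw [← oddExtension_natCast ho.position_zero (n + 1), ← ho.oddExtension_succ_sub,
        ← ho.oddExtension_succ_sub] at velocity_succ
      push_cast at velocity_succ ⊢
      rw [velocity_succ, add_sub_cancel_right]
  obtain ⟨n, rfl | rfl⟩ := j.eq_nat_or_neg
  · exact of_natCast n (by simpa using hj)
  · have h := of_natCast n (by simpa using hj)
    rw [show -(n : ℤ) + 1 = -(n - 1) by ring, show -(n : ℤ) - 1 = -(n + 1) by ring,
      oddExtension_neg, oddExtension_neg, oddExtension_neg, mul_neg, Real.sin_neg]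
    linarith

theorem abs_oddExtension_le {j : ℤ} (hj : |j| < m) : |oddExtension e j| ≤ 1 / 2 - v m := by
  obtain ⟨p, hp⟩ : ∃ p, m = p + 1 := ⟨m - 1, by grind⟩
  have abs_sign_le : |(j.sign : ℝ)| ≤ 1 := by
    exact_mod_cast (by rcases j.sign_trichotomy with h | h | h <;> simp [h] : |j.sign| ≤ 1)
  have position_end := ho.position_end
  rw [hp, ho.position_succ] at position_end
  calc |oddExtension e j| = |(j.sign : ℝ)| * e j.natAbs := by
        rw [oddExtension, abs_mul, abs_of_nonneg (ho.position_nonneg _)]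
    _ ≤ e j.natAbs := mul_le_of_le_one_left (ho.position_nonneg _) abs_sign_le
    _ ≤ e p := ho.position_monotone (by have := abs_lt.1 hj; omega)
    _ = 1 / 2 - v m := by rw [ho.velocity_end_eq hp]; linarith

theorem exists_oddExtension_succ_sub_eq {j : ℤ} (hj : |j| ≤ m) :
    ∃ i ≤ m, oddExtension e (j + 1) - oddExtension e j = v i := by
  rcases le_or_gt 0 j with h | h
  · lift j to ℕ using h
    exact ⟨j, by simpa using hj, ho.oddExtension_succ_sub j⟩
  · obtain ⟨i, rfl⟩ : ∃ i : ℕ, j = -(i + 1) := ⟨(-j - 1).toNat, by omega⟩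
    refine ⟨i, by grind, ?_⟩
    rw [← ho.oddExtension_neg_sub, show -((i : ℤ) + 1) + 1 = -i by ring]

theorem isTransitOrbit (hκ : 0 ≤ κ) (hκ4 : κ ≤ 1 / 4) (hm : 1 ≤ m) :
    IsTransitOrbit κ m (fun k => 1 + oddExtension e (k - m))
      (fun k => oddExtension e (k - m + 1) - oddExtension e (k - m)) where
  position_zero := by
    rw [Nat.cast_zero, zero_sub, oddExtension_neg, oddExtension_natCast ho.position_zero,
      ho.position_end]
    norm_num
  position_end := by
    rw [show ((2 * m : ℕ) : ℤ) - m = m by push_cast; ring, oddExtension_natCast ho.position_zero,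
      ho.position_end]
    norm_num
  velocity_end := by
    obtain ⟨p, hp⟩ : ∃ p, m = p + 1 := ⟨m - 1, by omega⟩
    rw [show ((2 * m : ℕ) : ℤ) - m = m by push_cast; ring, ho.oddExtension_succ_sub,
      ho.velocity_end_eq hp, ← ho.oddExtension_neg_sub p, hp]
    push_cast
    ring_nf
  position_succ k := by
    push_cast
    rw [add_sub_right_comm]
    ring
  velocity_succ k hk := by
    have h := ho.oddExtension_second_difference (j := k - m + 1) (abs_le.2 ⟨by omega, by omega⟩)
    rw [add_sub_cancel_right] at h
    push_cast
    rw [add_sub_right_comm, h, mul_add, mul_one, add_comm (2 * Real.pi), Real.sin_add_two_pi]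
  position_mem k hk0 hk := by
    have := abs_le.1 (ho.abs_oddExtension_le (j := k - m) (abs_lt.2 ⟨by omega, by omega⟩))
    have := ho.sqrt_div_four_le_velocity_end hκ hκ4 hm
    constructor <;> linarith
  velocity_nonneg k hk := by
    obtain ⟨i, -, hi⟩ := ho.exists_oddExtension_succ_sub_eq (j := k - m)
      (abs_le.2 ⟨by omega, by omega⟩)
    exact hi ▸ ho.velocity_nonneg i
  velocity_sq_le k hk := by
    obtain ⟨i, him, hi⟩ := ho.exists_oddExtension_succ_sub_eq (j := k - m)
      (abs_le.2 ⟨by omega, by omega⟩)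
    rw [hi]
    exact (pow_le_pow_left₀ (ho.velocity_nonneg i) (ho.velocity_monotone him) 2).trans
      (ho.velocity_end_sq_le hκ hm)

end IsHalfOrbit

theorem exists_isTransitOrbit {κ : ℝ} (hκ : 0 ≤ κ) (hκ4 : κ ≤ 1 / 4) {m : ℕ} (hm : 1 ≤ m) :
    ∃ y V : ℕ → ℝ, IsTransitOrbit κ m y V :=
  let ⟨_, _, ho⟩ := exists_isHalfOrbit hκ hm
  ⟨_, _, ho.isTransitOrbit hκ hκ4 hm⟩

/-! ### Trains of bumps -/

open Classical in
/-- The sum over the integers `p` satisfying `χ` of the translates `b (s - p / Q)`, for a function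
`b` supported in `(-1 / (2 * Q), 1 / (2 * Q))`; rounding `Q * s` selects the only index `p` whose
translate may be nonzero at `s`. -/
def train (Q : ℕ) (χ : ℤ → Prop) (b : ℝ → ℝ) (s : ℝ) : ℝ :=
  if χ (round (Q * s)) then b (s - round (Q * s) / Q) else 0

theorem eventually_abs_sub_lt {s a r : ℝ} (h : |s - a| < r) : ∀ᶠ x in 𝓝 s, |x - a| < r :=
  (continuous_abs.comp (continuous_id.sub continuous_const)).continuousAt.eventually_lt_const h

theorem eventually_lt_abs_sub {s a r : ℝ} (h : r < |s - a|) : ∀ᶠ x in 𝓝 s, r < |x - a| :=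
  (continuous_abs.comp (continuous_id.sub continuous_const)).continuousAt.eventually_const_lt h

theorem round_eq_of_abs_sub_lt {x : ℝ} {p : ℤ} (h : |x - p| < 1 / 2) : round x = p := by
  rw [round_eq, Int.floor_eq_iff]
  have := abs_lt.1 h
  constructor <;> linarith

theorem abs_round_div_sub_le {q : ℝ} (hq : 0 < q) (x : ℝ) :
    |round (q * x) / q - x| ≤ 1 / (2 * q) := by
  rw [show round (q * x) / q - x = -((q * x - round (q * x)) / q) by field_simp; ring, abs_neg,
    abs_div, abs_of_pos hq, ← div_div]
  exact div_le_div_of_nonneg_right (abs_sub_round _) hq.le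

section

variable {Q : ℕ} {χ : ℤ → Prop} {b : ℝ → ℝ} {w : ℝ}

theorem abs_natCast_mul_sub (hQ : 0 < Q) (s p : ℝ) : |Q * s - p| = Q * |s - p / Q| := by
  have hQ' : (0 : ℝ) < Q := by exact_mod_cast hQ
  rw [← abs_of_pos hQ', ← abs_mul, abs_of_pos hQ', mul_sub, mul_div_cancel₀ _ hQ'.ne']

theorem round_natCast_mul_eq (hQ : 0 < Q) {p : ℤ} {s : ℝ} (hs : |s - p / Q| < 1 / (2 * Q)) :
    round (Q * s) = p := by
  refine round_eq_of_abs_sub_lt ?_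
  rw [abs_natCast_mul_sub hQ]
  rw [lt_div_iff₀ (by positivity)] at hs
  linarith

theorem abs_sub_round_natCast_mul_le (hQ : 0 < Q) (s : ℝ) (j : ℤ) :
    |s - round (Q * s) / Q| ≤ |s - j / Q| := by
  have := round_le (Q * s) j
  rw [abs_natCast_mul_sub hQ, abs_natCast_mul_sub hQ] at this
  exact le_of_mul_le_mul_left this (by exact_mod_cast hQ)

theorem train_apply (hQ : 0 < Q) {p : ℤ} {s : ℝ} (hs : |s - p / Q| < 1 / (2 * Q)) (hp : χ p) :
    train Q χ b s = b (s - p / Q) := by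
  rw [train, round_natCast_mul_eq hQ hs, if_pos hp]

theorem train_apply_of_not (hQ : 0 < Q) {p : ℤ} {s : ℝ} (hs : |s - p / Q| < 1 / (2 * Q))
    (hp : ¬ χ p) : train Q χ b s = 0 := by
  rw [train, round_natCast_mul_eq hQ hs, if_neg hp]

theorem train_eq_zero (hb : ∀ x, w ≤ |x| → b x = 0) {s : ℝ} (hs : ∀ j : ℤ, w ≤ |s - j / Q|) :
    train Q χ b s = 0 := by
  rw [train]
  split_ifs
  exacts [hb _ (hs _), rfl]

theorem train_eventuallyEq (hQ : 0 < Q) {p : ℤ} {s : ℝ} (hs : |s - p / Q| < 1 / (2 * Q))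
    (hp : χ p) : train Q χ b =ᶠ[𝓝 s] fun x => b (x - p / Q) := by
  filter_upwards [eventually_abs_sub_lt hs] with x hx using train_apply hQ hx hp

theorem train_eventuallyEq_zero (hQ : 0 < Q) (hb : ∀ x, w ≤ |x| → b x = 0)
    (hw : w < 1 / (2 * Q)) {s : ℝ} (hs : ∀ j, χ j → w < |s - j / Q|) :
    train Q χ b =ᶠ[𝓝 s] fun _ => 0 := by
  set p := round (Q * s)
  rcases lt_or_ge |s - p / Q| (1 / (2 * Q)) with hnear | hfar
  · by_cases hχ : χ p
    · filter_upwards [train_eventuallyEq (b := b) hQ hnear hχ, eventually_lt_abs_sub (hs p hχ)]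
        with x hx hx'
      rw [hx, hb _ hx'.le]
    · filter_upwards [eventually_abs_sub_lt hnear] with x hx using train_apply_of_not hQ hx hχ
  · filter_upwards [Metric.ball_mem_nhds s (sub_pos.2 hw)] with x hx
    refine train_eq_zero hb fun j => ?_
    have far_j := hfar.trans (abs_sub_round_natCast_mul_le hQ s j)
    have triangle := abs_sub_le s x (j / Q)
    rw [Metric.mem_ball, Real.dist_eq, abs_sub_comm] at hx
    linarith

theorem GevreyBound.train {α R A : ℝ} (hg : GevreyBound α R A b) (hR : 0 ≤ R) (hQ : 0 < Q)
    (hb : ∀ x, w ≤ |x| → b x = 0) (hw : w < 1 / (2 * Q)) :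
    GevreyBound α R A (train Q χ b) := by
  refine hg.of_locally hR fun s => ?_
  by_cases hs : ∃ p, χ p ∧ |s - p / Q| < 1 / (2 * Q)
  · obtain ⟨p, hp, hs⟩ := hs
    exact Or.inr ⟨_, train_eventuallyEq hQ hs hp⟩
  · push Not at hs
    exact Or.inl (train_eventuallyEq_zero hQ hb hw fun j hj => hw.trans_le (hs j hj))

theorem train_periodic (hQ : 0 < Q) (hχ : ∀ p : ℤ, χ (p + Q) ↔ χ p) :
    Function.Periodic (train Q χ b) 1 := by
  intro s
  have hQ' : (Q : ℝ) ≠ 0 := by exact_mod_cast hQ.ne'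
  have round_add : round ((Q : ℝ) * (s + 1)) = round ((Q : ℝ) * s) + Q := by
    rw [mul_add, mul_one, round_add_natCast]
  have sub_div : s + 1 - ((round ((Q : ℝ) * s) + Q : ℤ) : ℝ) / Q =
      s - (round ((Q : ℝ) * s) : ℝ) / Q := by
    push_cast
    field_simp
    ring
  have selected_iff : χ (round ((Q : ℝ) * (s + 1))) ↔ χ (round ((Q : ℝ) * s)) := by
    rw [round_add, hχ]
  by_cases h : χ (round ((Q : ℝ) * s))
  · rw [train, train, if_pos h, if_pos (selected_iff.2 h), round_add, sub_div]
  · rw [train, train, if_neg h, if_neg (mt selected_iff.1 h)]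

end

/-! ### The choice of the parameters -/

/-- The parameters attached to the resonances of order `Q`: the strength `κ` of the standard map,
its half period `m`, a bump `b` of width `1 / (Q log Q)` in the action `r₁` and a bump `f` of width
`√κ / (8 Q)` in the angle `θ₁`, with their Gevrey bounds `Ab` and `Af`. The fields `u_small` and
`v_small` bound the resonant terms of `u` and `v` by `δ`, and `time` leaves room, at the speed
`1 / (2 m) ^ 2`, for a drift by `Estar (2 ν)` in time `Estar ν`, at the scale `ν = 4 / Q`. -/
structure ResonanceData (α R δ C : ℝ) (Q : ℕ) where
  κ : ℝ
  m : ℕ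
  b : ℝ → ℝ
  f : ℝ → ℝ
  Ab : ℝ
  Af : ℝ
  le_Q : 16 ≤ Q
  two_lt_log : 2 < Real.log Q
  κ_pos : 0 < κ
  κ_le : κ ≤ 1 / 4
  Q_le_m : Q ≤ m
  speed : κ + (1 / (2 * (m : ℝ))) ^ 2 < (1 / (2 * Real.log Q)) ^ 2
  b_bound : GevreyBound α R Ab b
  b_one : ∀ x, |x| ≤ 1 / (Q * Real.log Q) / 2 → b x = 1
  b_zero : ∀ x, 1 / (Q * Real.log Q) ≤ |x| → b x = 0
  f_bound : GevreyBound α R Af f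
  f_one : ∀ x, |x| ≤ √κ / (8 * Q) / 2 → f x = 1
  f_zero : ∀ x, √κ / (8 * Q) ≤ |x| → f x = 0
  u_small : κ / (2 * Real.pi * Q ^ 2) *
    Real.exp (α * (2 * Real.pi * Q / R) ^ (1 / α)) * Ab ≤ δ
  v_small : Af * Ab * (1 / (2 * m * (2 * Real.pi * Q)) *
    Real.exp (α * (2 * Real.pi * Q / R) ^ (1 / α))) ≤ δ
  time : ((2 * m : ℕ) : ℝ) ^ 2 * (Estar C (1 / (α - 1)) (2 * (4 / Q)) + 2) ≤
    Estar C (1 / (α - 1)) (4 / Q)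

theorem Estar_pos (C γ ν : ℝ) : 0 < Estar C γ ν :=
  Real.exp_pos _

theorem Estar_div {C γ a x : ℝ} (ha : 0 < a) (hx : a < x) :
    Estar C γ (a / x) = Real.exp (Real.exp (C * (x / a * Real.log (x / a)) ^ γ)) := by
  have hx0 : 0 < x := ha.trans hx
  have log_pos : 0 < Real.log (x / a) := Real.log_pos (by rwa [one_lt_div ha])
  rw [Estar, E, show Real.log (a / x) = -Real.log (x / a) by rw [← Real.log_inv, inv_div],
    abs_neg, abs_of_pos log_pos, Real.rpow_neg (by positivity), ← Real.inv_rpow (by positivity),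
    inv_div, div_eq_mul_inv (Real.log _), inv_div, mul_comm (Real.log _)]

theorem mul_log_le_eight_mul {x : ℝ} (hx : 16 ≤ x) :
    x * Real.log x ≤ 8 * (x / 4 * Real.log (x / 4)) := by
  have log_le : Real.log x ≤ 2 * Real.log (x / 4) := by
    rw [← Nat.cast_ofNat, ← Real.log_pow]
    exact Real.log_le_log (by linarith) (by nlinarith)
  calc x * Real.log x ≤ x * (2 * Real.log (x / 4)) := by gcongr
    _ = 8 * (x / 4 * Real.log (x / 4)) := by ring

theorem Estar_two_mul_four_div_le {C γ x : ℝ} (hC : 0 ≤ C) (hγ : 0 ≤ γ) (hx : 16 ≤ x) :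
    Estar C γ (2 * (4 / x)) ≤
      Real.exp (Real.exp (2 ^ (-γ) * (C * (x / 4 * Real.log (x / 4)) ^ γ))) := by
  have log_nonneg : 0 ≤ Real.log (x / 4) := Real.log_nonneg (by linarith)
  have : 0 ≤ Real.log (x / 8) := Real.log_nonneg (by linarith)
  have log_le : Real.log (x / 8) ≤ Real.log (x / 4) :=
    Real.log_le_log (by linarith) (by linarith)
  rw [show 2 * (4 / x) = 8 / x by ring, Estar_div (by norm_num) (by linarith), Real.exp_le_exp,
    Real.exp_le_exp, Real.rpow_neg zero_le_two]
  calc C * (x / 8 * Real.log (x / 8)) ^ γ ≤ C * (x / 4 * Real.log (x / 4) / 2) ^ γ := by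
        have : x / 8 * Real.log (x / 8) ≤ x / 4 * Real.log (x / 4) / 2 := by nlinarith
        gcongr
    _ = (2 ^ γ)⁻¹ * (C * (x / 4 * Real.log (x / 4)) ^ γ) := by
        rw [Real.div_rpow (mul_nonneg (by linarith) log_nonneg) zero_le_two]
        ring

theorem forty_eight_le_exp_four : 48 ≤ Real.exp 4 := by
  calc (48 : ℝ) ≤ 2.7 ^ 4 := by norm_num
    _ ≤ Real.exp 1 ^ 4 := by
        gcongr
        linarith [Real.exp_one_gt_d9]
    _ = Real.exp 4 := by rw [← Real.exp_nat_mul]; norm_num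

theorem eventually_exp_exp_time {τ : ℝ} (hτ : τ < 1) :
    ∀ᶠ a : ℝ in Filter.atTop, 4 + 3 * Real.exp (τ * a) ≤ Real.exp a := by
  have tendsto : Filter.Tendsto (fun a : ℝ => Real.exp ((1 - τ) * a)) Filter.atTop Filter.atTop :=
    Real.tendsto_exp_atTop.comp (Filter.tendsto_id.const_mul_atTop (by linarith))
  filter_upwards [tendsto.eventually_ge_atTop 4, Real.tendsto_exp_atTop.eventually_ge_atTop 16]
    with a four_le sixteen_le
  have exp_eq : Real.exp a = Real.exp ((1 - τ) * a) * Real.exp (τ * a) := by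
    rw [← Real.exp_add]
    ring_nf
  nlinarith [Real.exp_pos (τ * a)]

/-- The weight `(Q log Q) ^ γ` of a resonance of order `Q`: up to a constant factor, it is the
logarithm of the Gevrey norm of a bump of width `1 / (Q log Q)`. -/
def resonanceWeight (γ x : ℝ) : ℝ := (x * Real.log x) ^ γ

theorem sq_mul_Estar_add_two_le {γ c x : ℝ} {m : ℕ} (hγ : 0 < γ) (hc : 0 < c) (hx : 16 ≤ x)
    (hm : (m : ℝ) ≤ 2 * Real.exp (Real.exp (c * resonanceWeight γ x)))
    (hexp : ∀ a, 2 * c * resonanceWeight γ x ≤ a →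
      4 + 3 * Real.exp (max (1 / 2) (2 ^ (-γ)) * a) ≤ Real.exp a) :
    ((2 * m : ℕ) : ℝ) ^ 2 * (Estar (2 * c * 8 ^ γ) γ (2 * (4 / x)) + 2) ≤
      Estar (2 * c * 8 ^ γ) γ (4 / x) := by
  have log_nonneg : 0 ≤ Real.log x := Real.log_nonneg (by linarith)
  have log_nonneg' : 0 ≤ Real.log (x / 4) := Real.log_nonneg (by linarith)
  have base_nonneg : 0 ≤ x / 4 * Real.log (x / 4) := mul_nonneg (by linarith) log_nonneg'
  set τ := max (1 / 2 : ℝ) (2 ^ (-γ))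
  set a : ℝ := 2 * c * 8 ^ γ * (x / 4 * Real.log (x / 4)) ^ γ with a_eq
  have : 0 ≤ a := by positivity
  have weight_le : 2 * c * resonanceWeight γ x ≤ a := by
    rw [a_eq, mul_assoc (2 * c), ← Real.mul_rpow (by norm_num) base_nonneg]
    have := mul_log_le_eight_mul hx
    have : 0 ≤ x * Real.log x := mul_nonneg (by linarith) log_nonneg
    unfold resonanceWeight
    gcongr
  set X := Real.exp (Real.exp (τ * a))
  have one_le_X : 1 ≤ X := Real.one_le_exp (Real.exp_pos _).le
  have two_mul_m_le : ((2 * m : ℕ) : ℝ) ≤ 4 * X := by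
    have half_le : 1 / 2 * a ≤ τ * a := by gcongr; exact le_max_left _ _
    have : Real.exp (Real.exp (c * resonanceWeight γ x)) ≤ X := by
      rw [Real.exp_le_exp, Real.exp_le_exp]
      linarith
    push_cast
    linarith
  have Estar_le : Estar (2 * c * 8 ^ γ) γ (2 * (4 / x)) ≤ X := by
    refine (Estar_two_mul_four_div_le (by positivity) hγ.le hx).trans ?_
    rw [Real.exp_le_exp, Real.exp_le_exp, ← a_eq]
    gcongr
    exact le_max_right _ _
  calc ((2 * m : ℕ) : ℝ) ^ 2 * (Estar (2 * c * 8 ^ γ) γ (2 * (4 / x)) + 2)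
      ≤ (4 * X) ^ 2 * (3 * X) := by gcongr <;> linarith [Estar_pos (2 * c * 8 ^ γ) γ (2 * (4 / x))]
    _ = 48 * X ^ 3 := by ring
    _ ≤ Real.exp 4 * X ^ 3 := by gcongr; exact forty_eight_le_exp_four
    _ = Real.exp (4 + 3 * Real.exp (τ * a)) := by
        rw [← Real.exp_nat_mul, ← Real.exp_add]
        norm_num
    _ ≤ Real.exp (Real.exp a) := Real.exp_le_exp.2 (hexp a weight_le)
    _ = Estar (2 * c * 8 ^ γ) γ (4 / x) := by rw [Estar_div (by norm_num) (by linarith)]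

theorem tendsto_resonanceWeight {γ : ℝ} (hγ : 0 < γ) :
    Filter.Tendsto (fun Q : ℕ => resonanceWeight γ Q) Filter.atTop Filter.atTop :=
  (tendsto_rpow_atTop hγ).comp
    (tendsto_natCast_atTop_atTop.atTop_mul_atTop₀
      (Real.tendsto_log_atTop.comp tendsto_natCast_atTop_atTop))

theorem eventually_mul_cube_le_exp_rpow (A : ℝ) {γ : ℝ} (hγ : 0 < γ) :
    ∀ᶠ Q : ℕ in Filter.atTop, A * (Q : ℝ) ^ 3 ≤ Real.exp ((Q : ℝ) ^ γ) := by
  have tendsto : Filter.Tendsto (fun Q : ℕ => (Q : ℝ) ^ γ) Filter.atTop Filter.atTop :=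
    (tendsto_rpow_atTop hγ).comp tendsto_natCast_atTop_atTop
  filter_upwards [((tendsto_exp_div_rpow_atTop (3 / γ)).comp tendsto).eventually_ge_atTop A,
    Filter.eventually_gt_atTop 0] with Q hQ hQ0
  have : (0 : ℝ) < Q := by exact_mod_cast hQ0
  rw [Function.comp_apply, ← Real.rpow_mul this.le, mul_div_cancel₀ _ hγ.ne',
    le_div_iff₀ (by positivity)] at hQ
  exact_mod_cast hQ

theorem eventually_add_mul_le_exp (A B : ℝ) :
    ∀ᶠ W : ℝ in Filter.atTop, A + B * W ≤ Real.exp W := by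
  filter_upwards [(Real.tendsto_exp_div_pow_atTop 1).eventually_ge_atTop (|A| + B),
    Filter.eventually_ge_atTop 1] with W hW one_le
  rw [pow_one, le_div_iff₀ (by linarith)] at hW
  nlinarith [le_abs_self A, abs_nonneg A]

theorem log_le_half {x : ℝ} (hx : 0 < x) : Real.log x ≤ x / 2 := by
  have log_eq : Real.log x = 2 * Real.log (√x) := by
    rw [Real.log_sqrt hx.le]
    ring
  nlinarith [Real.log_le_sub_one_of_pos (Real.sqrt_pos.2 hx), Real.mul_self_sqrt hx.le,
    sq_nonneg (√x - 2)]

theorem add_sq_lt_sq_inv_log {x m κ : ℝ} (hx : 1 < x) (hm : x ≤ m)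
    (hκ : κ ≤ 1 / (16 * x ^ 2)) :
    κ + (1 / (2 * m)) ^ 2 < (1 / (2 * Real.log x)) ^ 2 := by
  have hx0 : 0 < x := by linarith
  have hm0 : 0 < m := by linarith
  have log_pos : 0 < Real.log x := Real.log_pos hx
  have two_log_le : 2 * Real.log x ≤ x := by linarith [log_le_half hx0]
  calc κ + (1 / (2 * m)) ^ 2 ≤ 1 / (16 * x ^ 2) + (1 / (2 * x)) ^ 2 := by gcongr
    _ = 5 / 16 * (1 / x) ^ 2 := by field_simp; norm_num
    _ < (1 / x) ^ 2 := by linarith [sq_pos_of_pos (one_div_pos.2 hx0)]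
    _ ≤ (1 / (2 * Real.log x)) ^ 2 := by gcongr

/-- The logarithm of the standard map strength at a resonance of weight `W` is `-W` times this rate,
up to a factor `Q`; the bump in `r₁` costs the rate `c₁` and the resonant sine costs the rate `c₂`,
so that the resonant term of `u` has size `exp (-W)`. -/
def strengthRate (c₁ c₂ : ℝ) : ℝ := c₁ + c₂ + 1

/-- The iterated logarithm of the half period at a resonance of weight `W` is `W` times this rate.
The bump in `θ₁`, of width at least `exp (-(strengthRate c₁ c₂ / 2 + 1) * W)`, has a Gevrey norm of
iterated logarithm at most `(periodRate γ c₁ c₂ - 1) * W`, which the half period dominates. -/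
def periodRate (γ c₁ c₂ : ℝ) : ℝ := γ * (strengthRate c₁ c₂ / 2 + 1) + 1

/-- The inequalities that make `Q` large enough to carry a resonance. -/
structure IsLargeOrder (γ c₁ c₂ δ : ℝ) (Q : ℕ) : Prop where
  sixteen_le : 16 ≤ Q
  two_lt_log : 2 < Real.log Q
  mul_cube_le : 16 * (Q : ℝ) ^ 3 ≤ Real.exp ((Q : ℝ) ^ γ)
  neg_log_le : -Real.log δ ≤ resonanceWeight γ Q
  add_mul_le_exp : c₁ + strengthRate c₁ c₂ * resonanceWeight γ Q ≤
    Real.exp (resonanceWeight γ Q)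
  exp_exp_time : ∀ a, 2 * periodRate γ c₁ c₂ * resonanceWeight γ Q ≤ a →
    4 + 3 * Real.exp (max (1 / 2) (2 ^ (-γ)) * a) ≤ Real.exp a

theorem eventually_isLargeOrder {γ c₁ c₂ : ℝ} (hγ : 0 < γ) (hrate : 0 < periodRate γ c₁ c₂)
    (δ : ℝ) : ∀ᶠ Q : ℕ in Filter.atTop, IsLargeOrder γ c₁ c₂ δ Q := by
  have max_lt_one : max (1 / 2 : ℝ) (2 ^ (-γ)) < 1 := max_lt (by norm_num)
    (Real.rpow_lt_one_of_one_lt_of_neg (by norm_num) (by linarith))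
  have weight_tendsto := tendsto_resonanceWeight hγ
  have time_tendsto := weight_tendsto.const_mul_atTop (mul_pos two_pos hrate)
  filter_upwards [Filter.eventually_ge_atTop 16,
    (Real.tendsto_log_atTop.comp tendsto_natCast_atTop_atTop).eventually_gt_atTop 2,
    eventually_mul_cube_le_exp_rpow 16 hγ, weight_tendsto.eventually_ge_atTop (-Real.log δ),
    weight_tendsto.eventually (eventually_add_mul_le_exp c₁ (strengthRate c₁ c₂)),
    time_tendsto.eventually_forall_ge_atTop (eventually_exp_exp_time max_lt_one)]
    with Q h₁ h₂ h₃ h₄ h₅ h₆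
  exact ⟨h₁, h₂, h₃, h₄, h₅, h₆⟩

namespace IsLargeOrder

variable {γ c₁ c₂ δ : ℝ} {Q : ℕ}

theorem sixteen_le_cast (h : IsLargeOrder γ c₁ c₂ δ Q) : (16 : ℝ) ≤ Q := by
  exact_mod_cast h.sixteen_le

theorem rpow_le_weight (h : IsLargeOrder γ c₁ c₂ δ Q) (hγ : 0 ≤ γ) :
    (Q : ℝ) ^ γ ≤ resonanceWeight γ Q :=
  Real.rpow_le_rpow (Nat.cast_nonneg Q)
    (le_mul_of_one_le_right (Nat.cast_nonneg Q) (by linarith [h.two_lt_log])) hγ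

theorem one_le_weight (h : IsLargeOrder γ c₁ c₂ δ Q) (hγ : 0 ≤ γ) :
    1 ≤ resonanceWeight γ Q :=
  (Real.one_le_rpow (by linarith [h.sixteen_le_cast]) hγ).trans (h.rpow_le_weight hγ)

theorem mul_cube_le_exp_weight (h : IsLargeOrder γ c₁ c₂ δ Q) (hγ : 0 ≤ γ) :
    16 * (Q : ℝ) ^ 3 ≤ Real.exp (resonanceWeight γ Q) :=
  h.mul_cube_le.trans (Real.exp_le_exp.2 (h.rpow_le_weight hγ))

theorem eight_mul_le_exp_weight (h : IsLargeOrder γ c₁ c₂ δ Q) (hγ : 0 ≤ γ) :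
    8 * (Q : ℝ) ≤ Real.exp (resonanceWeight γ Q) := by
  have : (Q : ℝ) ≤ Q ^ 3 := le_self_pow₀ (by linarith [h.sixteen_le_cast]) (by norm_num)
  linarith [h.mul_cube_le_exp_weight hγ, h.sixteen_le_cast]

theorem exp_neg_weight_le (h : IsLargeOrder γ c₁ c₂ δ Q) (hδ : 0 < δ) :
    Real.exp (-resonanceWeight γ Q) ≤ δ := by
  rw [← Real.exp_log hδ, Real.exp_le_exp]
  linarith [h.neg_log_le]

theorem exp_sineCost_le (h : IsLargeOrder γ c₁ c₂ δ Q) {α R : ℝ} (hα : 0 < α) (hR : 0 < R)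
    (hγα : 1 / α ≤ γ) :
    Real.exp (α * (2 * Real.pi * Q / R) ^ (1 / α)) ≤
      Real.exp (α * (2 * Real.pi / R) ^ (1 / α) * resonanceWeight γ Q) := by
  have hγ : 0 ≤ γ := (one_div_pos.2 hα).le.trans hγα
  have : (Q : ℝ) ^ (1 / α) ≤ resonanceWeight γ Q :=
    (Real.rpow_le_rpow_of_exponent_le (by linarith [h.sixteen_le_cast]) hγα).trans
      (h.rpow_le_weight hγ)
  rw [Real.exp_le_exp, mul_div_right_comm,
    Real.mul_rpow (by have := Real.pi_pos; positivity) (Nat.cast_nonneg Q), ← mul_assoc]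
  have := Real.pi_pos
  gcongr

end IsLargeOrder

section

variable {x W : ℝ}

theorem mul_exp_neg_le_of_cube_le {c : ℝ} (hx : 0 < x) (hc : 1 ≤ c) (hW : 0 ≤ W)
    (hcube : 16 * x ^ 3 ≤ Real.exp W) : x * Real.exp (-(c * W)) ≤ 1 / (16 * x ^ 2) := by
  rw [le_div_iff₀ (by positivity)]
  calc x * Real.exp (-(c * W)) * (16 * x ^ 2) = 16 * x ^ 3 * Real.exp (-(c * W)) := by ring
    _ ≤ Real.exp W * Real.exp (-W) := by
        gcongr
        exact le_mul_of_one_le_left hW hc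
    _ = 1 := by rw [← Real.exp_add, add_neg_cancel, Real.exp_zero]

theorem exp_neg_le_sqrt_div (c : ℝ) (hx : 1 ≤ x) (hexp : 8 * x ≤ Real.exp W) :
    Real.exp (-((c / 2 + 1) * W)) ≤ √(x * Real.exp (-(c * W))) / (8 * x) := by
  have le_sqrt : Real.exp (-(c / 2 * W)) ≤ √(x * Real.exp (-(c * W))) := by
    refine Real.le_sqrt_of_sq_le ?_
    calc Real.exp (-(c / 2 * W)) ^ 2 = Real.exp (-(c * W)) := by
          rw [← Real.exp_nat_mul]
          push_cast
          ring_nf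
      _ ≤ x * Real.exp (-(c * W)) := le_mul_of_one_le_left (Real.exp_pos _).le hx
  rw [le_div_iff₀ (by linarith)]
  calc Real.exp (-((c / 2 + 1) * W)) * (8 * x)
      ≤ Real.exp (-((c / 2 + 1) * W)) * Real.exp W := by gcongr
    _ = Real.exp (-(c / 2 * W)) := by
        rw [← Real.exp_add]
        ring_nf
    _ ≤ _ := le_sqrt

theorem rpow_neg_sqrt_div_le {γ : ℝ} (c : ℝ) (hγ : 0 ≤ γ) (hx : 1 ≤ x)
    (hexp : 8 * x ≤ Real.exp W) :
    (√(x * Real.exp (-(c * W))) / (8 * x)) ^ (-γ) ≤ Real.exp (γ * (c / 2 + 1) * W) := by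
  refine (Real.rpow_le_rpow_of_nonpos (Real.exp_pos _) (exp_neg_le_sqrt_div c hx hexp)
    (neg_nonpos.2 hγ)).trans_eq ?_
  rw [← Real.exp_mul]
  ring_nf

theorem ceil_exp_exp_le (t : ℝ) :
    (⌈Real.exp (Real.exp t)⌉₊ : ℝ) ≤ 2 * Real.exp (Real.exp t) := by
  linarith [Nat.ceil_lt_add_one (Real.exp_pos (Real.exp t)).le,
    Real.one_le_exp (Real.exp_pos t).le]

theorem one_div_rpow_neg {y γ : ℝ} (hy : 0 ≤ y) : (1 / y) ^ (-γ) = y ^ γ := by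
  rw [one_div, Real.rpow_neg (inv_nonneg.2 hy), Real.inv_rpow hy, inv_inv]

theorem u_amplitude_le {c₁ c₂ S : ℝ} (hx : 1 ≤ x) (hS0 : 0 ≤ S)
    (hS : S ≤ Real.exp (c₂ * W)) :
    x * Real.exp (-(strengthRate c₁ c₂ * W)) / (2 * Real.pi * x ^ 2) * S *
      Real.exp (c₁ * W) ≤ Real.exp (-W) := by
  have pi_gt := Real.pi_gt_three
  have strength_le : x * Real.exp (-(strengthRate c₁ c₂ * W)) / (2 * Real.pi * x ^ 2) ≤
      Real.exp (-(strengthRate c₁ c₂ * W)) := by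
    rw [div_le_iff₀ (by positivity), mul_comm]
    gcongr
    nlinarith
  calc _ ≤ Real.exp (-(strengthRate c₁ c₂ * W)) * Real.exp (c₂ * W) * Real.exp (c₁ * W) := by
        gcongr
    _ = Real.exp (-W) := by
        rw [← Real.exp_add, ← Real.exp_add, strengthRate]
        ring_nf

theorem v_amplitude_le {c₁ c₂ c S m : ℝ} (hc : 0 ≤ c) (hW : 0 ≤ W) (hx : 1 ≤ x)
    (hrate : 0 ≤ strengthRate c₁ c₂) (hm : Real.exp (Real.exp ((c + 1) * W)) ≤ m)
    (hS0 : 0 ≤ S) (hS : S ≤ Real.exp (c₂ * W))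
    (hexp : c₁ + strengthRate c₁ c₂ * W ≤ Real.exp W) :
    Real.exp (c₁ * Real.exp (c * W)) * Real.exp (c₁ * W) * (1 / (2 * m * (2 * Real.pi * x)) * S) ≤
      Real.exp (-W) := by
  have pi_gt := Real.pi_gt_three
  have m_pos : 0 < m := (Real.exp_pos _).trans_le hm
  have period_le : 1 / (2 * m * (2 * Real.pi * x)) ≤ Real.exp (-Real.exp ((c + 1) * W)) := by
    rw [Real.exp_neg, ← one_div]
    refine one_div_le_one_div_of_le (Real.exp_pos _) (hm.trans ?_)
    nlinarith [mul_le_mul pi_gt.le hx zero_le_one Real.pi_pos.le]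
  have exponent_le :
      c₁ * Real.exp (c * W) + strengthRate c₁ c₂ * W ≤ Real.exp ((c + 1) * W) := by
    have one_le : 1 ≤ Real.exp (c * W) := Real.one_le_exp (by positivity)
    calc c₁ * Real.exp (c * W) + strengthRate c₁ c₂ * W
        ≤ c₁ * Real.exp (c * W) + strengthRate c₁ c₂ * W * Real.exp (c * W) := by
          refine add_le_add_right ?_ _
          exact le_mul_of_one_le_right (mul_nonneg hrate hW) one_le
      _ = (c₁ + strengthRate c₁ c₂ * W) * Real.exp (c * W) := by ring
      _ ≤ Real.exp W * Real.exp (c * W) := by gcongr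
      _ = Real.exp ((c + 1) * W) := by
          rw [← Real.exp_add]
          ring_nf
  calc _ ≤ Real.exp (c₁ * Real.exp (c * W)) * Real.exp (c₁ * W) *
        (Real.exp (-Real.exp ((c + 1) * W)) * Real.exp (c₂ * W)) := by gcongr
    _ = Real.exp (c₁ * Real.exp (c * W) + c₁ * W + (-Real.exp ((c + 1) * W) + c₂ * W)) := by
        rw [← Real.exp_add, ← Real.exp_add, ← Real.exp_add]
    _ ≤ Real.exp (-W) := by
        rw [Real.exp_le_exp]
        rw [strengthRate] at exponent_le
        linarith

end

theorem IsLargeOrder.strength_le {γ c₁ c₂ δ c : ℝ} {Q : ℕ} (h : IsLargeOrder γ c₁ c₂ δ Q)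
    (hγ : 0 ≤ γ) (hc : 1 ≤ c) :
    Q * Real.exp (-(c * resonanceWeight γ Q)) ≤ 1 / (16 * (Q : ℝ) ^ 2) :=
  mul_exp_neg_le_of_cube_le (by linarith [h.sixteen_le_cast]) hc
    (by linarith [h.one_le_weight hγ]) (h.mul_cube_le_exp_weight hγ)

theorem IsLargeOrder.strength_le_quarter {γ c₁ c₂ δ c : ℝ} {Q : ℕ}
    (h : IsLargeOrder γ c₁ c₂ δ Q) (hγ : 0 ≤ γ) (hc : 1 ≤ c) :
    Q * Real.exp (-(c * resonanceWeight γ Q)) ≤ 1 / 4 := by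
  have hQ := h.sixteen_le_cast
  exact (h.strength_le hγ hc).trans (one_div_le_one_div_of_le (by norm_num) (by nlinarith))

theorem IsLargeOrder.one_div_mul_log_le_one {γ c₁ c₂ δ : ℝ} {Q : ℕ}
    (h : IsLargeOrder γ c₁ c₂ δ Q) : 1 / (Q * Real.log Q) ≤ 1 := by
  have hQ := h.sixteen_le_cast
  have hlog := h.two_lt_log
  exact div_le_one_of_le₀ (by nlinarith) (by positivity)

theorem IsLargeOrder.sqrt_strength_div_le_one {γ c₁ c₂ δ c : ℝ} {Q : ℕ}
    (h : IsLargeOrder γ c₁ c₂ δ Q) (hγ : 0 ≤ γ) (hc : 1 ≤ c) :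
    √(Q * Real.exp (-(c * resonanceWeight γ Q))) / (8 * Q) ≤ 1 := by
  have sqrt_le_one := Real.sqrt_le_one.2 ((h.strength_le_quarter hγ hc).trans (by norm_num))
  exact div_le_one_of_le₀ (by linarith [h.sixteen_le_cast]) (by positivity)

theorem IsLargeOrder.le_of_exp_exp_le {γ c₁ c₂ δ c m : ℝ} {Q : ℕ}
    (h : IsLargeOrder γ c₁ c₂ δ Q) (hγ : 0 ≤ γ) (hc : 1 ≤ c)
    (hm : Real.exp (Real.exp (c * resonanceWeight γ Q)) ≤ m) : (Q : ℝ) ≤ m :=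
  calc (Q : ℝ) ≤ 8 * Q := by linarith [h.sixteen_le_cast]
    _ ≤ Real.exp (resonanceWeight γ Q) := h.eight_mul_le_exp_weight hγ
    _ ≤ Real.exp (c * resonanceWeight γ Q) :=
        Real.exp_le_exp.2 (le_mul_of_one_le_left (by linarith [h.one_le_weight hγ]) hc)
    _ ≤ Real.exp (Real.exp (c * resonanceWeight γ Q)) := by
        linarith [Real.add_one_le_exp (Real.exp (c * resonanceWeight γ Q))]
    _ ≤ m := hm

theorem IsLargeOrder.nonempty_resonanceData {α R c₁ δ : ℝ} {Q : ℕ} (hα : 1 < α) (hR : 0 < R)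
    (hδ : 0 < δ) (hc₁ : 0 < c₁)
    (hbump : ∀ w : ℝ, 0 < w → w ≤ 1 → ∃ b : ℝ → ℝ,
      GevreyBound α R (Real.exp (c₁ * w ^ (-(1 / (α - 1))))) b ∧
        (∀ x, |x| ≤ w / 2 → b x = 1) ∧ ∀ x, w ≤ |x| → b x = 0)
    (h : IsLargeOrder (1 / (α - 1)) c₁ (α * (2 * Real.pi / R) ^ (1 / α)) δ Q) :
    Nonempty (ResonanceData α R δ (2 * periodRate (1 / (α - 1)) c₁
      (α * (2 * Real.pi / R) ^ (1 / α)) * 8 ^ (1 / (α - 1))) Q) := by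
  set γ := 1 / (α - 1)
  set c₂ := α * (2 * Real.pi / R) ^ (1 / α)
  have hγ : 0 < γ := one_div_pos.2 (by linarith)
  have hc₂ : 0 ≤ c₂ := by have := Real.pi_pos; positivity
  have one_le_rate : 1 ≤ strengthRate c₁ c₂ := by unfold strengthRate; linarith
  have hQ := h.sixteen_le_cast
  have hlog := h.two_lt_log
  have hW := h.one_le_weight hγ.le
  have hS := h.exp_sineCost_le (zero_lt_one.trans hα) hR
    (one_div_le_one_div_of_le (by linarith) (by linarith))
  set W := resonanceWeight γ Q
  set κ := Q * Real.exp (-(strengthRate c₁ c₂ * W))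
  set m := ⌈Real.exp (Real.exp (periodRate γ c₁ c₂ * W))⌉₊
  have κ_pos : 0 < κ := by positivity
  obtain ⟨b, b_bound, b_one, b_zero⟩ :=
    hbump (1 / (Q * Real.log Q)) (by positivity) h.one_div_mul_log_le_one
  obtain ⟨f, f_bound, f_one, f_zero⟩ :=
    hbump (√κ / (8 * Q)) (by positivity) (h.sqrt_strength_div_le_one hγ.le one_le_rate)
  have rpow_le := rpow_neg_sqrt_div_le (strengthRate c₁ c₂) hγ.le (by linarith)
    (h.eight_mul_le_exp_weight hγ.le)
  have m_ge : Real.exp (Real.exp (periodRate γ c₁ c₂ * W)) ≤ m := Nat.le_ceil _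
  have Q_le_m := h.le_of_exp_exp_le hγ.le (by unfold periodRate; nlinarith) m_ge
  exact ⟨{
    κ, m, b, f
    Ab := Real.exp (c₁ * W)
    Af := Real.exp (c₁ * Real.exp (γ * (strengthRate c₁ c₂ / 2 + 1) * W))
    le_Q := h.sixteen_le
    two_lt_log := hlog
    κ_pos, κ_le := h.strength_le_quarter hγ.le one_le_rate
    Q_le_m := by exact_mod_cast Q_le_m
    speed := add_sq_lt_sq_inv_log (by linarith) Q_le_m (h.strength_le hγ.le one_le_rate)
    b_bound := by rwa [one_div_rpow_neg (by positivity)] at b_bound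
    b_one, b_zero
    f_bound := f_bound.mono hR.le (by gcongr)
    f_one, f_zero
    u_small := (u_amplitude_le (by linarith) (Real.exp_pos _).le hS).trans
      (h.exp_neg_weight_le hδ)
    v_small := (v_amplitude_le (by positivity) (by linarith) (by linarith) (by linarith) m_ge
      (Real.exp_pos _).le hS h.add_mul_le_exp).trans (h.exp_neg_weight_le hδ)
    time := sq_mul_Estar_add_two_le hγ (by unfold periodRate; positivity) hQ
      (ceil_exp_exp_le _) h.exp_exp_time }⟩

theorem exists_resonanceData {α R : ℝ} (hα : 1 < α) (hR : 0 < R) :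
    ∃ C : ℝ, 0 < C ∧ ∀ δ : ℝ, 0 < δ →
      ∀ᶠ Q : ℕ in Filter.atTop, Nonempty (ResonanceData α R δ C Q) := by
  have hγ : 0 < 1 / (α - 1) := one_div_pos.2 (by linarith)
  obtain ⟨c₁, hc₁, hbump⟩ := exists_gevreyBound_bump hγ hR
  rw [one_div_one_div, add_sub_cancel] at hbump
  have rate_pos : 0 < periodRate (1 / (α - 1)) c₁ (α * (2 * Real.pi / R) ^ (1 / α)) := by
    have := Real.pi_pos
    unfold periodRate strengthRate
    positivity
  refine ⟨_, mul_pos (mul_pos two_pos rate_pos) (by positivity : (0 : ℝ) < 8 ^ (1 / (α - 1))),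
    fun δ hδ => ?_⟩
  filter_upwards [eventually_isLargeOrder hγ rate_pos δ] with Q h
  exact h.nonempty_resonanceData hα hR hδ hc₁ hbump

/-! ### The sequence of resonances and the perturbations `u` and `v` -/

/-- Orders of resonance `Q n` with their parameters, growing so fast that the spacing `1 / Q n` of
the resonances of order `Q n` is at most the width of the zones of every smaller order (`sep`), and
that the resonant zones fill a set of measure at most `ε` of each period (`le_log`). -/
structure ResonanceSeq (α R C ε : ℝ) where
  Q : ℕ → ℕ
  data : ∀ n, ResonanceData α R (ε / (64 * 2 ^ n)) C (Q n)
  sep : ∀ m n, m < n → Q m * Real.log (Q m) ≤ Q n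
  le_log : ∀ n, 8 * 2 ^ (n + 1) / ε ≤ Real.log (Q n)
  le_Q : ∀ n, n ≤ Q n
  one_lt_α : 1 < α
  R_pos : 0 < R
  ε_pos : 0 < ε

theorem exists_fast_sequence (N g : ℕ → ℕ) :
    ∃ Q : ℕ → ℕ, (∀ n, N n ≤ Q n) ∧ ∀ m n, m < n → g (Q m) ≤ Q n := by
  let Q : ℕ → ℕ := Nat.rec (N 0) fun k q => max (N (k + 1)) (max q (g q))
  have monotone : Monotone Q :=
    monotone_nat_of_le_succ fun _ => (le_max_left _ _).trans (le_max_right _ _)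
  refine ⟨Q, fun n => ?_, fun m n hmn => ?_⟩
  · cases n with
    | zero => exact le_rfl
    | succ n => exact le_max_left _ _
  · exact ((le_max_right _ _).trans (le_max_right _ _)).trans (monotone (Nat.succ_le_of_lt hmn))

theorem exists_resonanceSeq {α R : ℝ} (hα : 1 < α) (hR : 0 < R) :
    ∃ C : ℝ, 0 < C ∧ ∀ ε : ℝ, 0 < ε → Nonempty (ResonanceSeq α R C ε) := by
  obtain ⟨C, hC, hdata⟩ := exists_resonanceData hα hR
  refine ⟨C, hC, fun ε hε => ?_⟩
  have eventually_data : ∀ n : ℕ, ∃ N : ℕ, ∀ Q, N ≤ Q →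
      Nonempty (ResonanceData α R (ε / (64 * 2 ^ n)) C Q) ∧
        8 * 2 ^ (n + 1) / ε ≤ Real.log Q ∧ n ≤ Q := fun n =>
    Filter.eventually_atTop.1 <| (hdata (ε / (64 * 2 ^ n)) (by positivity)).and <|
      ((Real.tendsto_log_atTop.comp tendsto_natCast_atTop_atTop).eventually_ge_atTop _).and
        (Filter.eventually_ge_atTop n)
  choose N hN using eventually_data
  obtain ⟨Q, hQN, hQ⟩ := exists_fast_sequence N fun q => ⌈(q : ℝ) * Real.log q⌉₊
  exact ⟨{ Q := Q
           data := fun n => (hN n (Q n) (hQN n)).1.some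
           sep := fun m n hmn => (Nat.le_ceil _).trans (by exact_mod_cast hQ m n hmn)
           le_log := fun n => (hN n (Q n) (hQN n)).2.1
           le_Q := fun n => (hN n (Q n) (hQN n)).2.2
           one_lt_α := hα
           R_pos := hR
           ε_pos := hε }⟩

namespace ResonanceSeq

variable {α R C ε : ℝ} (S : ResonanceSeq α R C ε) (ω₁ : ℝ)

/-- The half width of the resonant zones of order `Q n`. -/
def zoneWidth (n : ℕ) : ℝ := 1 / (S.Q n * Real.log (S.Q n))

/-- The resonance `p / Q n` is kept if its zone does not meet the zones of smaller order. -/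
def Admissible (n : ℕ) (p : ℤ) : Prop :=
  ∀ m, m < n → ∀ j : ℤ, S.zoneWidth m + S.zoneWidth n ≤ |(p : ℝ) / S.Q n - j / S.Q m|

/-- The bumps in the action `r₁` that localize the perturbation at the admissible resonances
`r₁ + ω₁ = p / Q n`. -/
def actionBump (n : ℕ) (r : ℝ) : ℝ := train (S.Q n) (S.Admissible n) (S.data n).b (r + ω₁)

/-- The bumps in the angle `θ₁`, centred at the points of `(ℤ + 1/2) / Q n`, where the
transit orbits of the standard map start. -/
def angleBump (n : ℕ) (θ : ℝ) : ℝ :=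
  train (S.Q n) (fun _ => True) (S.data n).f (θ + -(1 / (2 * S.Q n)))

/-- The potential `κ / (2π Q²) cos (2π Q θ)`, whose flow makes `Q θ₁` follow the standard map of
strength `κ`; the cosine is written as a shifted sine. -/
def kickPotential (n : ℕ) (θ : ℝ) : ℝ :=
  (S.data n).κ / (2 * Real.pi * S.Q n ^ 2) *
    Real.sin (2 * Real.pi * S.Q n * θ + Real.pi / 2)

/-- The potential `- sin (2π Q θ) / (4π Q m)`, whose flow increases `r₂` by `1 / (2 m)` at the
points `θ₂` of `ℤ / Q`. -/
def driftPotential (n : ℕ) (θ : ℝ) : ℝ :=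
  -(1 / (2 * (S.data n).m * (2 * Real.pi * S.Q n))) *
    Real.sin (2 * Real.pi * S.Q n * θ + 0)

/-- The actions `r₁` at distance at least twice the zone width from every resonance. -/
def flatSet : Set ℝ := {r | ∀ m, ∀ j : ℤ, 2 * S.zoneWidth m ≤ |r + ω₁ - j / S.Q m|}

theorem Q_pos (n : ℕ) : 0 < S.Q n := lt_of_lt_of_le (by norm_num) (S.data n).le_Q

theorem Q_cast_pos (n : ℕ) : (0 : ℝ) < S.Q n := by exact_mod_cast S.Q_pos n

theorem log_Q_pos (n : ℕ) : 0 < Real.log (S.Q n) := by linarith [(S.data n).two_lt_log]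

theorem zoneWidth_pos (n : ℕ) : 0 < S.zoneWidth n :=
  one_div_pos.2 (mul_pos (S.Q_cast_pos n) (S.log_Q_pos n))

theorem zoneWidth_lt (n : ℕ) : S.zoneWidth n < 1 / (2 * S.Q n) := by
  have := S.Q_cast_pos n
  refine one_div_lt_one_div_of_lt (by positivity) ?_
  nlinarith [(S.data n).two_lt_log]

theorem inv_Q_le_zoneWidth {m n : ℕ} (h : m < n) : 1 / (S.Q n : ℝ) ≤ S.zoneWidth m :=
  one_div_le_one_div_of_le (mul_pos (S.Q_cast_pos m) (S.log_Q_pos m)) (S.sep m n h)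

theorem one_le_m (n : ℕ) : 1 ≤ (S.data n).m :=
  (S.Q_pos n).trans_le (S.data n).Q_le_m

theorem admissible_add_Q_iff (n : ℕ) (p : ℤ) : S.Admissible n (p + S.Q n) ↔ S.Admissible n p := by
  have Q_ne := fun n => (S.Q_cast_pos n).ne'
  refine forall₂_congr fun m _ => (Equiv.addRight (S.Q m : ℤ)).forall_congr_right.symm.trans ?_
  refine forall_congr' fun j => ?_
  rw [Equiv.coe_addRight, Int.cast_add, Int.cast_add, Int.cast_natCast, Int.cast_natCast, add_div,
    add_div, div_self (Q_ne n), div_self (Q_ne m), add_sub_add_right_eq_sub]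

theorem actionBump_periodic (n : ℕ) : Function.Periodic (S.actionBump ω₁ n) 1 := fun r => by
  rw [actionBump, actionBump, add_right_comm]
  exact train_periodic (S.Q_pos n) (S.admissible_add_Q_iff n) (r + ω₁)

theorem angleBump_periodic (n : ℕ) : Function.Periodic (S.angleBump n) 1 := fun θ => by
  rw [angleBump, angleBump, add_right_comm]
  exact train_periodic (S.Q_pos n) (fun _ => Iff.rfl) _

theorem sine_periodic (n : ℕ) (A b : ℝ) :
    Function.Periodic (fun θ => A * Real.sin (2 * Real.pi * S.Q n * θ + b)) 1 := fun θ => by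
  simp only
  rw [show 2 * Real.pi * S.Q n * (θ + 1) + b =
    2 * Real.pi * S.Q n * θ + b + (S.Q n : ℕ) * (2 * Real.pi) by ring, Real.sin_add_nat_mul_two_pi]

theorem kickPotential_periodic (n : ℕ) : Function.Periodic (S.kickPotential n) 1 :=
  S.sine_periodic n _ _

theorem driftPotential_periodic (n : ℕ) : Function.Periodic (S.driftPotential n) 1 :=
  S.sine_periodic n _ _

/-- The Gevrey bound for `sin (2π Q θ + b)`. -/
def sineBound (n : ℕ) : ℝ := Real.exp (α * (2 * Real.pi * S.Q n / R) ^ (1 / α))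

theorem actionBump_bound (n : ℕ) : GevreyBound α R (S.data n).Ab (S.actionBump ω₁ n) :=
  ((S.data n).b_bound.train S.R_pos.le (S.Q_pos n) (S.data n).b_zero
    (S.zoneWidth_lt n)).comp_add_const ω₁

theorem angleWidth_lt (n : ℕ) : √(S.data n).κ / (8 * S.Q n) < 1 / (2 * S.Q n) := by
  have := S.Q_cast_pos n
  have sqrt_le : √(S.data n).κ ≤ 1 := Real.sqrt_le_one.2 (by linarith [(S.data n).κ_le])
  rw [div_lt_div_iff₀ (by positivity) (by positivity)]
  nlinarith

theorem angleBump_bound (n : ℕ) : GevreyBound α R (S.data n).Af (S.angleBump n) :=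
  ((S.data n).f_bound.train S.R_pos.le (S.Q_pos n) (S.data n).f_zero
    (S.angleWidth_lt n)).comp_add_const _

theorem sine_bound (n : ℕ) (b : ℝ) : GevreyBound α R (S.sineBound n)
    (fun θ => Real.sin (2 * Real.pi * S.Q n * θ + b)) :=
  GevreyBound.sin_mul_add (by linarith [S.one_lt_α]) S.R_pos
    (by have := Real.pi_pos; positivity) b

theorem kickPotential_bound (n : ℕ) : GevreyBound α R
    ((S.data n).κ / (2 * Real.pi * S.Q n ^ 2) * S.sineBound n) (S.kickPotential n) := by
  have := (S.sine_bound n (Real.pi / 2)).const_mul ((S.data n).κ / (2 * Real.pi * S.Q n ^ 2))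
  rwa [abs_of_nonneg (div_nonneg (S.data n).κ_pos.le (by have := Real.pi_pos; positivity))]
    at this

theorem driftPotential_bound (n : ℕ) : GevreyBound α R
    (1 / (2 * (S.data n).m * (2 * Real.pi * S.Q n)) * S.sineBound n) (S.driftPotential n) := by
  have := (S.sine_bound n 0).const_mul (-(1 / (2 * (S.data n).m * (2 * Real.pi * S.Q n))))
  rwa [abs_neg, abs_of_nonneg (by have := Real.pi_pos; positivity)] at this

/-- The one-variable factors, in `(θ₁, r₁)`, of the resonant terms of `u`. -/
def uFactor (n : ℕ) : Fin 2 → ℝ → ℝ := ![S.kickPotential n, S.actionBump ω₁ n]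

/-- The one-variable factors, in `(θ₁, r₁, θ₂, r₂)`, of the resonant terms of `u`. -/
def extendUFactor (n : ℕ) : Fin 4 → ℝ → ℝ :=
  ![S.kickPotential n, S.actionBump ω₁ n, fun _ => 1, fun _ => 1]

/-- The one-variable factors, in `(θ₁, r₁, θ₂, r₂)`, of the resonant terms of `v`. -/
def vFactor (n : ℕ) : Fin 4 → ℝ → ℝ :=
  ![S.angleBump n, S.actionBump ω₁ n, S.driftPotential n, fun _ => 1]

/-- Gevrey bounds for the functions `uFactor`. -/
def uBound (n : ℕ) : Fin 2 → ℝ :=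
  ![(S.data n).κ / (2 * Real.pi * S.Q n ^ 2) * S.sineBound n, (S.data n).Ab]

/-- Gevrey bounds for the functions `extendUFactor`. -/
def extendUBound (n : ℕ) : Fin 4 → ℝ :=
  ![(S.data n).κ / (2 * Real.pi * S.Q n ^ 2) * S.sineBound n, (S.data n).Ab, 1, 1]

/-- Gevrey bounds for the functions `vFactor`. -/
def vBound (n : ℕ) : Fin 4 → ℝ :=
  ![(S.data n).Af, (S.data n).Ab,
    1 / (2 * (S.data n).m * (2 * Real.pi * S.Q n)) * S.sineBound n, 1]

theorem one_bound (S : ResonanceSeq α R C ε) : GevreyBound α R 1 (fun _ => 1) := by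
  simpa using GevreyBound.const (α := α) S.R_pos.le 1

theorem uFactor_bound (n : ℕ) (i : Fin 2) :
    GevreyBound α R (S.uBound n i) (S.uFactor ω₁ n i) := by
  fin_cases i
  · exact S.kickPotential_bound n
  · exact S.actionBump_bound ω₁ n

theorem extendUFactor_bound (n : ℕ) (i : Fin 4) :
    GevreyBound α R (S.extendUBound n i) (S.extendUFactor ω₁ n i) := by
  fin_cases i
  · exact S.kickPotential_bound n
  · exact S.actionBump_bound ω₁ n
  · exact S.one_bound
  · exact S.one_bound

theorem vFactor_bound (n : ℕ) (i : Fin 4) :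
    GevreyBound α R (S.vBound n i) (S.vFactor ω₁ n i) := by
  fin_cases i
  · exact S.angleBump_bound n
  · exact S.actionBump_bound ω₁ n
  · exact S.driftPotential_bound n
  · exact S.one_bound

theorem hasSum_tolerance (ε : ℝ) : HasSum (fun n : ℕ => ε / (64 * 2 ^ n)) (ε / 32) := by
  have geometric : (fun n : ℕ => ε / (64 * 2 ^ n)) = fun n => ε / 64 * (1 / 2) ^ n := by
    funext n
    rw [div_pow, one_pow]
    field_simp
  rw [geometric, show ε / 32 = ε / 64 * 2 by ring]
  exact hasSum_geometric_two.mul_left (ε / 64)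

theorem prod_uBound_le (n : ℕ) : ∏ i, S.uBound n i ≤ ε / (64 * 2 ^ n) := by
  rw [Fin.prod_univ_two]
  exact (S.data n).u_small

theorem prod_extendUBound (n : ℕ) : ∏ i, S.extendUBound n i = ∏ i, S.uBound n i := by
  rw [Fin.prod_univ_two, Fin.prod_univ_four]
  simp [extendUBound, uBound]

theorem prod_vBound_le (n : ℕ) : ∏ i, S.vBound n i ≤ ε / (64 * 2 ^ n) := by
  rw [Fin.prod_univ_four]
  exact (mul_one _).trans_le (S.data n).v_small

theorem summable_uBound : Summable fun n => ∏ i, S.uBound n i :=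
  Summable.of_nonneg_of_le
    (fun n => Finset.prod_nonneg fun i _ => (S.uFactor_bound 0 n i).nonneg) S.prod_uBound_le
    (hasSum_tolerance ε).summable

theorem summable_extendUBound : Summable fun n => ∏ i, S.extendUBound n i := by
  simpa only [S.prod_extendUBound] using S.summable_uBound

theorem summable_vBound : Summable fun n => ∏ i, S.vBound n i :=
  Summable.of_nonneg_of_le
    (fun n => Finset.prod_nonneg fun i _ => (S.vFactor_bound 0 n i).nonneg) S.prod_vBound_le
    (hasSum_tolerance ε).summable

theorem tsum_uBound_le : ∑' n, ∏ i, S.uBound n i ≤ ε / 32 :=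
  S.summable_uBound.tsum_le_of_sum_le fun s =>
    (Finset.sum_le_sum fun n _ => S.prod_uBound_le n).trans
      (sum_le_hasSum s (fun n _ => by have := S.ε_pos; positivity) (hasSum_tolerance ε))

theorem tsum_vBound_le : ∑' n, ∏ i, S.vBound n i ≤ ε / 32 :=
  S.summable_vBound.tsum_le_of_sum_le fun s =>
    (Finset.sum_le_sum fun n _ => S.prod_vBound_le n).trans
      (sum_le_hasSum s (fun n _ => by have := S.ε_pos; positivity) (hasSum_tolerance ε))

/-- The perturbation `u` on `M₁`. -/
def u (z : Annulus) : ℝ :=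
  ∑' n, (S.kickPotential_periodic n).lift z.fst * S.actionBump ω₁ n z.snd

/-- The perturbation `v` on `M₁ × M₂`. -/
def v (z : Phase) : ℝ :=
  ∑' n, (S.angleBump_periodic n).lift z.fst.fst * S.actionBump ω₁ n z.fst.snd *
    (S.driftPotential_periodic n).lift z.snd.fst

theorem u_comp_cover : S.u ω₁ ∘ annulusCover = tensorSum (S.uFactor ω₁) 0 := by
  funext x
  simp only [Function.comp_apply, u, tensorSum, Pi.zero_apply, iteratedDeriv_zero,
    Fin.prod_univ_two]
  rfl

theorem extend_u_comp_cover :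
    extend (S.u ω₁) ∘ phaseCover = tensorSum (S.extendUFactor ω₁) 0 := by
  funext x
  simp only [Function.comp_apply, extend, u, tensorSum, Pi.zero_apply, iteratedDeriv_zero,
    Fin.prod_univ_four, extendUFactor, Matrix.cons_val, mul_one]
  rfl

theorem v_comp_cover : S.v ω₁ ∘ phaseCover = tensorSum (S.vFactor ω₁) 0 := by
  funext x
  simp only [Function.comp_apply, v, tensorSum, Pi.zero_apply, iteratedDeriv_zero,
    Fin.prod_univ_four, vFactor, Matrix.cons_val, mul_one]
  rfl

theorem iteratedDeriv_actionBump_eq_zero {n : ℕ} {r : ℝ}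
    (h : ∀ j : ℤ, S.Admissible n j → S.zoneWidth n < |r + ω₁ - j / S.Q n|) (k : ℕ) :
    iteratedDeriv k (S.actionBump ω₁ n) r = 0 :=
  iteratedDeriv_eq_zero_of_eventuallyEq
    ((continuous_add_const ω₁).continuousAt.eventually
      (train_eventuallyEq_zero (S.Q_pos n) (S.data n).b_zero (S.zoneWidth_lt n) h)) k

theorem iteratedDeriv_actionBump_of_mem_flatSet {r : ℝ} (hr : r ∈ S.flatSet ω₁) (n k : ℕ) :
    iteratedDeriv k (S.actionBump ω₁ n) r = 0 :=
  S.iteratedDeriv_actionBump_eq_zero ω₁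
    (fun j _ => by linarith [hr n j, S.zoneWidth_pos n]) k

theorem Admissible.add_zoneWidth_le {S : ResonanceSeq α R C ε} {m n : ℕ} {j p : ℤ}
    (hj : S.Admissible m j) (hp : S.Admissible n p) (hmn : m ≠ n) :
    S.zoneWidth m + S.zoneWidth n ≤ |(p : ℝ) / S.Q n - j / S.Q m| := by
  rcases lt_or_gt_of_ne hmn with h | h
  · exact hp m h j
  · rw [add_comm, abs_sub_comm]
    exact hj n h p

theorem iteratedDeriv_actionBump_of_ne {n m : ℕ} {p : ℤ} (hp : S.Admissible n p) {r : ℝ}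
    (hr : |r + ω₁ - p / S.Q n| < S.zoneWidth n) (hmn : m ≠ n) (k : ℕ) :
    iteratedDeriv k (S.actionBump ω₁ m) r = 0 := by
  refine S.iteratedDeriv_actionBump_eq_zero ω₁ (fun j hj => ?_) k
  have disjoint := hj.add_zoneWidth_le hp hmn
  have triangle := abs_sub_le ((p : ℝ) / S.Q n) (r + ω₁) (j / S.Q m)
  rw [abs_sub_comm ((p : ℝ) / S.Q n) (r + ω₁)] at triangle
  linarith

section

variable {n : ℕ} {p : ℤ} (hp : S.Admissible n p)

include hp

theorem actionBump_eventuallyEq_one {r : ℝ} (hr : |r + ω₁ - p / S.Q n| < S.zoneWidth n / 2) :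
    S.actionBump ω₁ n =ᶠ[𝓝 r] fun _ => 1 := by
  filter_upwards [(continuous_add_const ω₁).continuousAt.eventually (eventually_abs_sub_lt hr)]
    with x hx
  rw [actionBump, train_apply (S.Q_pos n) (by linarith [S.zoneWidth_lt n, S.zoneWidth_pos n]) hp,
    (S.data n).b_one _ hx.le]

theorem actionBump_eq_one {r : ℝ} (hr : |r + ω₁ - p / S.Q n| < S.zoneWidth n / 2) :
    S.actionBump ω₁ n r = 1 :=
  (S.actionBump_eventuallyEq_one ω₁ hp hr).eq_of_nhds

theorem iteratedDeriv_one_actionBump {r : ℝ} (hr : |r + ω₁ - p / S.Q n| < S.zoneWidth n / 2) :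
    iteratedDeriv 1 (S.actionBump ω₁ n) r = 0 := by
  rw [iteratedDeriv_one, (S.actionBump_eventuallyEq_one ω₁ hp hr).deriv_eq, deriv_const]

theorem tensorSum_eq_single {N : ℕ} {h : ℕ → Fin N → ℝ → ℝ} {i : Fin N}
    (hi : ∀ n, h n i = S.actionBump ω₁ n) {x : Fin N → ℝ}
    (hx : |x i + ω₁ - p / S.Q n| < S.zoneWidth n / 2) (k : Fin N → ℕ) :
    tensorSum h k x = ∏ i, iteratedDeriv (k i) (h n i) (x i) := by
  refine tsum_eq_single n fun m hm => Finset.prod_eq_zero (Finset.mem_univ i) ?_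
  rw [hi, S.iteratedDeriv_actionBump_of_ne ω₁ hp (by linarith [S.zoneWidth_pos n]) hm]

end

theorem admissible_round {r : ℝ} (hr : r ∈ S.flatSet ω₁) (n : ℕ) :
    S.Admissible n (round (S.Q n * (r + ω₁))) := by
  intro m hm j
  have inv_eq : 1 / (S.Q n : ℝ) = 1 / (2 * S.Q n) + 1 / (2 * S.Q n) := by
    have := (S.Q_cast_pos n).ne'
    field_simp
    norm_num
  have near := abs_round_div_sub_le (S.Q_cast_pos n) (r + ω₁)
  rw [abs_sub_comm] at near
  have triangle := abs_sub_le (r + ω₁) ((round (S.Q n * (r + ω₁)) : ℝ) / S.Q n) (j / S.Q m)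
  linarith [hr m j, S.inv_Q_le_zoneWidth hm, S.zoneWidth_lt n]

theorem tensorSum_eq_zero_of_mem_flatSet {N : ℕ} {h : ℕ → Fin N → ℝ → ℝ} {i : Fin N}
    (hi : ∀ n, h n i = S.actionBump ω₁ n) {x : Fin N → ℝ} (hx : x i ∈ S.flatSet ω₁)
    (k : Fin N → ℕ) : tensorSum h k x = 0 := by
  have prod_eq_zero : ∀ n, ∏ i, iteratedDeriv (k i) (h n i) (x i) = 0 := fun n =>
    Finset.prod_eq_zero (Finset.mem_univ i)
      (by rw [hi, S.iteratedDeriv_actionBump_of_mem_flatSet ω₁ hx])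
  simp only [tensorSum, prod_eq_zero, tsum_zero]

theorem iteratedDeriv_one_const_mul_sin (A a b θ : ℝ) :
    iteratedDeriv 1 (fun θ => A * Real.sin (a * θ + b)) θ =
      A * a * Real.sin (a * θ + (b + Real.pi / 2)) := by
  rw [iteratedDeriv_const_mul_field, iteratedDeriv_sin_mul_add]
  simp only [Nat.cast_one, one_mul, pow_one, mul_assoc]

theorem iteratedDeriv_one_kickPotential (n : ℕ) (θ : ℝ) : iteratedDeriv 1 (S.kickPotential n) θ =
    -((S.data n).κ / S.Q n * Real.sin (2 * Real.pi * (S.Q n * θ))) := by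
  have := (S.Q_cast_pos n).ne'
  have := Real.pi_pos.ne'
  refine (iteratedDeriv_one_const_mul_sin _ _ _ _).trans ?_
  rw [add_halves, Real.sin_add_pi, mul_assoc _ _ θ]
  field_simp

theorem iteratedDeriv_one_driftPotential (n : ℕ) (θ : ℝ) : iteratedDeriv 1 (S.driftPotential n) θ =
    -(1 / (2 * (S.data n).m) * Real.cos (2 * Real.pi * (S.Q n * θ))) := by
  have := (S.Q_cast_pos n).ne'
  have := Real.pi_pos.ne'
  refine (iteratedDeriv_one_const_mul_sin _ _ _ _).trans ?_
  rw [zero_add, Real.sin_add_pi_div_two, mul_assoc _ _ θ]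
  field_simp

theorem hamVectorField_u {n : ℕ} {p : ℤ} (hp : S.Admissible n p) {x : Fin 4 → ℝ}
    (hx : |x 1 + ω₁ - p / S.Q n| < S.zoneWidth n / 2) :
    hamVectorField (extend (S.u ω₁) ∘ phaseCover) x =
      ![0, (S.data n).κ / S.Q n * Real.sin (2 * Real.pi * (S.Q n * x 0)), 0, 0] := by
  rw [S.extend_u_comp_cover,
    hamVectorField_tensorSum (S.extendUFactor_bound ω₁) S.summable_extendUBound]
  simp only [S.tensorSum_eq_single ω₁ hp (h := S.extendUFactor ω₁) (i := 1) (fun _ => rfl) hx,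
    Fin.prod_univ_four]
  simp [extendUFactor, S.iteratedDeriv_one_actionBump ω₁ hp hx, S.actionBump_eq_one ω₁ hp hx,
    S.iteratedDeriv_one_kickPotential, iteratedDeriv_const, -iteratedDeriv_one]

theorem hamVectorField_v {n : ℕ} {p : ℤ} (hp : S.Admissible n p) {x : Fin 4 → ℝ}
    (hx : |x 1 + ω₁ - p / S.Q n| < S.zoneWidth n / 2) :
    hamVectorField (S.v ω₁ ∘ phaseCover) x =
      ![0, -(iteratedDeriv 1 (S.angleBump n) (x 0) * S.driftPotential n (x 2)), 0,
        S.angleBump n (x 0) *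
          (1 / (2 * (S.data n).m) * Real.cos (2 * Real.pi * (S.Q n * x 2)))] := by
  rw [S.v_comp_cover, hamVectorField_tensorSum (S.vFactor_bound ω₁) S.summable_vBound]
  simp only [S.tensorSum_eq_single ω₁ hp (h := S.vFactor ω₁) (i := 1) (fun _ => rfl) hx,
    Fin.prod_univ_four]
  simp [vFactor, S.iteratedDeriv_one_actionBump ω₁ hp hx, S.actionBump_eq_one ω₁ hp hx,
    S.iteratedDeriv_one_driftPotential, iteratedDeriv_const, -iteratedDeriv_one]

theorem hamVectorField_u_of_mem_flatSet {x : Fin 4 → ℝ} (hx : x 1 ∈ S.flatSet ω₁) :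
    hamVectorField (extend (S.u ω₁) ∘ phaseCover) x = 0 := by
  rw [S.extend_u_comp_cover,
    hamVectorField_tensorSum (S.extendUFactor_bound ω₁) S.summable_extendUBound]
  simp [S.tensorSum_eq_zero_of_mem_flatSet ω₁ (h := S.extendUFactor ω₁) (i := 1) (fun _ => rfl) hx]

theorem hamVectorField_v_of_mem_flatSet {x : Fin 4 → ℝ} (hx : x 1 ∈ S.flatSet ω₁) :
    hamVectorField (S.v ω₁ ∘ phaseCover) x = 0 := by
  rw [S.v_comp_cover, hamVectorField_tensorSum (S.vFactor_bound ω₁) S.summable_vBound]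
  simp [S.tensorSum_eq_zero_of_mem_flatSet ω₁ (h := S.vFactor ω₁) (i := 1) (fun _ => rfl) hx]

end ResonanceSeq

/-! ### The drifting orbits -/

theorem T₀_phaseCover (ω₁ ω₂ a r b s : ℝ) :
    T₀ ω₁ ω₂ (phaseCover ![a, r, b, s]) = phaseCover ![a + (ω₁ + r), r, b + (ω₂ + s), s] := by
  simp [T₀, twist, phaseCover, phasePt, annulusPt]

theorem phaseCover_add_int (a r b s : ℝ) (k : ℤ) :
    phaseCover ![a, r, b + k, s] = phaseCover ![a, r, b, s] := by
  rw [phaseCover_eq_iff]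
  simp

theorem sin_two_pi_add_int (y : ℝ) (j : ℤ) :
    Real.sin (2 * Real.pi * (y + j)) = Real.sin (2 * Real.pi * y) := by
  rw [show 2 * Real.pi * (y + j) = 2 * Real.pi * y + j * (2 * Real.pi) by ring,
    Real.sin_add_int_mul_two_pi]

theorem IsTimeOneMap.apply_of_const {H : Phase → ℝ} {Φ : Phase → Phase} {K : NNReal}
    (hΦ : IsTimeOneMap H Φ) (hv : LipschitzWith K (hamVectorField (H ∘ phaseCover)))
    {x a : Fin 4 → ℝ}
    (h : ∀ t ∈ Set.Icc (0 : ℝ) 1, hamVectorField (H ∘ phaseCover) (x + t • a) = a) :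
    Φ (phaseCover x) = phaseCover (x + a) := by
  have := hΦ.apply_of_hasDerivAt hv (c := fun t => x + t • a) fun t ht => by
    simpa [h t ht] using ((hasDerivAt_id t).smul_const a).const_add x
  simpa using this

namespace ResonanceSeq

variable {α R C ε : ℝ} (S : ResonanceSeq α R C ε) {ω₁ ω₂ : ℝ} {Φu Φv : Phase → Phase}

theorem exists_lipschitzWith_u (ω₁ : ℝ) :
    ∃ K, LipschitzWith K (hamVectorField (extend (S.u ω₁) ∘ phaseCover)) := by
  rw [S.extend_u_comp_cover]
  exact exists_lipschitzWith_hamVectorField (S.extendUFactor_bound ω₁) S.summable_extendUBound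

theorem exists_lipschitzWith_v (ω₁ : ℝ) :
    ∃ K, LipschitzWith K (hamVectorField (S.v ω₁ ∘ phaseCover)) := by
  rw [S.v_comp_cover]
  exact exists_lipschitzWith_hamVectorField (S.vFactor_bound ω₁) S.summable_vBound

theorem exists_isTimeOneMap_u (ω₁ : ℝ) : ∃ Φ, IsTimeOneMap (extend (S.u ω₁)) Φ := by
  obtain ⟨K, hK⟩ := S.exists_lipschitzWith_u ω₁
  obtain ⟨M, hM⟩ :=
    exists_norm_hamVectorField_le (S.extendUFactor_bound ω₁) S.summable_extendUBound
  rw [← S.extend_u_comp_cover] at hM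
  exact exists_isTimeOneMap hK hM

theorem exists_isTimeOneMap_v (ω₁ : ℝ) : ∃ Φ, IsTimeOneMap (S.v ω₁) Φ := by
  obtain ⟨K, hK⟩ := S.exists_lipschitzWith_v ω₁
  obtain ⟨M, hM⟩ := exists_norm_hamVectorField_le (S.vFactor_bound ω₁) S.summable_vBound
  rw [← S.v_comp_cover] at hM
  exact exists_isTimeOneMap hK hM

theorem flow_u_of_mem_flatSet (hu : IsTimeOneMap (extend (S.u ω₁)) Φu) {x : Fin 4 → ℝ}
    (hx : x 1 ∈ S.flatSet ω₁) : Φu (phaseCover x) = phaseCover x := by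
  obtain ⟨K, hK⟩ := S.exists_lipschitzWith_u ω₁
  simpa using hu.apply_of_const hK (x := x) (a := 0) fun t _ => by
    simpa using S.hamVectorField_u_of_mem_flatSet ω₁ hx

theorem flow_v_of_mem_flatSet (hv : IsTimeOneMap (S.v ω₁) Φv) {x : Fin 4 → ℝ}
    (hx : x 1 ∈ S.flatSet ω₁) : Φv (phaseCover x) = phaseCover x := by
  obtain ⟨K, hK⟩ := S.exists_lipschitzWith_v ω₁
  simpa using hv.apply_of_const hK (x := x) (a := 0) fun t _ => by
    simpa using S.hamVectorField_v_of_mem_flatSet ω₁ hx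

theorem image_torus (hu : IsTimeOneMap (extend (S.u ω₁)) Φu) (hv : IsTimeOneMap (S.v ω₁) Φv)
    {r₁ : ℝ} (hr : r₁ ∈ S.flatSet ω₁) (r₂ : ℝ) :
    (Φv ∘ Φu ∘ T₀ ω₁ ω₂) '' torus r₁ r₂ = torus r₁ r₂ := by
  have translation : ∀ a b, (Φv ∘ Φu ∘ T₀ ω₁ ω₂) (phaseCover ![a, r₁, b, r₂]) =
      phaseCover ![a + (ω₁ + r₁), r₁, b + (ω₂ + r₂), r₂] := by
    intro a b
    rw [Function.comp_apply, Function.comp_apply, T₀_phaseCover,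
      S.flow_u_of_mem_flatSet hu (by simpa using hr),
      S.flow_v_of_mem_flatSet hv (by simpa using hr)]
  have exists_lift : ∀ z ∈ torus r₁ r₂, ∃ a b, z = phaseCover ![a, r₁, b, r₂] := by
    rintro z ⟨h1, h2⟩
    obtain ⟨x, rfl⟩ := phaseCover_surjective z
    exact ⟨x 0, x 2, phaseCover_eq_iff.2 ⟨⟨rfl, h1⟩, rfl, h2⟩⟩
  ext z
  constructor
  · rintro ⟨z, hz, rfl⟩
    obtain ⟨a, b, rfl⟩ := exists_lift z hz
    rw [translation]
    exact ⟨rfl, rfl⟩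
  · intro hz
    obtain ⟨a, b, rfl⟩ := exists_lift z hz
    refine ⟨phaseCover ![a - (ω₁ + r₁), r₁, b - (ω₂ + r₂), r₂], ⟨rfl, rfl⟩, ?_⟩
    rw [translation, sub_add_cancel, sub_add_cancel]

theorem flow_u_resonant (hu : IsTimeOneMap (extend (S.u ω₁)) Φu) {n : ℕ} {p : ℤ}
    (hp : S.Admissible n p) {a r r' : ℝ} (b s : ℝ)
    (hr' : r' = r + (S.data n).κ / S.Q n * Real.sin (2 * Real.pi * (S.Q n * a)))
    (h : |r + ω₁ - p / S.Q n| < S.zoneWidth n / 2)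
    (h' : |r' + ω₁ - p / S.Q n| < S.zoneWidth n / 2) :
    Φu (phaseCover ![a, r, b, s]) = phaseCover ![a, r', b, s] := by
  obtain ⟨K, hK⟩ := S.exists_lipschitzWith_u ω₁
  have stays_in_zone : ∀ t ∈ Set.Icc (0 : ℝ) 1,
      |r + t * (r' - r) + ω₁ - p / S.Q n| < S.zoneWidth n / 2 := by
    rintro t ⟨t0, t1⟩
    have convex := (convex_ball ((p : ℝ) / S.Q n - ω₁) (S.zoneWidth n / 2)).add_smul_sub_mem
      (x := r) (y := r') (t := t)
    simp only [Metric.mem_ball, Real.dist_eq, sub_sub_eq_add_sub, smul_eq_mul] at convex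
    exact convex h h' ⟨t0, t1⟩
  have flow_eq := hu.apply_of_const hK (x := ![a, r, b, s]) (a := ![0, r' - r, 0, 0])
    fun t ht => by
      rw [S.hamVectorField_u ω₁ hp (by simpa using stays_in_zone t ht), hr']
      simp
  rw [flow_eq]
  congr 1
  ext i
  fin_cases i <;> simp

theorem flow_v_resonant (hv : IsTimeOneMap (S.v ω₁) Φv) {n : ℕ} {p : ℤ}
    (hp : S.Admissible n p) {a r : ℝ} (b s : ℝ) (h : |r + ω₁ - p / S.Q n| < S.zoneWidth n / 2)
    {e : ℝ} (he : S.angleBump n =ᶠ[𝓝 a] fun _ => e) :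
    Φv (phaseCover ![a, r, b, s]) = phaseCover ![a, r, b,
      s + e * (1 / (2 * (S.data n).m) * Real.cos (2 * Real.pi * (S.Q n * b)))] := by
  obtain ⟨K, hK⟩ := S.exists_lipschitzWith_v ω₁
  have deriv_zero : iteratedDeriv 1 (S.angleBump n) a = 0 := by
    rw [iteratedDeriv_one, he.deriv_eq, deriv_const]
  set kick := e * (1 / (2 * (S.data n).m) * Real.cos (2 * Real.pi * (S.Q n * b))) with kick_def
  have flow_eq := hv.apply_of_const hK (x := ![a, r, b, s]) (a := ![0, 0, 0, kick])
    fun t _ => by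
      rw [S.hamVectorField_v ω₁ hp (by simpa using h)]
      simp only [Pi.add_apply, Pi.smul_apply, Matrix.cons_val, smul_eq_mul, mul_zero, add_zero,
        he.eq_of_nhds, deriv_zero, zero_mul, neg_zero, ← kick_def]
  rw [flow_eq]
  congr 1
  ext i
  fin_cases i <;> simp

theorem angleBump_eventuallyEq_one (n : ℕ) (j : ℤ) :
    S.angleBump n =ᶠ[𝓝 ((1 / 2 + (j : ℝ)) / S.Q n)] fun _ => 1 := by
  have := S.Q_cast_pos n
  have := Real.sqrt_pos.2 (S.data n).κ_pos
  have center : (1 / 2 + (j : ℝ)) / S.Q n + -(1 / (2 * S.Q n)) = j / S.Q n := by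
    field_simp
    ring
  have width_pos : 0 < √(S.data n).κ / (8 * S.Q n) := by positivity
  have near : ∀ᶠ x : ℝ in 𝓝 ((1 / 2 + (j : ℝ)) / S.Q n + -(1 / (2 * S.Q n))),
      |x - j / S.Q n| < √(S.data n).κ / (8 * S.Q n) / 2 :=
    eventually_abs_sub_lt (by rw [center, sub_self, abs_zero]; positivity)
  filter_upwards [(continuous_add_const _).continuousAt.eventually near] with x hx
  rw [angleBump, train_apply (S.Q_pos n)
    (hx.trans ((half_lt_self width_pos).trans (S.angleWidth_lt n))) trivial,
    (S.data n).f_one _ hx.le]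

theorem angleBump_eventuallyEq_zero (n : ℕ) {y : ℝ} (j : ℤ)
    (hy : y ∈ Set.Icc (1 / 2 + √(S.data n).κ / 4) (3 / 2 - √(S.data n).κ / 4)) :
    S.angleBump n =ᶠ[𝓝 ((y + j) / S.Q n)] fun _ => 0 := by
  have hQ := S.Q_cast_pos n
  have hκ := Real.sqrt_pos.2 (S.data n).κ_pos
  have far_from_int : ∀ i : ℤ, √(S.data n).κ / 8 < |y - 1 / 2 - i| := by
    intro i
    rw [lt_abs]
    rcases le_or_gt i 0 with h | h
    · have : (i : ℝ) ≤ 0 := by exact_mod_cast h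
      exact Or.inl (by linarith [hy.1])
    · have : (1 : ℝ) ≤ i := by exact_mod_cast h
      exact Or.inr (by linarith [hy.2])
  refine (continuous_add_const _).continuousAt.eventually
    (train_eventuallyEq_zero (S.Q_pos n) (S.data n).f_zero (S.angleWidth_lt n) fun i _ => ?_)
  have rescale : (y + j) / (S.Q n : ℝ) + -(1 / (2 * S.Q n)) - i / S.Q n =
      (y - 1 / 2 - ((i - j : ℤ) : ℝ)) / S.Q n := by
    push_cast
    field_simp
    ring
  rw [rescale, abs_div, abs_of_pos hQ, ← div_div]
  exact div_lt_div_of_pos_right (far_from_int _) hQ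

/-- A point in the zone of the resonance `p / Q n`, in the variables of a drifting orbit:
`Q θ₁ = y` is the phase of the standard map and `V` its velocity, `θ₂ = b`, and `l` counts the
kicks of size `1 / (2 m)` received by `r₂ + ω₂`. -/
def driftPoint (n : ℕ) (ω₁ ω₂ : ℝ) (p : ℤ) (y V b l : ℝ) : Phase :=
  phaseCover ![y / S.Q n, p / S.Q n + V / S.Q n - ω₁, b, l / (2 * (S.data n).m) - ω₂]

/-- The velocities that keep a drifting orbit inside its resonant zone. -/
def slowVelocities (n : ℕ) : Set ℝ := Set.Ico 0 (1 / (2 * Real.log (S.Q n)))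

theorem velocity_mem_slowVelocities {n : ℕ} {y V : ℕ → ℝ}
    (hyV : IsTransitOrbit (S.data n).κ (S.data n).m y V) {k : ℕ} (hk : k ≤ 2 * (S.data n).m) :
    V k ∈ S.slowVelocities n :=
  ⟨hyV.velocity_nonneg k hk, lt_of_pow_lt_pow_left₀ 2 (by have := S.log_Q_pos n; positivity)
    ((hyV.velocity_sq_le k hk).trans_lt (S.data n).speed)⟩

theorem lt_one_of_mem_slowVelocities {n : ℕ} {V : ℝ} (hV : V ∈ S.slowVelocities n) : V < 1 := by
  refine hV.2.trans_le ?_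
  have := (S.data n).two_lt_log
  rw [div_le_one (by linarith)]
  linarith

theorem abs_lt_zoneWidth_of_mem_slowVelocities {n : ℕ} {V : ℝ} (hV : V ∈ S.slowVelocities n)
    (ω₁ : ℝ) (p : ℤ) : |p / S.Q n + V / S.Q n - ω₁ + ω₁ - p / S.Q n| < S.zoneWidth n / 2 := by
  rw [show (p : ℝ) / S.Q n + V / S.Q n - ω₁ + ω₁ - p / S.Q n = V / S.Q n by ring,
    abs_of_nonneg (div_nonneg hV.1 (S.Q_cast_pos n).le)]
  calc V / S.Q n < 1 / (2 * Real.log (S.Q n)) / S.Q n :=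
        div_lt_div_of_pos_right hV.2 (S.Q_cast_pos n)
    _ = S.zoneWidth n / 2 := by rw [zoneWidth]; field_simp

theorem driftPoint_add_int (n : ℕ) (p : ℤ) (y V b l : ℝ) (k : ℤ) :
    S.driftPoint n ω₁ ω₂ p y V (b + k) l = S.driftPoint n ω₁ ω₂ p y V b l :=
  phaseCover_add_int _ _ _ _ k

section

variable {n : ℕ} {p : ℤ} (hp : S.Admissible n p)

include hp

theorem flow_u_driftPoint (hu : IsTimeOneMap (extend (S.u ω₁)) Φu) {y y' V V' : ℝ} (b l : ℝ)
    (j : ℤ) (hy : y' = y + V) (hV' : V' = V + (S.data n).κ * Real.sin (2 * Real.pi * y'))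
    (slow : V ∈ S.slowVelocities n) (slow' : V' ∈ S.slowVelocities n) :
    Φu (T₀ ω₁ ω₂ (S.driftPoint n ω₁ ω₂ p (y + j) V b l)) =
      S.driftPoint n ω₁ ω₂ p (y' + ((j + p : ℤ) : ℝ)) V' (b + l / (2 * (S.data n).m)) l := by
  have hQ := (S.Q_cast_pos n).ne'
  have angle₁ : (y + j) / (S.Q n : ℝ) + (ω₁ + (p / S.Q n + V / S.Q n - ω₁)) =
      (y' + ((j + p : ℤ) : ℝ)) / S.Q n := by
    rw [hy]
    push_cast
    field_simp
    ring
  have angle₂ : b + (ω₂ + (l / (2 * (S.data n).m) - ω₂)) = b + l / (2 * (S.data n).m) := by ring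
  rw [driftPoint, T₀_phaseCover, angle₁, angle₂]
  refine S.flow_u_resonant hu hp _ _ ?_ (S.abs_lt_zoneWidth_of_mem_slowVelocities slow ω₁ p)
    (S.abs_lt_zoneWidth_of_mem_slowVelocities slow' ω₁ p)
  rw [mul_div_cancel₀ _ hQ, sin_two_pi_add_int, hV']
  ring

theorem flow_v_driftPoint (hv : IsTimeOneMap (S.v ω₁) Φv) {y V e : ℝ} (b l : ℝ)
    (slow : V ∈ S.slowVelocities n) (he : S.angleBump n =ᶠ[𝓝 (y / S.Q n)] fun _ => e) :
    Φv (S.driftPoint n ω₁ ω₂ p y V b l) =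
      S.driftPoint n ω₁ ω₂ p y V b (l + e * Real.cos (2 * Real.pi * (S.Q n * b))) := by
  rw [driftPoint, S.flow_v_resonant hv hp _ _
    (S.abs_lt_zoneWidth_of_mem_slowVelocities slow ω₁ p) he, driftPoint]
  congr 4
  ring_nf

variable {y V : ℕ → ℝ} (hyV : IsTransitOrbit (S.data n).κ (S.data n).m y V)
  (hu : IsTimeOneMap (extend (S.u ω₁)) Φu) (hv : IsTimeOneMap (S.v ω₁) Φv)

include hyV hu hv

theorem iterate_driftPoint_of_lt (j : ℤ) (b l : ℝ) {k : ℕ} (hk : k < 2 * (S.data n).m) :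
    (Φv ∘ Φu ∘ T₀ ω₁ ω₂)^[k] (S.driftPoint n ω₁ ω₂ p (y 0 + j) (V 0) b l) =
      S.driftPoint n ω₁ ω₂ p (y k + ((j + k * p : ℤ) : ℝ)) (V k)
        (b + k * (l / (2 * (S.data n).m))) l := by
  induction k with
  | zero => simp
  | succ k ih =>
    have hk' : k < 2 * (S.data n).m := by omega
    have slow : V (k + 1) ∈ S.slowVelocities n := S.velocity_mem_slowVelocities hyV hk.le
    rw [Function.iterate_succ_apply', ih hk', Function.comp_apply, Function.comp_apply,
      S.flow_u_driftPoint hp hu _ _ _ (hyV.position_succ k) (hyV.velocity_succ k hk')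
        (S.velocity_mem_slowVelocities hyV hk'.le) slow,
      S.flow_v_driftPoint hp hv _ _ slow
        (S.angleBump_eventuallyEq_zero n _ (hyV.position_mem _ k.succ_pos hk))]
    congr 1 <;> push_cast <;> ring

theorem iterate_two_mul_driftPoint (j i l : ℤ) :
    (Φv ∘ Φu ∘ T₀ ω₁ ω₂)^[2 * (S.data n).m]
        (S.driftPoint n ω₁ ω₂ p (1 / 2 + j) (V 0) (i / S.Q n) l) =
      S.driftPoint n ω₁ ω₂ p (1 / 2 + ((j + (2 * (S.data n).m * p + 1) : ℤ) : ℝ)) (V 0)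
        (i / S.Q n) (l + 1) := by
  have hm := S.one_le_m n
  obtain ⟨k, hk⟩ : ∃ k, 2 * (S.data n).m = k + 1 := ⟨2 * (S.data n).m - 1, by omega⟩
  have hk' : k < 2 * (S.data n).m := by omega
  have cast_succ : (k : ℝ) + 1 = 2 * (S.data n).m := by exact_mod_cast hk.symm
  have slow : V (k + 1) ∈ S.slowVelocities n := S.velocity_mem_slowVelocities hyV hk.ge
  have position : y (k + 1) + ((j + k * p + p : ℤ) : ℝ) =
      1 / 2 + ((j + (2 * (S.data n).m * p + 1) : ℤ) : ℝ) := by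
    rw [← hk, hyV.position_end]
    push_cast
    rw [← cast_succ]
    ring
  have angle₂ : (i : ℝ) / S.Q n + k * (l / (2 * (S.data n).m)) + l / (2 * (S.data n).m) =
      i / S.Q n + l := by
    rw [← cast_succ]
    field_simp
    ring
  have cos_eq_one : Real.cos (2 * Real.pi * (S.Q n * (i / S.Q n))) = 1 := by
    rw [mul_div_cancel₀ _ (S.Q_cast_pos n).ne', mul_comm, Real.cos_int_mul_two_pi]
  conv_lhs => rw [hk, ← hyV.position_zero]
  rw [Function.iterate_succ_apply', S.iterate_driftPoint_of_lt hp hyV hu hv j _ _ hk',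
    Function.comp_apply, Function.comp_apply,
    S.flow_u_driftPoint hp hu _ _ _ (hyV.position_succ k) (hyV.velocity_succ k hk')
      (S.velocity_mem_slowVelocities hyV hk'.le) slow,
    position, angle₂, driftPoint_add_int,
    S.flow_v_driftPoint hp hv _ _ slow (S.angleBump_eventuallyEq_one n _),
    cos_eq_one, mul_one, ← hk, hyV.velocity_end]

theorem iterate_mul_driftPoint (j i l : ℤ) (M : ℕ) :
    (Φv ∘ Φu ∘ T₀ ω₁ ω₂)^[2 * (S.data n).m * M]
        (S.driftPoint n ω₁ ω₂ p (1 / 2 + j) (V 0) (i / S.Q n) l) =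
      S.driftPoint n ω₁ ω₂ p (1 / 2 + ((j + M * (2 * (S.data n).m * p + 1) : ℤ) : ℝ)) (V 0)
        (i / S.Q n) (l + M) := by
  induction M with
  | zero => simp
  | succ M ih =>
    have one_period := S.iterate_two_mul_driftPoint (ω₂ := ω₂) hp hyV hu hv
      (j + M * (2 * (S.data n).m * p + 1)) i (l + M)
    push_cast at ih one_period ⊢
    rw [mul_add, mul_one, add_comm, Function.iterate_add_apply, ih, one_period]
    congr 1 <;> ring

end

end ResonanceSeq

/-! ### Diffusion -/

theorem dist_coe_le (a b : ℝ) : dist (a : UnitAddCircle) (b : UnitAddCircle) ≤ |a - b| := by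
  rw [dist_eq_norm, ← AddCircle.coe_sub, UnitAddCircle.norm_eq]
  simpa using round_le (a - b) 0

theorem dist_withLp_prod_le {A B : Type*} [SeminormedAddCommGroup A] [SeminormedAddCommGroup B]
    (x y : WithLp 2 (A × B)) : dist x y ≤ dist x.fst y.fst + dist x.snd y.snd := by
  rw [WithLp.prod_dist_eq_of_L2]
  refine Real.sqrt_le_iff.2 ⟨by positivity, ?_⟩
  nlinarith [dist_nonneg (x := x.fst) (y := y.fst), dist_nonneg (x := x.snd) (y := y.snd)]

theorem dist_annulusPt_le (a r a' r' : ℝ) :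
    dist (annulusPt (a : UnitAddCircle) r) (annulusPt (a' : UnitAddCircle) r') ≤
      |a - a'| + |r - r'| :=
  (dist_withLp_prod_le _ _).trans (add_le_add (dist_coe_le a a') (Real.dist_eq r r').le)

theorem dist_phaseCover_le (x y : Fin 4 → ℝ) : dist (phaseCover x) (phaseCover y) ≤
    |x 0 - y 0| + |x 1 - y 1| + (|x 2 - y 2| + |x 3 - y 3|) :=
  (dist_withLp_prod_le _ _).trans
    (add_le_add (dist_annulusPt_le _ _ _ _) (dist_annulusPt_le _ _ _ _))

theorem sub_le_dist_phaseCover (x y : Fin 4 → ℝ) :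
    x 3 - y 3 ≤ dist (phaseCover x) (phaseCover y) :=
  calc x 3 - y 3 ≤ dist (x 3) (y 3) := le_abs_self _
    _ ≤ dist (phaseCover x).snd (phaseCover y).snd :=
      WithLp.dist_snd_le (phaseCover x).snd (phaseCover y).snd
    _ ≤ dist (phaseCover x) (phaseCover y) := WithLp.dist_snd_le _ _

theorem IsDiffusiveStar.mono {M : Type*} [MetricSpace M] {C γ : ℝ} {T : M → M} {X Y : Set M}
    (h : IsDiffusiveStar C γ T Y) (hXY : X ⊆ Y) : IsDiffusiveStar C γ T X := by
  obtain ⟨ν, hν, hν0, hdiff⟩ := h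
  exact ⟨ν, hν, hν0, fun n z hz => hdiff n z (hXY hz)⟩

namespace ResonanceSeq

variable {α R C ε : ℝ} (S : ResonanceSeq α R C ε) {ω₁ ω₂ : ℝ} {Φu Φv : Phase → Phase}

theorem exists_driftPoint_near (ω₁ ω₂ : ℝ) (n : ℕ) (x : Fin 4 → ℝ) {V : ℝ}
    (hV : V ∈ Set.Ico 0 1) : ∃ j i l : ℤ,
      dist (S.driftPoint n ω₁ ω₂ (round (S.Q n * (x 1 + ω₁))) (1 / 2 + j) V (i / S.Q n) l)
          (phaseCover x) ≤ 4 / S.Q n ∧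
        |l / (2 * (S.data n).m) - ω₂ - x 3| ≤ 1 / (2 * S.Q n) := by
  have hQ := S.Q_cast_pos n
  have Q_le_m : (S.Q n : ℝ) ≤ (S.data n).m := by exact_mod_cast (S.data n).Q_le_m
  have m_pos : (0 : ℝ) < (S.data n).m := hQ.trans_le Q_le_m
  have angle₁ : |(1 / 2 + round (S.Q n * (x 0 - 1 / (2 * S.Q n)))) / S.Q n - x 0| ≤
      1 / (2 * S.Q n) := by
    convert abs_round_div_sub_le hQ (x 0 - 1 / (2 * S.Q n)) using 2
    field_simp
    ring
  have action₁ : |round (S.Q n * (x 1 + ω₁)) / S.Q n + V / S.Q n - ω₁ - x 1| ≤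
      1 / (2 * S.Q n) + 1 / S.Q n := by
    rw [show round (S.Q n * (x 1 + ω₁)) / S.Q n + V / S.Q n - ω₁ - x 1 =
      round (S.Q n * (x 1 + ω₁)) / S.Q n - (x 1 + ω₁) + V / S.Q n by ring]
    refine (abs_add_le _ _).trans (add_le_add (abs_round_div_sub_le hQ _) ?_)
    rw [abs_of_nonneg (div_nonneg hV.1 hQ.le)]
    exact div_le_div_of_nonneg_right hV.2.le hQ.le
  have angle₂ := abs_round_div_sub_le hQ (x 2)
  have action₂ : |round (2 * (S.data n).m * (x 3 + ω₂)) / (2 * (S.data n).m) - ω₂ - x 3| ≤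
      1 / (2 * S.Q n) := by
    rw [sub_sub, add_comm ω₂]
    exact (abs_round_div_sub_le (by positivity) _).trans
      (one_div_le_one_div_of_le (by positivity) (by linarith))
  refine ⟨round (S.Q n * (x 0 - 1 / (2 * S.Q n))), round (S.Q n * x 2),
    round (2 * (S.data n).m * (x 3 + ω₂)), (dist_phaseCover_le _ _).trans ?_, action₂⟩
  simp only [Matrix.cons_val]
  calc _ ≤ 1 / (2 * S.Q n) + (1 / (2 * S.Q n) + 1 / S.Q n) +
        (1 / (2 * S.Q n) + 1 / (2 * (S.Q n : ℝ))) :=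
      add_le_add (add_le_add angle₁ action₁) (add_le_add angle₂ action₂)
    _ ≤ 4 / S.Q n := by
      field_simp
      norm_num

theorem two_mul_mul_ceil_le_Estar (n : ℕ) :
    ((2 * (S.data n).m *
      ⌈2 * (S.data n).m * (Estar C (1 / (α - 1)) (2 * (4 / S.Q n)) + 1)⌉₊ : ℕ) : ℝ) ≤
      Estar C (1 / (α - 1)) (4 / S.Q n) := by
  have m_ge_one : (1 : ℝ) ≤ (S.data n).m := by exact_mod_cast S.one_le_m n
  have distance_pos := Estar_pos C (1 / (α - 1)) (2 * (4 / S.Q n))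
  refine le_trans ?_ (S.data n).time
  set D := Estar C (1 / (α - 1)) (2 * (4 / S.Q n))
  have ceil_le : (⌈2 * (S.data n).m * (D + 1)⌉₊ : ℝ) ≤ 2 * (S.data n).m * (D + 2) := by
    have := (Nat.ceil_lt_add_one (show 0 ≤ 2 * (S.data n).m * (D + 1) by positivity)).le
    linarith
  push_cast
  calc 2 * (S.data n).m * (⌈2 * (S.data n).m * (D + 1)⌉₊ : ℝ)
      ≤ 2 * (S.data n).m * (2 * (S.data n).m * (D + 2)) := by gcongr
    _ = (2 * (S.data n).m) ^ 2 * (D + 2) := by ring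

theorem isNuDiffusiveStarAt (hu : IsTimeOneMap (extend (S.u ω₁)) Φu)
    (hv : IsTimeOneMap (S.v ω₁) Φv) (n : ℕ) {z : Phase} (hz : z.fst.snd ∈ S.flatSet ω₁) :
    IsNuDiffusiveStarAt C (1 / (α - 1)) (Φv ∘ Φu ∘ T₀ ω₁ ω₂) (4 / S.Q n) z := by
  obtain ⟨x, rfl⟩ := phaseCover_surjective z
  change x 1 ∈ S.flatSet ω₁ at hz
  have m_pos : 0 < (S.data n).m := S.one_le_m n
  have distance_pos := Estar_pos C (1 / (α - 1)) (2 * (4 / S.Q n))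
  obtain ⟨y, V, hyV⟩ :=
    exists_isTransitOrbit (S.data n).κ_pos.le (S.data n).κ_le (S.one_le_m n)
  have slow : V 0 ∈ S.slowVelocities n := S.velocity_mem_slowVelocities hyV (Nat.zero_le _)
  obtain ⟨j, i, l, near, action₂⟩ := S.exists_driftPoint_near ω₁ ω₂ n x
    ⟨slow.1, S.lt_one_of_mem_slowVelocities slow⟩
  refine ⟨_, _, ?_, near, S.two_mul_mul_ceil_le_Estar n, ?_⟩
  · have := Nat.ceil_pos.2 (show 0 < 2 * (S.data n).m *
      (Estar C (1 / (α - 1)) (2 * (4 / S.Q n)) + 1) by positivity)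
    positivity
  rw [S.iterate_mul_driftPoint (S.admissible_round ω₁ hz n) hyV hu hv]
  refine le_trans ?_ (sub_le_dist_phaseCover _ _)
  simp only [Matrix.cons_val]
  set D := Estar C (1 / (α - 1)) (2 * (4 / S.Q n))
  have drift : D + 1 ≤ ⌈2 * (S.data n).m * (D + 1)⌉₊ / (2 * (S.data n).m) := by
    rw [le_div_iff₀ (by positivity), mul_comm]
    exact Nat.le_ceil _
  have initial_error : 1 / (2 * (S.Q n : ℝ)) ≤ 1 := by
    have : (1 : ℝ) ≤ S.Q n := by exact_mod_cast S.Q_pos n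
    exact (div_le_one (by positivity)).2 (by linarith)
  have := neg_le_of_abs_le action₂
  rw [add_div]
  linarith

theorem tendsto_four_div_Q :
    Filter.Tendsto (fun n => 4 / (S.Q n : ℝ)) Filter.atTop (𝓝 0) :=
  Filter.Tendsto.const_div_atTop (Filter.tendsto_atTop_mono
    (fun n => by exact_mod_cast S.le_Q n) tendsto_natCast_atTop_atTop) 4

theorem isDiffusiveStar (hu : IsTimeOneMap (extend (S.u ω₁)) Φu)
    (hv : IsTimeOneMap (S.v ω₁) Φv) :
    IsDiffusiveStar C (1 / (α - 1)) (Φv ∘ Φu ∘ T₀ ω₁ ω₂)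
      {z : Phase | z.fst.snd ∈ S.flatSet ω₁} := by
  refine ⟨fun n => 4 / S.Q n, fun n => ⟨by have := S.Q_cast_pos n; positivity, ?_⟩,
    S.tendsto_four_div_Q, fun n z hz => S.isNuDiffusiveStarAt hu hv n hz⟩
  have : (16 : ℝ) ≤ S.Q n := by exact_mod_cast (S.data n).le_Q
  rw [div_lt_div_iff₀ (by linarith) (by norm_num)]
  linarith

/-! ### The set of flat actions -/

theorem isClosed_flatSet (ω₁ : ℝ) : IsClosed (S.flatSet ω₁) := by
  simp only [flatSet, Set.ofPred_forall]
  exact isClosed_iInter fun m => isClosed_iInter fun j =>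
    isClosed_le continuous_const (by fun_prop)

theorem add_int_mem_flatSet {r : ℝ} (hr : r ∈ S.flatSet ω₁) (k : ℤ) : r + k ∈ S.flatSet ω₁ := by
  intro m j
  have translate : r + k + ω₁ - j / S.Q m = r + ω₁ - ((j - k * S.Q m : ℤ) : ℝ) / S.Q m := by
    have := (S.Q_cast_pos m).ne'
    push_cast
    field_simp
    ring
  rw [translate]
  exact hr m _

theorem addInt_subset_flatSet (ω₁ : ℝ) :
    addInt (Set.Icc 0 1 ∩ S.flatSet ω₁) ⊆ S.flatSet ω₁ := by
  rintro _ ⟨x, hx, k, rfl⟩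
  exact S.add_int_mem_flatSet hx.2 k

/-- The resonances of order `Q n` whose zones may meet the unit interval of actions. -/
def unitResonances (n : ℕ) (ω₁ : ℝ) : Finset ℤ :=
  Finset.Icc ⌊S.Q n * ω₁⌋ (⌊S.Q n * ω₁⌋ + S.Q n + 1)

theorem card_unitResonances (n : ℕ) (ω₁ : ℝ) : (S.unitResonances n ω₁).card = S.Q n + 2 := by
  rw [unitResonances, Int.card_Icc]
  omega

theorem mem_unitResonances {n : ℕ} {r : ℝ} (hr : r ∈ Set.Icc 0 1) {j : ℤ}
    (h : |r + ω₁ - j / S.Q n| < 2 * S.zoneWidth n) : j ∈ S.unitResonances n ω₁ := by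
  have hQ := S.Q_cast_pos n
  have rescaled : |S.Q n * (r + ω₁) - j| < 1 := by
    rw [abs_natCast_mul_sub (S.Q_pos n)]
    calc S.Q n * |r + ω₁ - j / S.Q n| < S.Q n * (2 * (1 / (2 * S.Q n))) := by
          gcongr
          linarith [S.zoneWidth_lt n]
      _ = 1 := by field_simp
  have floor_le := Int.floor_le (S.Q n * ω₁)
  have lt_floor := Int.lt_floor_add_one (S.Q n * ω₁)
  have mul_nonneg : 0 ≤ S.Q n * r := mul_nonneg hQ.le hr.1
  have mul_le : S.Q n * r ≤ S.Q n := mul_le_of_le_one_right hQ.le hr.2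
  rw [abs_lt] at rescaled
  refine Finset.mem_Icc.2 ⟨Int.lt_add_one_iff.1 ?_, Int.lt_add_one_iff.1 ?_⟩ <;>
    rify <;> linarith

/-- The union of the doubled zones of the resonances in `unitResonances`. -/
def resonantZone (n : ℕ) (ω₁ : ℝ) : Set ℝ :=
  ⋃ j ∈ S.unitResonances n ω₁, Metric.closedBall ((j : ℝ) / S.Q n - ω₁) (2 * S.zoneWidth n)

theorem diff_iUnion_resonantZone_subset (ω₁ : ℝ) :
    Set.Icc 0 1 \ ⋃ n, S.resonantZone n ω₁ ⊆ Set.Icc 0 1 ∩ S.flatSet ω₁ := by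
  rintro r ⟨hr, hrZ⟩
  refine ⟨hr, fun n j => ?_⟩
  by_contra! h
  refine hrZ (Set.mem_iUnion.2 ⟨n, Set.mem_iUnion₂.2 ⟨j, S.mem_unitResonances hr h, ?_⟩⟩)
  rw [Metric.mem_closedBall, Real.dist_eq, sub_sub_eq_add_sub]
  exact h.le

theorem card_mul_zoneWidth_le (n : ℕ) :
    ((S.Q n : ℝ) + 2) * (2 * (2 * S.zoneWidth n)) ≤ ε / 2 / 2 ^ n := by
  have hε := S.ε_pos
  have hlog := S.log_Q_pos n
  have hQ : (16 : ℝ) ≤ S.Q n := by exact_mod_cast (S.data n).le_Q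
  have pow_le_log := S.le_log n
  rw [div_le_iff₀ hε] at pow_le_log
  calc ((S.Q n : ℝ) + 2) * (2 * (2 * S.zoneWidth n))
      ≤ (2 * S.Q n) * (2 * (2 * S.zoneWidth n)) := by
        have := S.zoneWidth_pos n
        gcongr
        linarith
    _ = 8 / Real.log (S.Q n) := by
        rw [zoneWidth]
        field_simp
        norm_num
    _ ≤ ε / 2 / 2 ^ n := by
        rw [div_div, ← pow_succ', div_le_div_iff₀ hlog (by positivity)]
        linarith

theorem volume_resonantZone_le (n : ℕ) (ω₁ : ℝ) :
    MeasureTheory.volume (S.resonantZone n ω₁) ≤ ENNReal.ofReal (ε / 2 / 2 ^ n) := by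
  refine (MeasureTheory.measure_biUnion_finset_le _ _).trans ?_
  simp only [Real.volume_closedBall, Finset.sum_const, card_unitResonances, nsmul_eq_mul]
  rw [← ENNReal.ofReal_natCast, ← ENNReal.ofReal_mul (Nat.cast_nonneg _)]
  exact ENNReal.ofReal_le_ofReal (by exact_mod_cast S.card_mul_zoneWidth_le n)

theorem volume_iUnion_resonantZone_le (ω₁ : ℝ) :
    MeasureTheory.volume (⋃ n, S.resonantZone n ω₁) ≤ ENNReal.ofReal ε := by
  have hε := S.ε_pos
  have geometric := hasSum_geometric_two' ε
  refine (MeasureTheory.measure_iUnion_le _).trans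
    ((ENNReal.tsum_le_tsum fun n => S.volume_resonantZone_le n ω₁).trans ?_)
  rw [← ENNReal.ofReal_tsum_of_nonneg (fun n => by positivity) geometric.summable,
    geometric.tsum_eq]

theorem le_volume_flatSet (ω₁ : ℝ) :
    ENNReal.ofReal (1 - ε) ≤ MeasureTheory.volume (Set.Icc 0 1 ∩ S.flatSet ω₁) :=
  calc ENNReal.ofReal (1 - ε) = 1 - ENNReal.ofReal ε := by
        rw [ENNReal.ofReal_sub _ S.ε_pos.le, ENNReal.ofReal_one]
    _ ≤ MeasureTheory.volume (Set.Icc (0 : ℝ) 1) -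
        MeasureTheory.volume (⋃ n, S.resonantZone n ω₁) := by
        rw [Real.volume_Icc, sub_zero, ENNReal.ofReal_one]
        exact tsub_le_tsub_left (S.volume_iUnion_resonantZone_le ω₁) 1
    _ ≤ MeasureTheory.volume (Set.Icc (0 : ℝ) 1 \ ⋃ n, S.resonantZone n ω₁) :=
        MeasureTheory.le_measure_sdiff
    _ ≤ MeasureTheory.volume (Set.Icc 0 1 ∩ S.flatSet ω₁) :=
        MeasureTheory.measure_mono (S.diff_iUnion_resonantZone_subset ω₁)

/-! ### Periodicity, flatness and Gevrey norms of the perturbations -/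

theorem u_periodic (ω₁ : ℝ) (θ : UnitAddCircle) (r : ℝ) :
    S.u ω₁ (annulusPt θ (r + 1)) = S.u ω₁ (annulusPt θ r) :=
  tsum_congr fun n => congrArg (_ * ·) (S.actionBump_periodic ω₁ n r)

theorem v_periodic (ω₁ : ℝ) (θ : UnitAddCircle) (r : ℝ) (z : Annulus) :
    S.v ω₁ (phasePt (annulusPt θ (r + 1)) z) = S.v ω₁ (phasePt (annulusPt θ r) z) :=
  tsum_congr fun n => congrArg (_ * · * _) (S.actionBump_periodic ω₁ n r)

theorem isFlatOn_u (ω₁ : ℝ) : IsFlatOn (S.u ω₁ ∘ annulusCover) {x | x 1 ∈ S.flatSet ω₁} := by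
  intro x hx ℓ
  rw [S.u_comp_cover, multiDeriv_tensorSum (S.uFactor_bound ω₁) S.summable_uBound]
  exact S.tensorSum_eq_zero_of_mem_flatSet ω₁ (i := 1) (fun _ => rfl) hx ℓ

theorem isFlatOn_v (ω₁ : ℝ) : IsFlatOn (S.v ω₁ ∘ phaseCover) {x | x 1 ∈ S.flatSet ω₁} := by
  intro x hx ℓ
  rw [S.v_comp_cover, multiDeriv_tensorSum (S.vFactor_bound ω₁) S.summable_vBound]
  exact S.tensorSum_eq_zero_of_mem_flatSet ω₁ (i := 1) (fun _ => rfl) hx ℓ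

end ResonanceSeq

section

variable {α L C ε : ℝ} (S : ResonanceSeq α (1 / (2 * L ^ α)) C ε) (ω₁ : ℝ)

theorem ResonanceSeq.gevreyNorm_u_le (hL : 0 < L) :
    gevreyNorm α L (S.u ω₁ ∘ annulusCover) ≤ ENNReal.ofReal (ε / 8) := by
  rw [S.u_comp_cover]
  refine (gevreyNorm_tensorSum_le hL (S.uFactor_bound ω₁) S.summable_uBound).trans ?_
  rw [show (2 : ℝ≥0∞) ^ 2 = ENNReal.ofReal 4 by norm_num, ← ENNReal.ofReal_mul (by norm_num)]
  exact ENNReal.ofReal_le_ofReal (by linarith [S.tsum_uBound_le])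

theorem ResonanceSeq.gevreyNorm_v_le (hL : 0 < L) :
    gevreyNorm α L (S.v ω₁ ∘ phaseCover) ≤ ENNReal.ofReal (ε / 2) := by
  rw [S.v_comp_cover]
  refine (gevreyNorm_tensorSum_le hL (S.vFactor_bound ω₁) S.summable_vBound).trans ?_
  rw [show (2 : ℝ≥0∞) ^ 4 = ENNReal.ofReal 16 by norm_num, ← ENNReal.ofReal_mul (by norm_num)]
  exact ENNReal.ofReal_le_ofReal (by linarith [S.tsum_vBound_le])

theorem ResonanceSeq.isGevrey_u (hL : 0 < L) : IsGevrey α L (S.u ω₁ ∘ annulusCover) := by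
  refine ⟨?_, (S.gevreyNorm_u_le ω₁ hL).trans_lt ENNReal.ofReal_lt_top⟩
  rw [S.u_comp_cover]
  exact contDiff_tensorSum (S.uFactor_bound ω₁) S.summable_uBound 0

theorem ResonanceSeq.isGevrey_v (hL : 0 < L) : IsGevrey α L (S.v ω₁ ∘ phaseCover) := by
  refine ⟨?_, (S.gevreyNorm_v_le ω₁ hL).trans_lt ENNReal.ofReal_lt_top⟩
  rw [S.v_comp_cover]
  exact contDiff_tensorSum (S.vFactor_bound ω₁) S.summable_vBound 0

theorem ResonanceSeq.gevreyNorm_add_lt (hL : 0 < L) :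
    gevreyNorm α L (S.u ω₁ ∘ annulusCover) + gevreyNorm α L (S.v ω₁ ∘ phaseCover) <
      ENNReal.ofReal ε := by
  have hε := S.ε_pos
  refine (add_le_add (S.gevreyNorm_u_le ω₁ hL) (S.gevreyNorm_v_le ω₁ hL)).trans_lt ?_
  rw [← ENNReal.ofReal_add (by positivity) (by positivity), ENNReal.ofReal_lt_ofReal_iff hε]
  linarith

end

end ManyTori

end

open ManyTori in
theorem mainTheorem4 (α L : ℝ) (hα : 1 < α) (hL : 0 < L) :
    ∃ C : ℝ, 0 < C ∧ ∀ ω₁ ω₂ ε : ℝ, 0 < ε →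
      ∃ (u : Annulus → ℝ) (v : Phase → ℝ) (X : Set ℝ),
        -- `u ∈ G^{α,L}(M₁)` and `v ∈ G^{α,L}(M₁ × M₂)`
        IsGevrey α L (u ∘ annulusCover) ∧ IsGevrey α L (v ∘ phaseCover) ∧
        -- `u` and `v` are `1`-periodic in `r₁`
        (∀ θ₁ r₁, u (annulusPt θ₁ (r₁ + 1)) = u (annulusPt θ₁ r₁)) ∧
        (∀ θ₁ r₁ z₂, v (phasePt (annulusPt θ₁ (r₁ + 1)) z₂) =
          v (phasePt (annulusPt θ₁ r₁) z₂)) ∧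
        -- the set `X`
        IsClosed X ∧ X ⊆ Set.Icc 0 1 ∧
        ENNReal.ofReal (1 - ε) ≤ MeasureTheory.volume X ∧
        -- (1) flatness for `r₁ ∈ X + ℤ`
        IsFlatOn (u ∘ annulusCover) {x | x 1 ∈ addInt X} ∧
        IsFlatOn (v ∘ phaseCover) {x | x 1 ∈ addInt X} ∧
        -- (2) smallness
        gevreyNorm α L (u ∘ annulusCover) + gevreyNorm α L (v ∘ phaseCover) < ENNReal.ofReal ε ∧
        -- (3) the flows of `u` and `v` are complete and, for `T = Φ^v ∘ Φ^u ∘ T₀`, the tori are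
        -- invariant and diffusive-`*`, and so is their union
        ∃ Φu Φv : Phase → Phase, IsTimeOneMap (extend u) Φu ∧ IsTimeOneMap v Φv ∧
          (∀ r₁ ∈ addInt X, ∀ r₂ : ℝ,
            (Φv ∘ Φu ∘ T₀ ω₁ ω₂) '' torus r₁ r₂ = torus r₁ r₂ ∧
            IsDiffusiveStar C (1 / (α - 1)) (Φv ∘ Φu ∘ T₀ ω₁ ω₂) (torus r₁ r₂)) ∧
          IsDiffusiveStar C (1 / (α - 1)) (Φv ∘ Φu ∘ T₀ ω₁ ω₂)
            {z : Phase | z.fst.snd ∈ addInt X} := by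
  obtain ⟨C, hC, exists_seq⟩ := exists_resonanceSeq (R := 1 / (2 * L ^ α)) hα (by positivity)
  refine ⟨C, hC, fun ω₁ ω₂ ε hε => ?_⟩
  obtain ⟨S⟩ := exists_seq ε hε
  obtain ⟨Φu, hu⟩ := S.exists_isTimeOneMap_u ω₁
  obtain ⟨Φv, hv⟩ := S.exists_isTimeOneMap_v ω₁
  have subset_flatSet := S.addInt_subset_flatSet ω₁
  have diffusive := (S.isDiffusiveStar (ω₂ := ω₂) hu hv).mono
    fun z (hz : z.fst.snd ∈ addInt (Set.Icc 0 1 ∩ S.flatSet ω₁)) => subset_flatSet hz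
  refine ⟨S.u ω₁, S.v ω₁, Set.Icc 0 1 ∩ S.flatSet ω₁, S.isGevrey_u ω₁ hL, S.isGevrey_v ω₁ hL,
    S.u_periodic ω₁, S.v_periodic ω₁, isClosed_Icc.inter (S.isClosed_flatSet ω₁),
    Set.inter_subset_left, S.le_volume_flatSet ω₁,
    fun x hx => S.isFlatOn_u ω₁ x (subset_flatSet hx),
    fun x hx => S.isFlatOn_v ω₁ x (subset_flatSet hx), S.gevreyNorm_add_lt ω₁ hL,
    Φu, Φv, hu, hv,
    fun r₁ hr₁ r₂ => ⟨S.image_torus hu hv (subset_flatSet hr₁) r₂, diffusive.mono ?_⟩, diffusive⟩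
  rintro z ⟨rfl, -⟩
  exact hr₁
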